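/- Let $m\ge 1$, let $\mathcal P_n$ be the space of holomorphic polynomials on $\mathbb C^m$ of degree at most $n$, and let $d_n=\binom{m+n}{n}=\dim\mathcal P_n$. Let $K\subset\mathbb C^m$ be a locally regular compact set, i.e. for every $z\in K$ and all sufficiently small $r>0$ the pluricomplex Green function $V_{K\cap\overline{B(z,r)}}$ is continuous at $z$, where $V_E(z)=\sup\{u(z): u\in\mathcal L(\mathbb C^m),\ u|_E\le 0\}$ and $\mathcal L(\mathbb C^m)$ is the Lelong class of plurisubharmonic functions $u$ on $\mathbb C^m$ with $u(\zeta)-\log|\zeta|$ bounded above near infinity. Let $q:K\to\mathbb R$ be continuous. For each $n\ge1$ let $\{p_{nj}\}_{j=1}^{d_n}$ be a basis of $\mathcal P_n$ (not necessarily orthonormal) with $\sup_K|p_{nj}e^{-nq}|\le 1$ for all $j$, and consider the random polynomial $$f_n(z)=\sum_{j=1}^{d_n}a^{(n)}_j\,p_{nj}(z),\qquad a^{(n)}=(a^{(n)}_1,\dots,a^{(n)}_{d_n})\sim\mu_n .$$ Here either $\mu_n$ is, for every $n$, the Gaussian measure $\pi^{-d_n}e^{-\|a\|^2}\,d\lambda(a)$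 on $\mathbb C^{d_n}$, or $\mu_n$ is, for every $n$, the Fubini–Study measure $\frac{d_n!}{\pi^{d_n}}(1+\|a\|^2)^{-(d_n+1)}\,d\lambda(a)$ on $\mathbb C^{d_n}$, where $\lambda$ is Lebesgue measure. For a polynomial $f$ with zero set $Z_f$ and a real-valued test form $\varphi$ (smooth, compactly supported) of bidegree $(m-1,m-1)$ on $\mathbb C^m$, put $\langle[Z_f],\varphi\rangle=\int_{\mathrm{Reg}\,Z_f}\varphi$, where $\mathrm{Reg}\,Z_f$ is the set of regular points of $Z_f$. Then for every such $\varphi$, $$\mathrm{Var}\Big\langle \tfrac1n[Z_{f_n}],\varphi\Big\rangle=O\!\left(\tfrac1{n^2}\right).$$ More precisely, for every $n\ge 1$ the integral $\int_{\mathrm{Reg}\,Z_{f_n}}\varphi$ converges absolutely for $\mu_n$-almost every $f_n$, the random variable $\langle \frac1n[Z_{f_n}],\varphi\rangle$ is square integrable, and there is a constant $C$, depending on $\varphi$ and on the choice between the Gaussian and the Fubini–Study case, but not on $n$, $K$, $q$ or the bases, such that $\mathrm{Var}\langle \frac1n[Z_{f_n}],\varphi\rangle\le C/n^2$ for all $n\ge1$.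 -/

import Mathlib

open MeasureTheory ProbabilityTheory Filter Topology
open scoped ContDiff

noncomputable section

/-- `ℂ^m` with its Euclidean norm. -/
abbrev CSpace (m : ℕ) : Type := EuclideanSpace ℂ (Fin m)

/-! ### Pluripotential theory on `ℂ^m` -/

/-- Plurisubharmonic functions `ℂ^m → [-∞, ∞)`: upper semicontinuous functions satisfying the
sub-mean value inequality on every circle of every complex line. The mean of `u` over a circle, a
number in `[-∞, ∞)`, is the infimum over `N` of the means of the truncations `max u N`, so the
inequality is required for all truncations. -/
def IsPlurisubharmonic {m : ℕ} (u : CSpace m → EReal) : Prop :=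
  UpperSemicontinuous u ∧ (∀ z, u z < ⊤) ∧
    ∀ (a b : CSpace m) (N : ℝ),
      u a ≤ ((Real.circleAverage (fun ζ : ℂ => (max (u (a + ζ • b)) (N : EReal)).toReal) 0 1 : ℝ) :
        EReal)

/-- The Lelong class: plurisubharmonic `u` on `ℂ^m` such that `u(ζ) - log ‖ζ‖` is bounded above
near infinity. -/
def LelongClass (m : ℕ) : Set (CSpace m → EReal) :=
  {u | IsPlurisubharmonic u ∧
    ∃ C R : ℝ, ∀ ζ : CSpace m, R ≤ ‖ζ‖ → u ζ ≤ ((Real.log ‖ζ‖ + C : ℝ) : EReal)}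

/-- The pluricomplex Green function `V_K` of a set `K ⊆ ℂ^m`. -/
def pluricomplexGreen {m : ℕ} (K : Set (CSpace m)) (z : CSpace m) : EReal :=
  sSup {t : EReal | ∃ u ∈ LelongClass m, (∀ w ∈ K, u w ≤ 0) ∧ t = u z}

/-- `K` is locally regular: for every `z ∈ K` and all sufficiently small `r > 0`, the pluricomplex
Green function of `K ∩ closedBall z r` is continuous at `z`. -/
def IsLocallyRegular {m : ℕ} (K : Set (CSpace m)) : Prop :=
  ∀ z ∈ K, ∀ᶠ r in 𝓝[>] (0 : ℝ),
    ContinuousAt (pluricomplexGreen (K ∩ Metric.closedBall z r)) z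

/-! ### Random polynomials -/

/-- The space `𝒫_n` of holomorphic polynomials on `ℂ^m` of degree at most `n`. -/
abbrev PolySpace (m n : ℕ) : Submodule ℂ (MvPolynomial (Fin m) ℂ) :=
  MvPolynomial.restrictTotalDegree (Fin m) ℂ n

/-- `d_n = dim 𝒫_n = binom (m + n) n`. -/
abbrev polyDim (m n : ℕ) : ℕ := (m + n).choose n

/-- The value of a polynomial at a point of `ℂ^m`. -/
def polyEval {m : ℕ} (f : MvPolynomial (Fin m) ℂ) (z : CSpace m) : ℂ :=
  MvPolynomial.eval (fun i => z i) f

/-- The polynomial `∑ j, a j * p j` with coefficient vector `a` in the basis `p` of `𝒫_n`. -/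
def randomPoly {m n : ℕ} (p : Module.Basis (Fin (polyDim m n)) ℂ (PolySpace m n))
    (a : Fin (polyDim m n) → ℂ) : MvPolynomial (Fin m) ℂ :=
  ∑ j, a j • (p j : MvPolynomial (Fin m) ℂ)

/-- The Gaussian measure on `ℂ^d`, with density `π^{-d} exp (-‖a‖²)`. -/
def complexGaussian (d : ℕ) : Measure (Fin d → ℂ) :=
  volume.withDensity fun a =>
    ENNReal.ofReal (1 / Real.pi ^ d * Real.exp (-∑ j, ‖a j‖ ^ 2))

/-- The Fubini–Study measure on `ℂ^d ⊂ ℂℙ^d`, with density `(d! / π^d) (1 + ‖a‖²)^{-(d+1)}`. -/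
def fubiniStudy (d : ℕ) : Measure (Fin d → ℂ) :=
  volume.withDensity fun a =>
    ENNReal.ofReal ((d.factorial : ℝ) / Real.pi ^ d * (1 / (1 + ∑ j, ‖a j‖ ^ 2) ^ (d + 1)))

/-! ### Test forms and currents of integration -/

/-- Real-valued test forms of bidegree `(m-1, m-1)` on `ℂ^m`: smooth compactly supported real
differential forms of degree `2 (m-1)`. Since a form of bidegree `(p, q)` is multiplied by
`c ^ (p - q)` when all of its arguments are multiplied by a complex number `c` of modulus one, a
form of degree `2 (m-1)` has bidegree `(m-1, m-1)` if and only if it is invariant under all these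
multiplications. -/
structure TestForm (m : ℕ) where
  /-- the underlying differential form -/
  form : CSpace m → (CSpace m [⋀^Fin ((m - 1) * 2)]→L[ℝ] ℝ)
  smooth : ContDiff ℝ ∞ form
  compactSupport : HasCompactSupport form
  bidegree : ∀ (z : CSpace m) (c : ℂ), ‖c‖ = 1 → ∀ v : Fin ((m - 1) * 2) → CSpace m,
    form z (fun i => c • v i) = form z v

/-- `g` is a local defining function of `Z` at `z`: it is holomorphic near `z`, has non-zero
differential at `z`, and near `z` the set `Z` is the zero set of `g`. -/
def IsLocalDefiningFunction {m : ℕ} (Z : Set (CSpace m)) (z : CSpace m) (g : CSpace m → ℂ) :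
    Prop :=
  ∃ U : Set (CSpace m), IsOpen U ∧ z ∈ U ∧ DifferentiableOn ℂ g U ∧ fderiv ℂ g z ≠ 0 ∧
    Z ∩ U = {w ∈ U | g w = 0}

/-- The regular points of a hypersurface `Z`: the points near which `Z` is a complex submanifold of
dimension `m - 1`. -/
def regularPoints {m : ℕ} (Z : Set (CSpace m)) : Set (CSpace m) :=
  {z ∈ Z | ∃ g, IsLocalDefiningFunction Z z g}

/-- `v` is a unitary basis of the complex tangent hyperplane of `Z` at the regular point `z`. -/
def IsUnitaryTangentFrame {m : ℕ} (Z : Set (CSpace m)) (z : CSpace m)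
    (v : Fin (m - 1) → CSpace m) : Prop :=
  Orthonormal ℂ v ∧ ∃ g, IsLocalDefiningFunction Z z g ∧ ∀ j, fderiv ℂ g z (v j) = 0

/-- The real frame `v₁, i v₁, v₂, i v₂, …` underlying a complex frame `v₁, v₂, …`. -/
def realFrame {m k : ℕ} (v : Fin k → CSpace m) : Fin (k * 2) → CSpace m :=
  fun l => Complex.I ^ (l.modNat : ℕ) • v l.divNat

open Classical in
/-- The density of the restriction of the form `η` to `Z` with respect to the surface measure: the
value of `η` on the real frame `v₁, i v₁, …` of a unitary basis of the tangent space. That frame is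
orthonormal and positively oriented for the complex orientation, and the value does not depend on
the choice of the unitary basis. -/
def tangentialDensity {m : ℕ} (Z : Set (CSpace m))
    (η : CSpace m → (CSpace m [⋀^Fin ((m - 1) * 2)]→L[ℝ] ℝ)) (z : CSpace m) : ℝ :=
  if h : ∃ v, IsUnitaryTangentFrame Z z v then η z (realFrame h.choose) else 0

/-- The surface measure on the regular points of `Z`: the `2 (m-1)`-dimensional Hausdorff measure,
normalised to agree with Lebesgue measure in Euclidean space. -/
def surfaceMeasure {m : ℕ} (Z : Set (CSpace m)) : Measure (CSpace m) :=
  (Measure.euclideanHausdorffMeasure ((m - 1) * 2)).restrict (regularPoints Z)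

/-- The zero set `Z_f` of a polynomial. -/
def zeroSet {m : ℕ} (f : MvPolynomial (Fin m) ℂ) : Set (CSpace m) :=
  {z | polyEval f z = 0}

/-- The pairing `⟨[Z_f], φ⟩ = ∫_{Reg Z_f} φ` of the current of integration with a test form. -/
def currentPairing {m : ℕ} (f : MvPolynomial (Fin m) ℂ) (φ : TestForm m) : ℝ :=
  ∫ z, tangentialDensity (zeroSet f) φ.form z ∂(surfaceMeasure (zeroSet f))

/-- The random variable `⟨(1/n) [Z_{f_n}], φ⟩`, as a function of the coefficients of `f_n`. -/
def zeroStatistic {m n : ℕ} (p : Module.Basis (Fin (polyDim m n)) ℂ (PolySpace m n))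
    (φ : TestForm m) (a : Fin (polyDim m n) → ℂ) : ℝ :=
  (1 / (n : ℝ)) * currentPairing (randomPoly p a) φ

end

/-!
The variance bound follows from an exact formula for the statistic and from a bound for the second
moment of `log |⟨a, u⟩|`, where `u` is a unit vector, that is uniform in the dimension.

**The formula.** Let `f` be a polynomial with 0 as a regular value. The value of a form `η` of
degree `2(m-1)` on the complex hyperplane orthogonal to a unit vector `ν` is a fixed linear
combination, with coefficients linear in `η`, of finitely many squared cosines `|⟨b, ν⟩|²`
(`exists_realFrame_eq_sum_norm_inner_sq`): wedge `η` with the area form of the line spanned by `ν`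
and evaluate on a fixed frame, which gives the same value as the frame adapted to `ν` because
unitary maps have real determinant one. On the zero set `Z` of `f`, the factor `|⟨b, ν⟩|²` is the
Jacobian of the orthogonal projection of `Z` along `b`. So integrating `|⟨b, ν⟩|² χ` over `Z` means
summing `χ` over the zeros of `f` on each complex line parallel to `b`, and then integrating over
these lines (`integral_normalCosSq_mul_eq_integral_roots`). In one variable the sum of `χ` over the
zeros of a polynomial `g` is `(2π)⁻¹ ∫ log |g| Δχ` (`integral_log_norm_polynomial_mul_laplacian`).
Together these are the Poincaré–Lelong formula `⟨[Z_f], φ⟩ = ∫ log |f| ψ`, where `ψ` is continuous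
with compact support and depends on `φ` only (`exists_currentPairing_eq_integral_log`). It applies
to almost every `f_n`, since the polynomials with a singular zero form the image of a space of
smaller dimension (`ae_forall_fderiv_polyEval_ne_zero`).

**The variance.** Write `f_n(z) = |p(z)| ⟨a, u(z)⟩`, where `p(z)` is the vector of values of the
basis and `u(z)` has norm one. Then `log |f_n| = log |p| + log |⟨a, u⟩|`, and the first term is not
random: it changes the statistic by a constant. By the Cauchy–Schwarz inequality and Tonelli's
theorem, the variance of `∫ log |⟨a, u(z)⟩| ψ(z) dz` is at most a constant depending on `ψ`
times the supremum of `E (log |⟨a, u⟩|)²` over unit vectors `u`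
(`memLp_integral_mul_of_lintegral_sq_le`). The law of `⟨a, u⟩` is the same for all unit vectors in
all dimensions, in the Gaussian and in the Fubini–Study case, and it integrates `log²`
(`exists_bound_sq_log_linearForm`). The factor `1/n` in the statistic becomes `1/n²`.
-/

/-! ### The logarithmic potential of a polynomial in one variable -/

/-- The second derivative of `χ` in the real direction `v`. -/
noncomputable def secondDeriv {V : Type*} [NormedAddCommGroup V] [NormedSpace ℝ V] (χ : V → ℝ)
    (v z : V) : ℝ :=
  fderiv ℝ (fun w => fderiv ℝ χ w v) z v

theorem continuous_secondDeriv {V : Type*} [NormedAddCommGroup V] [NormedSpace ℝ V] {χ : V → ℝ}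
    (hχ : ContDiff ℝ ∞ χ) (v : V) : Continuous (secondDeriv χ v) := by
  have h1 : ContDiff ℝ ∞ (fun w => fderiv ℝ χ w v) :=
    (hχ.fderiv_right (m := ∞) (by simp)).clm_apply contDiff_const
  exact (h1.continuous_fderiv (by simp)).clm_apply continuous_const

theorem hasCompactSupport_secondDeriv {V : Type*} [NormedAddCommGroup V] [NormedSpace ℝ V]
    {χ : V → ℝ} (hχ : HasCompactSupport χ) (v : V) : HasCompactSupport (secondDeriv χ v) :=
  (hχ.fderiv_apply ℝ v).fderiv_apply ℝ v

theorem abs_log_le_add_inv {x : ℝ} (hx : 0 ≤ x) : |Real.log x| ≤ x + x⁻¹ := by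
  rcases hx.eq_or_lt with rfl | hx
  · simp
  have h1 := Real.log_le_self hx.le
  have h2 := Real.log_le_self (inv_pos.2 hx).le
  rw [Real.log_inv] at h2
  have := inv_pos.2 hx
  rw [abs_le]; constructor <;> linarith

theorem integrable_inv_norm_mul_exp :
    Integrable (fun s : ℂ => ‖s‖⁻¹ * Real.exp (-‖s‖ ^ 2)) := by
  have h := Complex.integral_rpow_mul_exp_neg_rpow (p := 2) (q := -1) (by norm_num) (by norm_num)
  have h2 : Integrable (fun s : ℂ => ‖s‖ ^ (-1 : ℝ) * Real.exp (-‖s‖ ^ (2 : ℝ))) := by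
    by_contra hc
    rw [integral_undef hc] at h
    have : 0 < (2 * Real.pi / 2) * Real.Gamma ((-1 + 2) / 2) := by
      have := Real.Gamma_pos_of_pos (s := (-1 + 2) / 2) (by norm_num)
      positivity
    exact this.ne h
  simpa [Real.rpow_neg_one] using h2

theorem integrable_inv_norm_mul {h : ℂ → ℝ} (hc : Continuous h) (hs : HasCompactSupport h) :
    Integrable (fun s : ℂ => ‖s‖⁻¹ * h s) := by
  have hc' : Continuous (fun s : ℂ => Real.exp (‖s‖ ^ 2) * h s) := by fun_prop
  have hs' : HasCompactSupport (fun s : ℂ => Real.exp (‖s‖ ^ 2) * h s) := hs.mul_left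
  obtain ⟨C, hC⟩ := hc'.bounded_above_of_compact_support hs'
  have := integrable_inv_norm_mul_exp.mul_bdd hc'.aestronglyMeasurable (ae_of_all _ hC)
  refine this.congr (ae_of_all _ fun s => ?_)
  have : Real.exp (-‖s‖ ^ 2) * Real.exp (‖s‖ ^ 2) = 1 := by rw [← Real.exp_add]; simp
  simp only
  linear_combination (‖s‖⁻¹ * h s) * this

theorem integrable_log_norm_mul {h : ℂ → ℝ} (hc : Continuous h) (hs : HasCompactSupport h) :
    Integrable (fun s : ℂ => Real.log ‖s‖ * h s) := by
  have h1 : Integrable (fun s : ℂ => ‖s‖ * |h s|) :=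
    Continuous.integrable_of_hasCompactSupport (by fun_prop) (hs.abs.mul_left)
  have h2 := integrable_inv_norm_mul (h := fun s => |h s|) (by fun_prop) hs.abs
  refine (h1.add h2).mono' ((Measurable.aestronglyMeasurable (by fun_prop)).mul
    hc.aestronglyMeasurable) (ae_of_all _ fun s => ?_)
  have := abs_log_le_add_inv (norm_nonneg s)
  simp only [Real.norm_eq_abs, abs_mul, Pi.add_apply]
  nlinarith [abs_nonneg (h s)]

theorem fderiv_regularized_log {ε : ℝ} (hε : 0 < ε) (s v : ℂ) :
    DifferentiableAt ℝ (fun s : ℂ => Real.log (‖s‖ ^ 2 + ε) / 2) s ∧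
    fderiv ℝ (fun s : ℂ => Real.log (‖s‖ ^ 2 + ε) / 2) s v = inner ℝ s v / (‖s‖ ^ 2 + ε) := by
  have h1 : HasFDerivAt (fun s : ℂ => ‖s‖ ^ 2) (2 • (innerSL ℝ s)) s :=
    (hasStrictFDerivAt_norm_sq s).hasFDerivAt
  have hp : ‖s‖ ^ 2 + ε ≠ 0 := by positivity
  have h2 := ((h1.add_const ε).log hp).mul_const (2⁻¹ : ℝ)
  refine ⟨h2.differentiableAt, ?_⟩
  have := h2.fderiv
  simp only [← div_eq_mul_inv] at this
  rw [this]
  simp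
  field_simp

/-- Integration by parts against `log |s|`, as the limit of integration by parts against the smooth
functions `log (|s|² + ε) / 2`. -/
theorem integral_log_norm_mul_fderiv {g : ℂ → ℝ} (hg : ContDiff ℝ 1 g) (hs : HasCompactSupport g)
    (v : ℂ) :
    ∫ s : ℂ, Real.log ‖s‖ * fderiv ℝ g s v = - ∫ s : ℂ, (inner ℝ s v * (‖s‖ ^ 2)⁻¹) * g s := by
  have hg' : Continuous (fun s => fderiv ℝ g s v) :=
    (hg.continuous_fderiv one_ne_zero).clm_apply continuous_const
  have hgs' : HasCompactSupport (fun s => fderiv ℝ g s v) := hs.fderiv_apply ℝ v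
  have ibp : ∀ ε : ℝ, 0 < ε → ∫ s : ℂ, (Real.log (‖s‖ ^ 2 + ε) / 2) * fderiv ℝ g s v =
      - ∫ s : ℂ, (inner ℝ s v / (‖s‖ ^ 2 + ε)) * g s := by
    intro ε hε
    have hc : Continuous (fun s : ℂ => Real.log (‖s‖ ^ 2 + ε) / 2) :=
      (Continuous.log (by fun_prop) fun s => by positivity).div_const _
    have hc2 : Continuous (fun s : ℂ => inner ℝ s v / (‖s‖ ^ 2 + ε)) :=
      Continuous.div (by fun_prop) (by fun_prop) fun s => by positivity
    have e := fun s => (fderiv_regularized_log hε s v).2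
    have := integral_mul_fderiv_eq_neg_fderiv_mul_of_integrable (μ := (volume : Measure ℂ))
      (f := fun s : ℂ => Real.log (‖s‖ ^ 2 + ε) / 2) (g := g) (v := v)
      (by simp only [e]; exact (hc2.mul hg.continuous).integrable_of_hasCompactSupport hs.mul_left)
      ((hc.mul hg').integrable_of_hasCompactSupport hgs'.mul_left)
      ((hc.mul hg.continuous).integrable_of_hasCompactSupport hs.mul_left)
      (fun s _ => (fderiv_regularized_log hε s v).1)
      (fun s _ => hg.differentiable one_ne_zero s)
    rw [this]; simp only [e]
  have l1 : Tendsto (fun ε : ℝ => ∫ s : ℂ, (Real.log (‖s‖ ^ 2 + ε) / 2) * fderiv ℝ g s v) (𝓝[>] 0)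
      (𝓝 (∫ s : ℂ, Real.log ‖s‖ * fderiv ℝ g s v)) := by
    refine tendsto_integral_filter_of_dominated_convergence
      (fun s => ‖s‖⁻¹ * |fderiv ℝ g s v| + (‖s‖ ^ 2 + 1) * |fderiv ℝ g s v|) ?_ ?_ ?_ ?_
    · filter_upwards with ε
      exact (Measurable.aestronglyMeasurable (by fun_prop)).mul hg'.aestronglyMeasurable
    · filter_upwards [Ioc_mem_nhdsGT one_pos] with ε hε
      filter_upwards [compl_mem_ae_iff.2 (measure_singleton (0 : ℂ))] with s h0
      have h0 : 0 < ‖s‖ := norm_pos_iff.2 h0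
      rw [norm_mul, ← add_mul, Real.norm_eq_abs, Real.norm_eq_abs]
      refine mul_le_mul_of_nonneg_right ?_ (abs_nonneg _)
      have h1 := Real.log_le_self (x := ‖s‖ ^ 2 + ε) (by nlinarith [hε.1])
      have h2 : Real.log (‖s‖ ^ 2) ≤ Real.log (‖s‖ ^ 2 + ε) :=
        Real.log_le_log (by positivity) (by linarith [hε.1])
      rw [Real.log_pow] at h2
      have h3 := Real.log_le_self (inv_pos.2 h0).le
      rw [Real.log_inv] at h3
      have h4 := inv_pos.2 h0
      push_cast at h2
      rw [abs_le]; constructor <;> nlinarith [hε.2, sq_nonneg ‖s‖]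
    · exact (integrable_inv_norm_mul (h := fun s => |fderiv ℝ g s v|) (by fun_prop) hgs'.abs).add
        (Continuous.integrable_of_hasCompactSupport (by fun_prop) hgs'.abs.mul_left)
    · filter_upwards [compl_mem_ae_iff.2 (measure_singleton (0 : ℂ))] with s h0
      have h0 : 0 < ‖s‖ := norm_pos_iff.2 h0
      refine Tendsto.mul_const _ (tendsto_nhdsWithin_of_tendsto_nhds ?_)
      have : Real.log ‖s‖ = Real.log (‖s‖ ^ 2 + 0) / 2 := by
        rw [add_zero, Real.log_pow]; push_cast; ring
      rw [this]
      refine ContinuousAt.div_const (ContinuousAt.log (by fun_prop) (by positivity)) _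
  have l2 : Tendsto (fun ε : ℝ => - ∫ s : ℂ, (inner ℝ s v / (‖s‖ ^ 2 + ε)) * g s) (𝓝[>] 0)
      (𝓝 (- ∫ s : ℂ, (inner ℝ s v * (‖s‖ ^ 2)⁻¹) * g s)) := by
    refine Tendsto.neg (tendsto_integral_filter_of_dominated_convergence
      (fun s => ‖s‖⁻¹ * (‖v‖ * |g s|)) ?_ ?_ ?_ ?_)
    · filter_upwards with ε
      exact (Measurable.aestronglyMeasurable (by fun_prop)).mul hg.continuous.aestronglyMeasurable
    · filter_upwards [self_mem_nhdsWithin] with ε hε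
      filter_upwards [compl_mem_ae_iff.2 (measure_singleton (0 : ℂ))] with s h0
      have h0 : 0 < ‖s‖ := norm_pos_iff.2 h0
      have hε : 0 < ε := hε
      have h1 := abs_real_inner_le_norm s v
      rw [norm_mul, Real.norm_eq_abs, Real.norm_eq_abs, abs_div, abs_of_pos (a := ‖s‖ ^ 2 + ε)
        (by positivity), ← mul_assoc]
      refine mul_le_mul_of_nonneg_right ?_ (abs_nonneg _)
      rw [div_le_iff₀ (by positivity)]
      calc |inner ℝ s v| ≤ ‖s‖ * ‖v‖ := h1
        _ = ‖s‖⁻¹ * ‖v‖ * ‖s‖ ^ 2 := by field_simp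
        _ ≤ _ := by gcongr; linarith
    · exact integrable_inv_norm_mul (h := fun s => ‖v‖ * |g s|)
        (by have := hg.continuous; fun_prop) hs.abs.mul_left
    · filter_upwards [compl_mem_ae_iff.2 (measure_singleton (0 : ℂ))] with s h0
      have h0 : 0 < ‖s‖ := norm_pos_iff.2 h0
      refine Tendsto.mul_const _ (tendsto_nhdsWithin_of_tendsto_nhds ?_)
      have : inner ℝ s v * (‖s‖ ^ 2)⁻¹ = inner ℝ s v / (‖s‖ ^ 2 + 0) := by
        rw [add_zero, div_eq_mul_inv]
      rw [this]
      refine ContinuousAt.div (by fun_prop) (by fun_prop) (by positivity)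
  refine tendsto_nhds_unique l1 (l2.congr' ?_)
  filter_upwards [self_mem_nhdsWithin] with ε hε using (ibp ε hε).symm

/-- Integrating the radial derivative over the rays from the origin recovers the value there. -/
theorem integral_inv_norm_sq_mul_radial {χ : ℂ → ℝ} (hχ : ContDiff ℝ 1 χ)
    (hs : HasCompactSupport χ) :
    ∫ s : ℂ, (‖s‖ ^ 2)⁻¹ * fderiv ℝ χ s s = - (2 * Real.pi * χ 0) := by
  have hint : Integrable (fun s : ℂ => (‖s‖ ^ 2)⁻¹ * fderiv ℝ χ s s) := by
    refine (integrable_inv_norm_mul (h := fun s => ‖fderiv ℝ χ s‖)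
      (hχ.continuous_fderiv one_ne_zero).norm (hs.fderiv ℝ).norm).mono' ?_ (ae_of_all _ fun s => ?_)
    · have h1 : Continuous (fun s => fderiv ℝ χ s s) :=
        (hχ.continuous_fderiv one_ne_zero).clm_apply continuous_id
      exact (Measurable.aestronglyMeasurable (by fun_prop)).mul h1.aestronglyMeasurable
    · have h1 := (fderiv ℝ χ s).le_opNorm s
      rcases eq_or_ne s 0 with rfl | h0
      · simp
      have h0 : 0 < ‖s‖ := norm_pos_iff.2 h0
      rw [norm_mul, norm_inv, norm_pow, norm_norm]
      calc (‖s‖ ^ 2)⁻¹ * ‖fderiv ℝ χ s s‖ ≤ (‖s‖ ^ 2)⁻¹ * (‖fderiv ℝ χ s‖ * ‖s‖) := by gcongr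
        _ = _ := by field_simp
  rw [← Complex.integral_comp_polarCoord_symm]
  have hpt : ∀ p ∈ polarCoord.target, p.1 • ((‖Complex.polarCoord.symm p‖ ^ 2)⁻¹ *
      fderiv ℝ χ (Complex.polarCoord.symm p) (Complex.polarCoord.symm p)) =
      deriv (fun r : ℝ => χ ((r : ℂ) * (Real.cos p.2 + Real.sin p.2 * Complex.I))) p.1 := by
    rintro ⟨r, θ⟩ hp
    have hr : 0 < r := hp.1
    have hd : HasDerivAt (fun r : ℝ => χ ((r : ℂ) * (Real.cos θ + Real.sin θ * Complex.I)))
        (fderiv ℝ χ ((r : ℂ) * (Real.cos θ + Real.sin θ * Complex.I))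
          (1 * (Real.cos θ + Real.sin θ * Complex.I))) r :=
      ((hχ.differentiable one_ne_zero _).hasFDerivAt).comp_hasDerivAt r
        ((Complex.ofRealCLM.hasDerivAt (x := r)).mul_const _)
    simp only
    rw [hd.deriv, Complex.norm_polarCoord_symm, Complex.polarCoord_symm_apply]
    simp only
    have : (r : ℂ) * (Real.cos θ + Real.sin θ * Complex.I) =
      r • ((Real.cos θ : ℂ) + Real.sin θ * Complex.I) := Complex.real_smul.symm
    rw [one_mul]
    conv_lhs => enter [2, 2, 2]; rw [this]
    rw [map_smul, sq_abs, smul_eq_mul, smul_eq_mul]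
    field_simp
  have hmeas : MeasurableSet polarCoord.target := polarCoord.open_target.measurableSet
  rw [setIntegral_congr_fun hmeas hpt, polarCoord_target, Measure.volume_eq_prod]
  have hI : IntegrableOn (fun p : ℝ × ℝ =>
      deriv (fun r : ℝ => χ ((r : ℂ) * (Real.cos p.2 + Real.sin p.2 * Complex.I))) p.1)
      (Set.Ioi 0 ×ˢ Set.Ioo (-Real.pi) Real.pi) (volume.prod volume) := by
    rw [← polarCoord_target]
    refine IntegrableOn.congr_fun (f := fun p => p.1 • ((‖Complex.polarCoord.symm p‖ ^ 2)⁻¹ *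
      fderiv ℝ χ (Complex.polarCoord.symm p) (Complex.polarCoord.symm p))) ?_ hpt hmeas
    have h1 := (Complex.volume_preserving_equiv_real_prod.symm).integrable_comp_emb
      Complex.measurableEquivRealProd.symm.measurableEmbedding |>.2 hint
    have h2 := integrableOn_image_iff_integrableOn_abs_det_fderiv_smul (volume : Measure (ℝ × ℝ))
      hmeas (fun p _ => (hasFDerivAt_polarCoord_symm p).hasFDerivWithinAt)
      polarCoord.symm.injOn (Function.comp (fun s : ℂ => (‖s‖ ^ 2)⁻¹ * fderiv ℝ χ s s)
        Complex.measurableEquivRealProd.symm) |>.1 h1.integrableOn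
    refine h2.congr_fun (fun p hp => ?_) hmeas
    simp only [det_fderivPolarCoordSymm, Function.comp]
    rw [abs_of_pos hp.1]
    rfl
  rw [IntegrableOn, ← Measure.prod_restrict] at hI
  rw [← Measure.prod_restrict, integral_prod_symm _ hI]
  have hin : ∀ θ : ℝ, ∫ r in Set.Ioi (0 : ℝ),
      deriv (fun r : ℝ => χ ((r : ℂ) * (Real.cos θ + Real.sin θ * Complex.I))) r = - χ 0 := by
    intro θ
    have hc : ContDiff ℝ 1 (fun r : ℝ => χ ((r : ℂ) * (Real.cos θ + Real.sin θ * Complex.I))) :=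
      hχ.comp (Complex.ofRealCLM.contDiff.mul contDiff_const)
    have hcs : HasCompactSupport
        (fun r : ℝ => χ ((r : ℂ) * (Real.cos θ + Real.sin θ * Complex.I))) := by
      obtain ⟨R, hR⟩ := hs.isCompact.isBounded.subset_closedBall 0
      refine HasCompactSupport.intro (isCompact_closedBall (0 : ℝ) R) fun r hr => ?_
      by_contra h
      apply hr
      have := hR (subset_tsupport _ h)
      have hn : ‖(Real.cos θ : ℂ) + Real.sin θ * Complex.I‖ = 1 := by
        rw [Complex.norm_add_mul_I]; simp
      simpa [hn, -Complex.ofReal_cos, -Complex.ofReal_sin] using this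
    rw [hcs.integral_Ioi_deriv_eq hc]; simp
  simp only [hin]
  simp [Real.pi_pos.le]
  left
  ring

theorem fderiv_apply_self_eq_inner (χ : ℂ → ℝ) (s : ℂ) :
    fderiv ℝ χ s s = inner ℝ s 1 * fderiv ℝ χ s 1 + inner ℝ s Complex.I * fderiv ℝ χ s Complex.I := by
  have : s = (inner ℝ s 1 : ℝ) • (1 : ℂ) + (inner ℝ s Complex.I : ℝ) • Complex.I := by
    simp [Complex.inner]
  conv_lhs => enter [2]; rw [this]
  rw [map_add, map_smul, map_smul, smul_eq_mul, smul_eq_mul]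

/-- `(1/2π) log |s|` is a fundamental solution of the Laplacian on `ℂ`. -/
theorem integral_log_norm_mul_laplacian {χ : ℂ → ℝ} (hχ : ContDiff ℝ ∞ χ)
    (hs : HasCompactSupport χ) :
    ∫ s : ℂ, Real.log ‖s‖ * (secondDeriv χ 1 s + secondDeriv χ Complex.I s) =
      2 * Real.pi * χ 0 := by
  have hd : ∀ v : ℂ, ContDiff ℝ ∞ (fun s => fderiv ℝ χ s v) := fun v =>
    (hχ.fderiv_right (m := ∞) (by simp)).clm_apply contDiff_const
  have hI : ∀ v : ℂ, Integrable (fun s : ℂ => Real.log ‖s‖ * secondDeriv χ v s) := fun v =>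
    integrable_log_norm_mul (continuous_secondDeriv hχ v) (hasCompactSupport_secondDeriv hs v)
  have h1 : ∀ v : ℂ, ∫ s : ℂ, Real.log ‖s‖ * secondDeriv χ v s =
      - ∫ s : ℂ, (inner ℝ s v * (‖s‖ ^ 2)⁻¹) * fderiv ℝ χ s v := fun v =>
    integral_log_norm_mul_fderiv ((hd v).of_le (by simp)) (hs.fderiv_apply ℝ v) v
  have hI2 : ∀ v : ℂ, Integrable (fun s : ℂ => (inner ℝ s v * (‖s‖ ^ 2)⁻¹) * fderiv ℝ χ s v) := by
    intro v
    refine (integrable_inv_norm_mul (h := fun s => ‖v‖ * ‖fderiv ℝ χ s v‖)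
      (continuous_const.mul (hd v).continuous.norm) (hs.fderiv_apply ℝ v).norm.mul_left).mono'
      ?_ (ae_of_all _ fun s => ?_)
    · exact (Measurable.aestronglyMeasurable (by fun_prop)).mul (hd v).continuous.aestronglyMeasurable
    · rcases eq_or_ne s 0 with rfl | h0
      · simp
      have h0 : 0 < ‖s‖ := norm_pos_iff.2 h0
      have h1 := norm_inner_le_norm (𝕜 := ℝ) s v
      rw [norm_mul, norm_mul, norm_inv, norm_pow, norm_norm, ← mul_assoc]
      refine mul_le_mul_of_nonneg_right ?_ (norm_nonneg _)
      calc ‖inner ℝ s v‖ * (‖s‖ ^ 2)⁻¹ ≤ (‖s‖ * ‖v‖) * (‖s‖ ^ 2)⁻¹ := by gcongr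
        _ = _ := by field_simp
  simp only [mul_add]
  rw [integral_add (hI 1) (hI _), h1, h1, ← neg_add, ← integral_add (hI2 1) (hI2 _)]
  have := integral_inv_norm_sq_mul_radial (hχ.of_le (by simp)) hs
  rw [← neg_eq_iff_eq_neg] at this
  rw [← this]
  congr 2
  ext s
  rw [fderiv_apply_self_eq_inner]
  ring

theorem integral_secondDeriv_eq_zero {χ : ℂ → ℝ} (hχ : ContDiff ℝ ∞ χ)
    (hs : HasCompactSupport χ) (v : ℂ) : ∫ s : ℂ, secondDeriv χ v s = 0 := by
  have hd : ContDiff ℝ ∞ (fun s => fderiv ℝ χ s v) :=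
    (hχ.fderiv_right (m := ∞) (by simp)).clm_apply contDiff_const
  have h0 : Integrable (secondDeriv χ v) := (continuous_secondDeriv hχ v).integrable_of_hasCompactSupport
      (hasCompactSupport_secondDeriv hs v)
  have := integral_mul_fderiv_eq_neg_fderiv_mul_of_integrable (μ := (volume : Measure ℂ))
      (f := fun _ : ℂ => (1 : ℝ)) (g := fun s => fderiv ℝ χ s v) (v := v) (by simp)
      (by simp only [one_mul]; exact h0)
      (by simpa using hd.continuous.integrable_of_hasCompactSupport (hs.fderiv_apply ℝ v))
      (fun s _ => by fun_prop) (fun s _ => hd.differentiable (by simp) s)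
  simpa [secondDeriv] using this

theorem secondDeriv_comp_add_right {V : Type*} [NormedAddCommGroup V] [NormedSpace ℝ V] (χ : V → ℝ)
    (v r z : V) : secondDeriv (fun s => χ (s + r)) v z = secondDeriv χ v (z + r) := by
  unfold secondDeriv
  have : (fun w => fderiv ℝ (fun s => χ (s + r)) w v) = fun w => fderiv ℝ χ (w + r) v := by
    ext w; rw [fderiv_comp_add_right (f := χ)]
  rw [this, fderiv_comp_add_right (f := fun w => fderiv ℝ χ w v)]

/-- The log potential of a finite product of linear factors. -/
theorem integral_log_norm_multiset_prod_mul_laplacian {χ : ℂ → ℝ} (hχ : ContDiff ℝ ∞ χ)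
    (hs : HasCompactSupport χ) (S : Multiset ℂ) :
    Integrable (fun s : ℂ => Real.log ‖(S.map fun r => s - r).prod‖ *
      (secondDeriv χ 1 s + secondDeriv χ Complex.I s)) ∧
    ∫ s : ℂ, Real.log ‖(S.map fun r => s - r).prod‖ *
      (secondDeriv χ 1 s + secondDeriv χ Complex.I s) = 2 * Real.pi * (S.map χ).sum := by
  induction S using Multiset.induction_on with
  | empty => simp
  | cons r S ih =>
    set Δ := fun s => secondDeriv χ 1 s + secondDeriv χ Complex.I s with hΔ
    have hΔc : Continuous Δ := (continuous_secondDeriv hχ _).add (continuous_secondDeriv hχ _)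
    have hΔs : HasCompactSupport Δ :=
      (hasCompactSupport_secondDeriv hs _).add (hasCompactSupport_secondDeriv hs _)
    have hχr : ContDiff ℝ ∞ (fun s => χ (s + r)) := hχ.comp (by fun_prop)
    have hsr : HasCompactSupport (fun s => χ (s + r)) := hs.comp_homeomorph (Homeomorph.addRight r)
    have e1 : ∀ s, Δ (s + r) = secondDeriv (fun s => χ (s + r)) 1 s +
        secondDeriv (fun s => χ (s + r)) Complex.I s := fun s => by
      simp [hΔ, secondDeriv_comp_add_right]
    have i1 : Integrable (fun s : ℂ => Real.log ‖s - r‖ * Δ s) := by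
      have := integrable_log_norm_mul (h := fun s => Δ (s + r)) (by fun_prop)
        (hΔs.comp_homeomorph (Homeomorph.addRight r))
      simpa using this.comp_sub_right r
    have v1 : ∫ s : ℂ, Real.log ‖s - r‖ * Δ s = 2 * Real.pi * χ r := by
      have := integral_log_norm_mul_laplacian hχr hsr
      simp only [← e1, zero_add] at this
      rw [← this, ← integral_add_right_eq_self (fun s => Real.log ‖s - r‖ * Δ s) r]
      simp
    have hae : (fun s : ℂ => Real.log ‖((r ::ₘ S).map fun r => s - r).prod‖ * Δ s) =ᵐ[volume]
        fun s => Real.log ‖s - r‖ * Δ s + Real.log ‖(S.map fun r => s - r).prod‖ * Δ s := by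
      have : ∀ᵐ s : ℂ, s ∉ ((r ::ₘ S).toFinset : Set ℂ) :=
        compl_mem_ae_iff.2 ((Finset.finite_toSet _).measure_zero _)
      filter_upwards [this] with s h
      simp only [Finset.mem_coe, Multiset.mem_toFinset, Multiset.mem_cons, not_or] at h
      rw [Multiset.map_cons, Multiset.prod_cons, norm_mul, Real.log_mul, add_mul]
      · simpa [sub_eq_zero] using h.1
      · rw [norm_ne_zero_iff]
        refine Multiset.prod_ne_zero fun h0 => ?_
        obtain ⟨y, hy, h0⟩ := Multiset.mem_map.1 h0
        rw [sub_eq_zero] at h0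
        exact h.2 (h0 ▸ hy)
    refine ⟨(i1.add ih.1).congr hae.symm, ?_⟩
    rw [integral_congr_ae hae, integral_add i1 ih.1, v1, ih.2]
    simp; ring

/-- The Poincaré–Lelong formula in one variable, for polynomials. -/
theorem integral_log_norm_polynomial_mul_laplacian {χ : ℂ → ℝ} (hχ : ContDiff ℝ ∞ χ)
    (hs : HasCompactSupport χ) {g : Polynomial ℂ} (hg : g ≠ 0) :
    ∫ s : ℂ, Real.log ‖g.eval s‖ * (secondDeriv χ 1 s + secondDeriv χ Complex.I s) =
      2 * Real.pi * (g.roots.map χ).sum := by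
  obtain ⟨h1, h2⟩ := integral_log_norm_multiset_prod_mul_laplacian hχ hs g.roots
  have i1 : ∀ v, Integrable (secondDeriv χ v) := fun v =>
    (continuous_secondDeriv hχ v).integrable_of_hasCompactSupport
      (hasCompactSupport_secondDeriv hs v)
  have hae : (fun s : ℂ => Real.log ‖g.eval s‖ * (secondDeriv χ 1 s + secondDeriv χ Complex.I s))
      =ᵐ[volume] fun s => Real.log ‖g.leadingCoeff‖ * (secondDeriv χ 1 s + secondDeriv χ Complex.I s)
        + Real.log ‖(g.roots.map fun r => s - r).prod‖ *
          (secondDeriv χ 1 s + secondDeriv χ Complex.I s) := by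
    have : ∀ᵐ s : ℂ, s ∉ (g.roots.toFinset : Set ℂ) :=
      compl_mem_ae_iff.2 ((Finset.finite_toSet _).measure_zero _)
    filter_upwards [this] with s h
    simp only [Finset.mem_coe, Multiset.mem_toFinset, Polynomial.mem_roots hg, Polynomial.IsRoot] at h
    have e := (IsAlgClosed.splits g).eval_eq_prod_roots s
    rw [e] at h ⊢
    obtain ⟨ha, hb⟩ := mul_ne_zero_iff.1 h
    rw [norm_mul, Real.log_mul (by simpa using ha) (by simpa using hb), add_mul]
  have i2 : Integrable fun s => Real.log ‖g.leadingCoeff‖ *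
      (secondDeriv χ 1 s + secondDeriv χ Complex.I s) := ((i1 1).add (i1 _)).const_mul _
  rw [integral_congr_ae hae, integral_add i2 h1, h2, integral_const_mul, integral_add (i1 1) (i1 _), integral_secondDeriv_eq_zero hχ hs,
    integral_secondDeriv_eq_zero hχ hs]
  simp

/-! ### Moments of a random linear form -/

/-- The circular Gaussian measure on `ℂ` of variance `1 / t`. -/
noncomputable def planarGaussian (t : ℝ) : Measure ℂ :=
  volume.withDensity fun z => ENNReal.ofReal (t / Real.pi * Real.exp (-t * ‖z‖ ^ 2))

theorem integrable_planarGaussian_density {t : ℝ} (ht : 0 < t) :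
    Integrable (fun z : ℂ => t / Real.pi * Real.exp (-t * ‖z‖ ^ 2)) ∧
    ∫ z : ℂ, t / Real.pi * Real.exp (-t * ‖z‖ ^ 2) = 1 := by
  have h := GaussianFourier.integral_rexp_neg_mul_sq_norm (V := ℂ) ht
  rw [Complex.finrank_real_complex] at h
  norm_num at h
  have hI : Integrable (fun z : ℂ => Real.exp (-t * ‖z‖ ^ 2)) := by
    by_contra hc
    simp only [neg_mul] at hc
    rw [integral_undef hc] at h
    have : 0 < Real.pi / t := by positivity
    exact this.ne h
  refine ⟨hI.const_mul _, ?_⟩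
  rw [integral_const_mul]
  simp only [neg_mul]
  rw [h]
  field_simp

theorem isProbabilityMeasure_planarGaussian {t : ℝ} (ht : 0 < t) :
    IsProbabilityMeasure (planarGaussian t) := by
  constructor
  obtain ⟨h1, h2⟩ := integrable_planarGaussian_density ht
  rw [planarGaussian, withDensity_apply _ MeasurableSet.univ, Measure.restrict_univ,
    ← ofReal_integral_eq_lintegral_ofReal h1 (ae_of_all _ fun z => by positivity), h2]
  simp

/-- The Gaussian measure on `ℂ^d` is a product of planar Gaussian measures. -/
theorem pi_planarGaussian {t : ℝ} (ht : 0 < t) (d : ℕ) :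
    Measure.pi (fun _ : Fin d => planarGaussian t) =
      (volume : Measure (Fin d → ℂ)).withDensity fun a =>
        ENNReal.ofReal ((t / Real.pi) ^ d * Real.exp (-t * ∑ j, ‖a j‖ ^ 2)) := by
  have := isProbabilityMeasure_planarGaussian ht
  refine Measure.pi_eq fun s hs => ?_
  rw [withDensity_apply _ (MeasurableSet.univ_pi hs), ← lintegral_indicator (MeasurableSet.univ_pi hs)]
  set g : Fin d → ℂ → ℝ := fun j =>
    (s j).indicator fun z => t / Real.pi * Real.exp (-t * ‖z‖ ^ 2) with hg
  have hgi : ∀ j, Integrable (g j) := fun j =>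
    (integrable_planarGaussian_density ht).1.indicator (hs j)
  have hg0 : ∀ j z, 0 ≤ g j z := fun j z => Set.indicator_nonneg (fun z _ => by positivity) z
  have e : ((Set.univ.pi s).indicator fun a : Fin d → ℂ =>
      ENNReal.ofReal ((t / Real.pi) ^ d * Real.exp (-t * ∑ j, ‖a j‖ ^ 2))) =
      fun a => ENNReal.ofReal (∏ j, g j (a j)) := by
    ext a
    by_cases ha : a ∈ Set.univ.pi s
    · rw [Set.indicator_of_mem ha]
      congr 1
      have : ∀ j, g j (a j) = t / Real.pi * Real.exp (-t * ‖a j‖ ^ 2) := fun j =>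
        Set.indicator_of_mem (ha j (Set.mem_univ j)) _
      simp only [this]
      rw [Finset.prod_mul_distrib, ← Real.exp_sum, Finset.mul_sum]
      simp [div_pow]
    · rw [Set.indicator_of_notMem ha]
      simp only [Set.mem_univ_pi, not_forall] at ha
      obtain ⟨j, hj⟩ := ha
      rw [Finset.prod_eq_zero (Finset.mem_univ j) (Set.indicator_of_notMem hj _)]
      simp
  have hgp : Integrable (fun a : Fin d → ℂ => ∏ j, g j (a j)) := Integrable.fintype_prod hgi
  rw [e, ← ofReal_integral_eq_lintegral_ofReal hgp
    (ae_of_all _ fun a => Finset.prod_nonneg fun j _ => hg0 j _),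
    integral_fintype_prod_volume_eq_prod, ENNReal.ofReal_prod_of_nonneg
    (fun j _ => integral_nonneg (hg0 j))]
  refine Finset.prod_congr rfl fun j _ => ?_
  rw [ofReal_integral_eq_lintegral_ofReal (hgi j) (ae_of_all _ (hg0 j)), planarGaussian,
    withDensity_apply _ (hs j), ← lintegral_indicator (hs j)]
  refine lintegral_congr fun z => ?_
  by_cases hz : z ∈ s j <;> simp [hg, hz]

/-- Every unit vector `w` is the first row of a unitary matrix, so there is a volume-preserving
transformation of `ℂ^d` that preserves the Euclidean norm and has `∑ j, w j * a j` as one of its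
coordinates. -/
theorem exists_measurePreserving_coordinate {d : ℕ} (w : Fin d → ℂ) (hw : ∑ j, ‖w j‖ ^ 2 = 1) :
    ∃ (i : Fin d) (M : (Fin d → ℂ) → (Fin d → ℂ)), MeasurePreserving M volume volume ∧
      (∀ a, ∑ j, ‖M a j‖ ^ 2 = ∑ j, ‖a j‖ ^ 2) ∧ ∀ a, M a i = ∑ j, a j * w j := by
  have hd : Nonempty (Fin d) := by
    by_contra h
    rw [not_nonempty_iff] at h
    simp at hw
  obtain ⟨i⟩ := hd
  set v : EuclideanSpace ℂ (Fin d) := WithLp.toLp 2 fun j => star (w j) with hv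
  have hnv : ‖v‖ = 1 := by
    rw [EuclideanSpace.norm_eq]
    simp [hv, hw]
  have hon : Orthonormal ℂ (({i} : Set (Fin d)).domRestrict (fun _ : Fin d => v)) := by
    constructor
    · intro x; simpa using hnv
    · intro x y hxy; exact absurd (Subsingleton.elim x y) hxy
  obtain ⟨b, hb⟩ := hon.exists_orthonormalBasis_extension_of_card_eq (by simp)
  have hbi : b i = v := hb i rfl
  let e : EuclideanSpace ℂ (Fin d) ≃L[ℝ] (Fin d → ℂ) := PiLp.continuousLinearEquiv 2 ℝ fun _ => ℂ
  let ν : Measure (EuclideanSpace ℂ (Fin d)) :=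
    Measure.euclideanHausdorffMeasure (Module.finrank ℝ (EuclideanSpace ℂ (Fin d)))
  have hem : Measurable e := e.continuous.measurable
  have hesm : Measurable e.symm := e.symm.continuous.measurable
  have h1 : MeasurePreserving b.repr ν ν :=
    b.repr.toIsometryEquiv.measurePreserving_euclideanHausdorffMeasure _
  have hH : Measure.IsAddHaarMeasure (Measure.map e ν) := e.isAddHaarMeasure_map ν
  have hvol := Measure.isAddLeftInvariant_eq_smul (volume : Measure (Fin d → ℂ)) (Measure.map e ν)
  have h2 : MeasurePreserving e ν (Measure.map e ν) := ⟨hem, rfl⟩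
  have h3 : MeasurePreserving e.symm (Measure.map e ν) ν := by
    refine ⟨hesm, ?_⟩
    rw [Measure.map_map hesm hem]
    simp
  have h4 : MeasurePreserving (e ∘ b.repr ∘ e.symm) (Measure.map e ν) (Measure.map e ν) :=
    h2.comp (h1.comp h3)
  refine ⟨i, e ∘ b.repr ∘ e.symm, ?_, ?_, ?_⟩
  · rw [hvol]
    exact h4.smul_measure _
  · intro a
    have h := b.repr.norm_map (e.symm a)
    rw [EuclideanSpace.norm_eq, EuclideanSpace.norm_eq, Real.sqrt_inj (by positivity)
      (by positivity)] at h
    exact h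
  · intro a
    have : (e ∘ b.repr ∘ e.symm) a i = inner ℂ (b i) (e.symm a) := by
      simp [e, OrthonormalBasis.repr_apply_apply]
    rw [this, hbi, PiLp.inner_apply]
    simp [hv, e]

/-- Unitary invariance: a unit linear form of a Gaussian vector has the law of one coordinate. -/
theorem lintegral_linearForm_gaussian {t : ℝ} (ht : 0 < t) {d : ℕ} (w : Fin d → ℂ)
    (hw : ∑ j, ‖w j‖ ^ 2 = 1) {F : ℂ → ENNReal} (hF : Measurable F) :
    ∫⁻ a : Fin d → ℂ, F (∑ j, a j * w j) *
      ENNReal.ofReal ((t / Real.pi) ^ d * Real.exp (-t * ∑ j, ‖a j‖ ^ 2)) =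
      ∫⁻ z, F z ∂(planarGaussian t) := by
  have := isProbabilityMeasure_planarGaussian ht
  obtain ⟨i, M, hM, hM1, hM2⟩ := exists_measurePreserving_coordinate w hw
  have e0 : ∀ a : Fin d → ℂ, F (∑ j, a j * w j) *
      ENNReal.ofReal ((t / Real.pi) ^ d * Real.exp (-t * ∑ j, ‖a j‖ ^ 2)) = F (M a i) *
      ENNReal.ofReal ((t / Real.pi) ^ d * Real.exp (-t * ∑ j, ‖M a j‖ ^ 2)) := fun a => by
    rw [hM1, hM2]
  rw [lintegral_congr e0, hM.lintegral_comp (f := fun a : Fin d → ℂ => F (a i) *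
      ENNReal.ofReal ((t / Real.pi) ^ d * Real.exp (-t * ∑ j, ‖a j‖ ^ 2))) (by fun_prop)]
  have h := lintegral_withDensity_eq_lintegral_mul (volume : Measure (Fin d → ℂ))
    (f := fun a => ENNReal.ofReal ((t / Real.pi) ^ d * Real.exp (-t * ∑ j, ‖a j‖ ^ 2)))
    (by fun_prop) (g := fun a => F (a i)) (by fun_prop)
  rw [← pi_planarGaussian ht] at h
  simp only [Pi.mul_apply] at h
  refine (lintegral_congr fun a => mul_comm _ _).trans ?_
  rw [← h, ← (measurePreserving_eval (fun _ : Fin d => planarGaussian t) i).lintegral_comp hF]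

/-- The Fubini–Study density is a mixture of the densities of Gaussian measures of variance `1 / t`,
where `t` has an exponential distribution. -/
theorem lintegral_gaussian_mixture (d : ℕ) {S : ℝ} (hS : 0 ≤ S) :
    ∫⁻ t in Set.Ioi (0 : ℝ), ENNReal.ofReal (Real.exp (-t)) *
      ENNReal.ofReal ((t / Real.pi) ^ d * Real.exp (-t * S)) =
      ENNReal.ofReal ((d.factorial : ℝ) / Real.pi ^ d * (1 / (1 + S) ^ (d + 1))) := by
  have h := Real.integral_rpow_mul_exp_neg_mul_Ioi (a := d + 1) (r := 1 + S) (by positivity)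
    (by positivity)
  simp only [add_sub_cancel_right, Real.rpow_natCast] at h
  rw [Real.Gamma_nat_eq_factorial, show (d : ℝ) + 1 = ((d + 1 : ℕ) : ℝ) by push_cast; ring,
    Real.rpow_natCast] at h
  have hI : IntegrableOn (fun t : ℝ => t ^ d * Real.exp (-((1 + S) * t))) (Set.Ioi 0) := by
    by_contra hc
    rw [integral_undef hc] at h
    have : 0 < (1 / (1 + S)) ^ (d + 1) * (d.factorial : ℝ) := by positivity
    exact this.ne h
  have e : ∀ t ∈ Set.Ioi (0 : ℝ), ENNReal.ofReal (Real.exp (-t)) *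
      ENNReal.ofReal ((t / Real.pi) ^ d * Real.exp (-t * S)) =
      ENNReal.ofReal ((Real.pi ^ d)⁻¹ * (t ^ d * Real.exp (-((1 + S) * t)))) := by
    intro t _
    rw [← ENNReal.ofReal_mul (by positivity)]
    congr 1
    rw [show -((1 + S) * t) = -t + -t * S by ring, Real.exp_add, div_pow]
    ring
  rw [setLIntegral_congr_fun measurableSet_Ioi e, ← ofReal_integral_eq_lintegral_ofReal
    (hI.const_mul _) ((ae_restrict_iff' measurableSet_Ioi).2 (ae_of_all _ fun t ht => by
      have : (0 : ℝ) < t := ht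
      positivity)), integral_const_mul, h]
  congr 1
  rw [one_div_pow]
  ring

theorem lintegral_mul_fubiniStudy_density {d : ℕ} {G : (Fin d → ℂ) → ENNReal} (hG : Measurable G) :
    ∫⁻ a : Fin d → ℂ, G a * ENNReal.ofReal
      ((d.factorial : ℝ) / Real.pi ^ d * (1 / (1 + ∑ j, ‖a j‖ ^ 2) ^ (d + 1))) =
    ∫⁻ t in Set.Ioi (0 : ℝ), ENNReal.ofReal (Real.exp (-t)) * ∫⁻ a : Fin d → ℂ, G a *
      ENNReal.ofReal ((t / Real.pi) ^ d * Real.exp (-t * ∑ j, ‖a j‖ ^ 2)) := by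
  calc _ = ∫⁻ a : Fin d → ℂ, ∫⁻ t in Set.Ioi (0 : ℝ), G a * (ENNReal.ofReal (Real.exp (-t)) *
      ENNReal.ofReal ((t / Real.pi) ^ d * Real.exp (-t * ∑ j, ‖a j‖ ^ 2))) := by
        refine lintegral_congr fun a => ?_
        rw [lintegral_const_mul _ (by fun_prop), lintegral_gaussian_mixture d (by positivity)]
    _ = ∫⁻ t in Set.Ioi (0 : ℝ), ∫⁻ a : Fin d → ℂ, G a * (ENNReal.ofReal (Real.exp (-t)) *
      ENNReal.ofReal ((t / Real.pi) ^ d * Real.exp (-t * ∑ j, ‖a j‖ ^ 2))) := by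
        rw [lintegral_lintegral_swap]
        fun_prop
    _ = _ := by
        refine lintegral_congr fun t => ?_
        rw [← lintegral_const_mul _ (by fun_prop)]
        refine lintegral_congr fun a => ?_
        ring

/-- The law of a unit linear form under the Fubini–Study measure. By mixing Gaussian measures it does
not depend on the dimension, so it is the Fubini–Study measure of dimension one. -/
theorem lintegral_linearForm_fubiniStudy {d : ℕ} (w : Fin d → ℂ)
    (hw : ∑ j, ‖w j‖ ^ 2 = 1) {F : ℂ → ENNReal} (hF : Measurable F) :
    ∫⁻ a, F (∑ j, a j * w j) ∂(fubiniStudy d) =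
      ∫⁻ z : ℂ, F z * ENNReal.ofReal (1 / Real.pi * (1 / (1 + ‖z‖ ^ 2) ^ 2)) := by
  have key : ∀ (d : ℕ) (w : Fin d → ℂ), ∑ j, ‖w j‖ ^ 2 = 1 →
      ∫⁻ a, F (∑ j, a j * w j) ∂(fubiniStudy d) =
      ∫⁻ t in Set.Ioi (0 : ℝ), ENNReal.ofReal (Real.exp (-t)) * ∫⁻ z, F z ∂(planarGaussian t) := by
    intro d w hw
    have h := lintegral_withDensity_eq_lintegral_mul (volume : Measure (Fin d → ℂ))
      (f := fun a => ENNReal.ofReal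
        ((d.factorial : ℝ) / Real.pi ^ d * (1 / (1 + ∑ j, ‖a j‖ ^ 2) ^ (d + 1))))
      (by fun_prop) (g := fun a => F (∑ j, a j * w j)) (by fun_prop)
    rw [fubiniStudy, h]
    simp only [Pi.mul_apply, mul_comm _ (F _)]
    rw [lintegral_mul_fubiniStudy_density (by fun_prop)]
    refine setLIntegral_congr_fun measurableSet_Ioi fun t ht => ?_
    rw [lintegral_linearForm_gaussian ht w hw hF]
  rw [key d w hw, ← key 1 (fun _ => 1) (by simp)]
  have h := lintegral_withDensity_eq_lintegral_mul (volume : Measure (Fin 1 → ℂ))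
      (f := fun a => ENNReal.ofReal
        (((1 : ℕ).factorial : ℝ) / Real.pi ^ 1 * (1 / (1 + ∑ j, ‖a j‖ ^ 2) ^ (1 + 1))))
      (by fun_prop) (g := fun a => F (∑ j, a j * 1)) (by fun_prop)
  simp only [Pi.mul_apply] at h
  have h2 := ((volume_preserving_funUnique (Fin 1) ℂ).symm).lintegral_comp
    (f := fun a : Fin 1 → ℂ => ENNReal.ofReal (((1 : ℕ).factorial : ℝ) / Real.pi ^ 1 *
      (1 / (1 + ∑ j, ‖a j‖ ^ 2) ^ (1 + 1))) * F (∑ j, a j * 1)) (by fun_prop)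
  rw [fubiniStudy, h]
  refine h2.symm.trans (lintegral_congr fun z => ?_)
  simp [MeasurableEquiv.funUnique, mul_comm]

theorem complexGaussian_eq_pi (d : ℕ) :
    complexGaussian d = Measure.pi fun _ : Fin d => planarGaussian 1 := by
  rw [pi_planarGaussian one_pos, complexGaussian]
  simp

theorem lintegral_linearForm_complexGaussian {d : ℕ} (w : Fin d → ℂ)
    (hw : ∑ j, ‖w j‖ ^ 2 = 1) {F : ℂ → ENNReal} (hF : Measurable F) :
    ∫⁻ a, F (∑ j, a j * w j) ∂(complexGaussian d) =
      ∫⁻ z : ℂ, F z * ENNReal.ofReal (1 / Real.pi * Real.exp (-‖z‖ ^ 2)) := by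
  have h := lintegral_withDensity_eq_lintegral_mul (volume : Measure (Fin d → ℂ))
    (f := fun a => ENNReal.ofReal ((1 / Real.pi) ^ d * Real.exp (-1 * ∑ j, ‖a j‖ ^ 2)))
    (by fun_prop) (g := fun a => F (∑ j, a j * w j)) (by fun_prop)
  rw [complexGaussian_eq_pi, pi_planarGaussian one_pos, h]
  simp only [Pi.mul_apply, mul_comm _ (F _)]
  rw [lintegral_linearForm_gaussian one_pos w hw hF, planarGaussian,
    lintegral_withDensity_eq_lintegral_mul _ (by fun_prop) hF]
  simp [mul_comm]

theorem isProbabilityMeasure_complexGaussian (d : ℕ) : IsProbabilityMeasure (complexGaussian d) := by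
  have := isProbabilityMeasure_planarGaussian one_pos
  rw [complexGaussian_eq_pi]
  infer_instance

theorem isProbabilityMeasure_fubiniStudy (d : ℕ) : IsProbabilityMeasure (fubiniStudy d) := by
  constructor
  have h1 := lintegral_mul_fubiniStudy_density (d := d) (G := fun _ => 1) measurable_const
  simp only [one_mul] at h1
  rw [fubiniStudy, withDensity_apply _ MeasurableSet.univ, Measure.restrict_univ, h1]
  have h2 : ∀ t ∈ Set.Ioi (0 : ℝ), ENNReal.ofReal (Real.exp (-t)) * ∫⁻ a : Fin d → ℂ,
      ENNReal.ofReal ((t / Real.pi) ^ d * Real.exp (-t * ∑ j, ‖a j‖ ^ 2)) =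
      ENNReal.ofReal (Real.exp (-t)) := by
    intro t ht
    have := isProbabilityMeasure_planarGaussian ht
    have h3 : (Measure.pi (fun _ : Fin d => planarGaussian t)) Set.univ = 1 := measure_univ
    rw [pi_planarGaussian ht, withDensity_apply _ MeasurableSet.univ, Measure.restrict_univ] at h3
    rw [h3, mul_one]
  rw [setLIntegral_congr_fun measurableSet_Ioi h2, ← ofReal_integral_eq_lintegral_ofReal
    (integrableOn_exp_neg_Ioi 0) (ae_of_all _ fun t => (Real.exp_pos _).le), integral_exp_neg_Ioi]
  simp

theorem sq_log_le {x : ℝ} (hx : 0 ≤ x) : Real.log x ^ 2 ≤ 8 * (x + x⁻¹) := by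
  rcases hx.eq_or_lt with rfl | hx
  · simp
  have h1 := abs_log_le_add_inv (Real.sqrt_nonneg x)
  rw [Real.log_sqrt hx.le, abs_div, abs_two, div_le_iff₀ two_pos] at h1
  have h2 : 0 < Real.sqrt x := Real.sqrt_pos.2 hx
  have h3 := Real.sq_sqrt hx.le
  have h4 : (Real.sqrt x)⁻¹ ^ 2 = x⁻¹ := by rw [inv_pow, h3]
  have h5 := pow_le_pow_left₀ (abs_nonneg _) h1 2
  rw [sq_abs] at h5
  nlinarith [sq_nonneg (Real.sqrt x - (Real.sqrt x)⁻¹)]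

theorem integrable_sq_log_norm_mul_fubiniStudy :
    Integrable fun z : ℂ => Real.log ‖z‖ ^ 2 * (1 / Real.pi * (1 / (1 + ‖z‖ ^ 2) ^ 2)) := by
  have i1 : Integrable fun z : ℂ => (1 + ‖z‖) ^ (-3 : ℝ) :=
    integrable_one_add_norm (by rw [Complex.finrank_real_complex]; norm_num)
  have i2 := (i1.const_mul 64).add (integrable_inv_norm_mul_exp.const_mul (8 * Real.exp 1))
  refine i2.mono' (Measurable.aestronglyMeasurable (by fun_prop)) (ae_of_all _ fun z => ?_)
  rw [Real.norm_of_nonneg (by positivity)]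
  simp only [Pi.add_apply]
  rcases eq_or_ne z 0 with rfl | hz
  · simp
  set x := ‖z‖ with hx
  have hx0 : 0 < x := norm_pos_iff.2 hz
  have hlog := sq_log_le hx0.le
  have e3 : (1 + x) ^ (-3 : ℝ) = ((1 + x) ^ 3)⁻¹ := by
    rw [Real.rpow_neg (by positivity)]; norm_cast
  rw [e3]
  have hpi : 1 / Real.pi ≤ 1 := by
    rw [div_le_one Real.pi_pos]; linarith [Real.pi_gt_three]
  have hA : x * (1 / (1 + x ^ 2) ^ 2) ≤ 4 * ((1 + x) ^ 3)⁻¹ := by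
    rw [mul_one_div, ← div_eq_mul_inv, div_le_div_iff₀ (by positivity) (by positivity)]
    have h1 : (1 + x) ^ 2 ≤ 2 * (1 + x ^ 2) := by nlinarith [sq_nonneg (1 - x)]
    calc x * (1 + x) ^ 3 ≤ (1 + x) * (1 + x) ^ 3 := by gcongr; linarith
      _ = ((1 + x) ^ 2) ^ 2 := by ring
      _ ≤ (2 * (1 + x ^ 2)) ^ 2 := by gcongr
      _ = _ := by ring
  have hB : x⁻¹ * (1 / (1 + x ^ 2) ^ 2) ≤
      4 * ((1 + x) ^ 3)⁻¹ + Real.exp 1 * (x⁻¹ * Real.exp (-x ^ 2)) := by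
    rcases le_total x 1 with h | h
    · have h1 : 1 / (1 + x ^ 2) ^ 2 ≤ 1 := by
        rw [div_le_one (by positivity)]; nlinarith [sq_nonneg x, sq_nonneg (x ^ 2)]
      have h2 : 1 ≤ Real.exp 1 * Real.exp (-x ^ 2) := by
        rw [← Real.exp_add]; exact Real.one_le_exp (by nlinarith)
      have h3 : 0 ≤ 4 * ((1 + x) ^ 3)⁻¹ := by positivity
      calc x⁻¹ * (1 / (1 + x ^ 2) ^ 2) ≤ x⁻¹ * (Real.exp 1 * Real.exp (-x ^ 2)) := by
            gcongr; linarith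
        _ ≤ _ := by linarith
    · have h1 : x⁻¹ ≤ x := (inv_le_one_of_one_le₀ h).trans h
      have h3 : 0 ≤ Real.exp 1 * (x⁻¹ * Real.exp (-x ^ 2)) := by positivity
      calc x⁻¹ * (1 / (1 + x ^ 2) ^ 2) ≤ x * (1 / (1 + x ^ 2) ^ 2) := by gcongr
        _ ≤ _ := by linarith
  calc Real.log x ^ 2 * (1 / Real.pi * (1 / (1 + x ^ 2) ^ 2))
      ≤ (8 * (x + x⁻¹)) * (1 * (1 / (1 + x ^ 2) ^ 2)) := by gcongr
    _ = 8 * (x * (1 / (1 + x ^ 2) ^ 2)) + 8 * (x⁻¹ * (1 / (1 + x ^ 2) ^ 2)) := by ring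
    _ ≤ _ := by linarith

/-- The second moment of `log |∑ j, a j * w j|` for a unit vector `w` is bounded by a constant
that depends neither on `w` nor on the dimension. -/
theorem exists_bound_sq_log_linearForm {μ : (d : ℕ) → Measure (Fin d → ℂ)}
    (hμ : μ = complexGaussian ∨ μ = fubiniStudy) :
    ∃ M : NNReal, ∀ (d : ℕ) (w : Fin d → ℂ), ∑ j, ‖w j‖ ^ 2 = 1 →
      ∫⁻ a, ENNReal.ofReal (Real.log ‖∑ j, a j * w j‖ ^ 2) ∂(μ d) ≤ M := by
  have hm : Measurable fun z : ℂ => ENNReal.ofReal (Real.log ‖z‖ ^ 2) := by fun_prop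
  set I := ∫⁻ z : ℂ, ENNReal.ofReal (Real.log ‖z‖ ^ 2) *
    ENNReal.ofReal (1 / Real.pi * (1 / (1 + ‖z‖ ^ 2) ^ 2)) with hI
  have hfin : I ≠ ⊤ := by
    have h := integrable_sq_log_norm_mul_fubiniStudy
    have h2 : I = ENNReal.ofReal (∫ z : ℂ, Real.log ‖z‖ ^ 2 *
        (1 / Real.pi * (1 / (1 + ‖z‖ ^ 2) ^ 2))) := by
      rw [ofReal_integral_eq_lintegral_ofReal h (ae_of_all _ fun z => by positivity)]
      exact lintegral_congr fun z => (ENNReal.ofReal_mul (by positivity)).symm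
    rw [h2]; exact ENNReal.ofReal_ne_top
  refine ⟨2 * I.toNNReal, fun d w hw => ?_⟩
  rw [ENNReal.coe_mul, ENNReal.coe_toNNReal hfin]
  rcases hμ with rfl | rfl
  · rw [lintegral_linearForm_complexGaussian w hw hm, hI, ← lintegral_const_mul _ (by fun_prop)]
    refine lintegral_mono fun z => ?_
    simp only
    rw [mul_left_comm]
    gcongr
    have : ((2 : NNReal) : ENNReal) = ENNReal.ofReal 2 := by simp
    rw [this, ← ENNReal.ofReal_mul (by norm_num)]
    refine ENNReal.ofReal_le_ofReal ?_
    rw [mul_left_comm]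
    gcongr
    -- compare with the second Taylor polynomial of the exponential function
    have h := Real.quadratic_le_exp_of_nonneg (x := ‖z‖ ^ 2) (by positivity)
    rw [Real.exp_neg, mul_one_div, inv_eq_one_div, div_le_div_iff₀ (by positivity) (by positivity)]
    nlinarith
  · rw [lintegral_linearForm_fubiniStudy w hw hm]
    have : I ≤ 2 * I := by rw [two_mul]; exact le_self_add
    exact this

/-! ### Coordinates orthogonal to a complex direction -/

theorem finrank_real_CSpace (k : ℕ) : Module.finrank ℝ (CSpace k) = k * 2 := by
  rw [finrank_real_of_complex, finrank_euclideanSpace_fin, mul_comm]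

theorem isAddHaarMeasure_euclideanHausdorffMeasure_CSpace (k : ℕ) :
    (Measure.euclideanHausdorffMeasure (k * 2) : Measure (CSpace k)).IsAddHaarMeasure := by
  have := isAddHaarMeasure_euclideanHausdorffMeasure (E := CSpace k)
  rwa [finrank_real_CSpace] at this

section Coordinates

variable {k : ℕ} (b w : OrthonormalBasis (Fin (k + 1)) ℂ (CSpace (k + 1)))

/-- The coordinates with respect to `b 1, …, b k`: the orthogonal projection along `b 0`. -/
noncomputable def coordProj : CSpace (k + 1) →L[ℂ] CSpace k :=
  LinearMap.toContinuousLinearMap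
    { toFun := fun x => WithLp.toLp 2 fun j => b.repr x j.succ
      map_add' := fun x y => by ext j; simp
      map_smul' := fun c x => by ext j; simp }

/-- The isometric embedding of `ℂ^k` with image the orthogonal complement of `b 0`. -/
noncomputable def coordSect : CSpace k →ₗᵢ[ℂ] CSpace (k + 1) where
  toFun := fun y => b.repr.symm (WithLp.toLp 2 (Fin.cons 0 fun j => y j))
  map_add' := fun x y => by
    rw [← map_add]; congr 1; ext i
    refine Fin.cases ?_ (fun j => ?_) i <;> simp
  map_smul' := fun c x => by
    rw [← map_smul]; congr 1; ext i
    refine Fin.cases ?_ (fun j => ?_) i <;> simp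
  norm_map' := fun y => by
    change ‖b.repr.symm _‖ = _
    rw [LinearIsometryEquiv.norm_map, EuclideanSpace.norm_eq, EuclideanSpace.norm_eq]
    simp [Fin.sum_univ_succ]

@[simp] theorem coordProj_apply (x : CSpace (k + 1)) (j : Fin k) :
    coordProj b x j = b.repr x j.succ := rfl

theorem repr_coordSect_zero (y : CSpace k) : b.repr (coordSect b y) 0 = 0 := by
  change b.repr (b.repr.symm _) 0 = 0
  simp

theorem repr_coordSect_succ (y : CSpace k) (j : Fin k) : b.repr (coordSect b y) j.succ = y j := by
  change b.repr (b.repr.symm _) j.succ = y j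
  simp

@[simp] theorem coordProj_coordSect (y : CSpace k) : coordProj b (coordSect b y) = y := by
  ext j; simp [repr_coordSect_succ]

theorem coordProj_basis_zero : coordProj b (b 0) = 0 := by
  ext j; simp [b.repr_self]

theorem coordSect_coordProj_add (x : CSpace (k + 1)) :
    coordSect b (coordProj b x) + b.repr x 0 • b 0 = x := by
  apply b.repr.injective
  ext i
  refine Fin.cases ?_ (fun j => ?_) i
  · simp [repr_coordSect_zero, b.repr_self]
  · simp [repr_coordSect_succ, b.repr_self]

theorem norm_coordProj_le (x : CSpace (k + 1)) : ‖coordProj b x‖ ≤ ‖x‖ := by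
  rw [← b.repr.norm_map x, EuclideanSpace.norm_eq, EuclideanSpace.norm_eq]
  refine Real.sqrt_le_sqrt ?_
  rw [Fin.sum_univ_succ (n := k)]
  simp only [coordProj_apply]
  linarith [sq_nonneg ‖b.repr x 0‖]

/-- The minor of a unitary matrix complementary to an entry has the absolute value of the entry. -/
theorem norm_det_submatrix_succ {U : Matrix (Fin (k + 1)) (Fin (k + 1)) ℂ}
    (hU : U ∈ Matrix.unitaryGroup (Fin (k + 1)) ℂ) :
    ‖(U.submatrix Fin.succ Fin.succ).det‖ = ‖U 0 0‖ := by
  have h1 := Matrix.adjugate_fin_succ_eq_det_submatrix U 0 0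
  simp only [Fin.succAbove_zero] at h1
  have hUU : U * star U = 1 := Matrix.mem_unitaryGroup_iff.1 hU
  have h2 : U.adjugate = U.det • star U := by
    calc U.adjugate = U.adjugate * (U * star U) := by rw [hUU, mul_one]
      _ = _ := by rw [← mul_assoc, Matrix.adjugate_mul]; simp
  have h3 : ‖U.det‖ = 1 := by
    have h := congrArg Matrix.det hUU
    rw [Matrix.det_mul, Matrix.star_eq_conjTranspose, Matrix.det_conjTranspose, Matrix.det_one] at h
    have h4 := congrArg norm h
    rw [norm_mul, norm_star, norm_one] at h4
    nlinarith [norm_nonneg U.det]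
  rw [h2] at h1
  have h5 := congrArg norm h1
  simpa [h3, Matrix.star_apply] using h5.symm

theorem norm_det_coordProj_comp_coordSect :
    ‖LinearMap.det ((coordProj b : CSpace (k + 1) →ₗ[ℂ] CSpace k) ∘ₗ
      (coordSect w).toLinearMap)‖ = ‖inner ℂ (b 0) (w 0)‖ := by
  have hU := b.toMatrix_orthonormalBasis_mem_unitary w
  rw [← LinearMap.det_toMatrix (EuclideanSpace.basisFun (Fin k) ℂ).toBasis]
  have := norm_det_submatrix_succ hU
  have e : ∀ i j, b.toBasis.toMatrix w i j = b.repr (w j) i := fun i j => by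
    simp [Module.Basis.toMatrix_apply]
  rw [e, OrthonormalBasis.repr_apply_apply] at this
  rw [← this]
  congr 2
  ext i j
  rw [LinearMap.toMatrix_apply, Matrix.submatrix_apply, e]
  have hs : coordSect w (EuclideanSpace.single j 1) = w j.succ := by
    apply w.repr.injective
    ext l
    refine Fin.cases ?_ (fun l => ?_) l
    · simp [repr_coordSect_zero, w.repr_self]
    · simp [repr_coordSect_succ, w.repr_self]
  simp [hs]

theorem det_real_coordProj_comp_coordSect :
    LinearMap.det (((coordProj b : CSpace (k + 1) →ₗ[ℂ] CSpace k) ∘ₗ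
      (coordSect w).toLinearMap).restrictScalars ℝ) = ‖inner ℂ (b 0) (w 0)‖ ^ 2 := by
  rw [LinearMap.det_restrictScalars, Algebra.norm_complex_apply, Complex.normSq_eq_norm_sq,
    norm_det_coordProj_comp_coordSect]

/-- The projection along `b 0` multiplies areas in the complex hyperplane orthogonal to `w 0` by
`|⟨b 0, w 0⟩|²`. -/
theorem euclideanHausdorffMeasure_coordProj_image {B : Set (CSpace (k + 1))}
    (hB : ∀ x ∈ B, w.repr x 0 = 0) :
    Measure.euclideanHausdorffMeasure (k * 2) (coordProj b '' B) =
      ENNReal.ofReal (‖inner ℂ (b 0) (w 0)‖ ^ 2) *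
        Measure.euclideanHausdorffMeasure (k * 2) B := by
  have := isAddHaarMeasure_euclideanHausdorffMeasure_CSpace k
  have h1 : B = coordSect w '' (coordProj w '' B) := by
    rw [Set.image_image]
    conv_lhs => rw [← Set.image_id' B]
    refine Set.image_congr fun x hx => ?_
    have := coordSect_coordProj_add w x
    rw [hB x hx, zero_smul, add_zero] at this
    exact this.symm
  have h2 : Measure.euclideanHausdorffMeasure (k * 2) B =
      Measure.euclideanHausdorffMeasure (k * 2) (coordProj w '' B) := by
    conv_lhs => rw [h1]
    exact (coordSect w).isometry.euclideanHausdorffMeasure_image _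
  have h3 := Measure.addHaar_image_linearMap
    (Measure.euclideanHausdorffMeasure (k * 2) : Measure (CSpace k))
    (((coordProj b : CSpace (k + 1) →ₗ[ℂ] CSpace k) ∘ₗ
      (coordSect w).toLinearMap).restrictScalars ℝ) (coordProj w '' B)
  rw [det_real_coordProj_comp_coordSect, abs_of_nonneg (by positivity)] at h3
  rw [h2, ← h3]
  congr 1
  conv_lhs => rw [h1, Set.image_image]
  rfl

end Coordinates

/-! ### Hausdorff measure and Lipschitz maps -/

theorem LipschitzOnWith.euclideanHausdorffMeasure_image_le {X Y : Type*} [MetricSpace X]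
    [MeasurableSpace X] [BorelSpace X] [MetricSpace Y] [MeasurableSpace Y] [BorelSpace Y]
    {C : NNReal} {g : X → Y} {s : Set X} (hg : LipschitzOnWith C g s) (d : ℕ) :
    Measure.euclideanHausdorffMeasure d (g '' s) ≤
      (C : ENNReal) ^ d * Measure.euclideanHausdorffMeasure d s := by
  have h := hg.hausdorffMeasure_image_le (d := (d : ℝ)) (by positivity)
  rw [ENNReal.rpow_natCast] at h
  simp only [Measure.euclideanHausdorffMeasure_def, Measure.smul_apply]
  calc _ ≤ _ • ((C : ENNReal) ^ d * Measure.hausdorffMeasure (d : ℝ) s) := by gcongr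
    _ = _ := by rw [ENNReal.smul_def, ENNReal.smul_def, smul_eq_mul, smul_eq_mul]; ring

theorem euclideanHausdorffMeasure_le_of_antilipschitz {X Y : Type*} [MetricSpace X]
    [MeasurableSpace X] [BorelSpace X] [MetricSpace Y] [MeasurableSpace Y] [BorelSpace Y]
    {C : NNReal} {g : X → Y} {s : Set X} (hg : ∀ x ∈ s, ∀ y ∈ s, dist x y ≤ C * dist (g x) (g y))
    (d : ℕ) :
    Measure.euclideanHausdorffMeasure d s ≤
      (C : ENNReal) ^ d * Measure.euclideanHausdorffMeasure d (g '' s) := by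
  rcases s.eq_empty_or_nonempty with rfl | ⟨x0, -⟩
  · simp
  have : Nonempty X := ⟨x0⟩
  have hinj : Set.InjOn g s := fun x hx y hy h => by
    have := hg x hx y hy
    rw [h, dist_self, mul_zero] at this
    exact dist_le_zero.1 this
  have hl : LipschitzOnWith C (Function.invFunOn g s) (g '' s) := by
    refine LipschitzOnWith.of_dist_le_mul ?_
    rintro _ ⟨x, hx, rfl⟩ _ ⟨y, hy, rfl⟩
    rw [hinj.leftInvOn_invFunOn hx, hinj.leftInvOn_invFunOn hy]
    exact hg x hx y hy
  have h := hl.euclideanHausdorffMeasure_image_le d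
  rwa [hinj.leftInvOn_invFunOn.image_image] at h

/-- A set covered by neighbourhoods of its points is a countable disjoint union of measurable
pieces, each contained in one of the neighbourhoods. -/
theorem exists_measurable_partition {X : Type*} [TopologicalSpace X] [SecondCountableTopology X]
    [MeasurableSpace X] [OpensMeasurableSpace X] {S : Set X} (hS : MeasurableSet S) {p : Set X → Prop}
    (hp0 : p ∅) (hp : ∀ x ∈ S, ∃ V, V ∈ 𝓝 x ∧ ∀ B ⊆ V ∩ S, p B) :
    ∃ D : ℕ → Set X, (∀ i, MeasurableSet (D i)) ∧ Pairwise (Function.onFun Disjoint D) ∧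
      (⋃ i, D i) = S ∧ ∀ i, p (D i) := by
  rcases S.eq_empty_or_nonempty with rfl | hne
  · exact ⟨fun _ => ∅, by simp, by intro i j _; simp [Function.onFun], by simp, fun _ => hp0⟩
  choose! V hV hVp using hp
  obtain ⟨t, htS, htc, hcov⟩ := TopologicalSpace.countable_cover_nhdsWithin (s := S)
    (f := fun x => interior (V x)) fun x hx => mem_nhdsWithin_of_mem_nhds (interior_mem_nhds.2 (hV x hx))
  have htne : t.Nonempty := by
    by_contra h
    rw [Set.not_nonempty_iff_eq_empty] at h
    subst h
    obtain ⟨x, hx⟩ := hne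
    simpa using hcov hx
  obtain ⟨x, rfl⟩ := htc.exists_eq_range htne
  refine ⟨disjointed fun i => interior (V (x i)) ∩ S, fun i => ?_, disjoint_disjointed _, ?_, fun i => ?_⟩
  · exact MeasurableSet.disjointed (fun i => isOpen_interior.measurableSet.inter hS) i
  · rw [iUnion_disjointed, ← Set.iUnion_inter, Set.inter_eq_right]
    simpa using hcov
  · refine hVp (x i) (htS ⟨i, rfl⟩) _ ((disjointed_le _ i).trans ?_)
    exact Set.inter_subset_inter_left _ interior_subset

/-! ### The area formula for projections of a complex hypersurface -/

section Area

variable {k : ℕ}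

theorem exists_orthonormalBasis_norm_smul (u : CSpace (k + 1)) :
    ∃ b : OrthonormalBasis (Fin (k + 1)) ℂ (CSpace (k + 1)), (‖u‖ : ℂ) • b 0 = u := by
  by_cases hu : u = 0
  · exact ⟨EuclideanSpace.basisFun _ _, by simp [hu]⟩
  have hu0 : (‖u‖ : ℂ) ≠ 0 := by simpa using hu
  have hon : Orthonormal ℂ (({0} : Set (Fin (k + 1))).domRestrict
      (fun _ : Fin (k + 1) => (‖u‖ : ℂ)⁻¹ • u)) := by
    constructor
    · intro x
      simp only [Set.domRestrict_apply, norm_smul, norm_inv, Complex.norm_real, norm_norm]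
      exact inv_mul_cancel₀ (by simpa using hu)
    · intro x y hxy; exact absurd (Subsingleton.elim x y) hxy
  obtain ⟨w, hw⟩ := hon.exists_orthonormalBasis_extension_of_card_eq (by simp)
  exact ⟨w, by rw [hw 0 rfl, smul_inv_smul₀ hu0]⟩

/-- A linear form is, up to its norm, the first coordinate in some orthonormal basis. -/
theorem exists_normal_basis (A : CSpace (k + 1) →L[ℂ] ℂ) :
    ∃ w : OrthonormalBasis (Fin (k + 1)) ℂ (CSpace (k + 1)),
      ∀ x, A x = (‖A‖ : ℂ) * w.repr x 0 := by
  set g := (InnerProductSpace.toDual ℂ (CSpace (k + 1))).symm A with hg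
  have hng : ‖g‖ = ‖A‖ := by rw [hg, LinearIsometryEquiv.norm_map]
  obtain ⟨w, hw⟩ := exists_orthonormalBasis_norm_smul g
  refine ⟨w, fun x => ?_⟩
  rw [OrthonormalBasis.repr_apply_apply, ← InnerProductSpace.toDual_symm_apply (y := A), ← hg,
    ← hng]
  nth_rw 1 [← hw]
  rw [inner_smul_left, Complex.conj_ofReal]

/-- Near a zero of `f`, differences of zeros are almost tangent. -/
theorem HasStrictFDerivAt.exists_nhds_norm_apply_sub_le {E : Type*} [NormedAddCommGroup E]
    [NormedSpace ℂ E] {f : E → ℂ} {A : E →L[ℂ] ℂ} {z₀ : E} (hf : HasStrictFDerivAt f A z₀) {δ : ℝ}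
    (hδ : 0 < δ) :
    ∃ V ∈ 𝓝 z₀, ∀ z ∈ V, ∀ w ∈ V, f z = 0 → f w = 0 → ‖A (z - w)‖ ≤ δ * ‖z - w‖ := by
  have h := hf.isLittleO.bound hδ
  rw [nhds_prod_eq] at h
  obtain ⟨V, hV, h⟩ := mem_prod_same_iff.1 h
  refine ⟨V, hV, fun z hz w hw hfz hfw => ?_⟩
  have := h (Set.mk_mem_prod hz hw)
  simpa only [Set.mem_ofPred_eq, hfz, hfw, sub_self, zero_sub, norm_neg] using this

variable (b : OrthonormalBasis (Fin (k + 1)) ℂ (CSpace (k + 1)))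

/-- The squared cosine of the angle between `b 0` and the complex normal of a level set of `f`. -/
noncomputable def normalCosSq (f : CSpace (k + 1) → ℂ) (z : CSpace (k + 1)) : ℝ :=
  ‖fderiv ℂ f z (b 0)‖ ^ 2 / ‖fderiv ℂ f z‖ ^ 2

/-- Near a regular zero where `b 0` is transversal, the oblique projection along `b 0` onto the
tangent hyperplane distorts distances on the zero set by a factor close to one, so the orthogonal
projection along `b 0` distorts areas almost as it does on the tangent hyperplane. -/
theorem exists_nhds_coordProj_area {f : CSpace (k + 1) → ℂ} {A : CSpace (k + 1) →L[ℂ] ℂ}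
    {z₀ : CSpace (k + 1)} (hf : HasStrictFDerivAt f A z₀) (hA : A (b 0) ≠ 0) {C : NNReal}
    (hC : 1 < C) :
    ∃ V ∈ 𝓝 z₀, ∀ B ⊆ V ∩ {z | f z = 0}, Set.InjOn (coordProj b) B ∧
      Measure.euclideanHausdorffMeasure (k * 2) (coordProj b '' B) ≤ (C : ENNReal) ^ (k * 2) *
        (ENNReal.ofReal (‖A (b 0)‖ ^ 2 / ‖A‖ ^ 2) * Measure.euclideanHausdorffMeasure (k * 2) B) ∧
      ENNReal.ofReal (‖A (b 0)‖ ^ 2 / ‖A‖ ^ 2) * Measure.euclideanHausdorffMeasure (k * 2) B ≤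
        (C : ENNReal) ^ (k * 2) * Measure.euclideanHausdorffMeasure (k * 2) (coordProj b '' B) := by
  have hA0 : A ≠ 0 := by rintro rfl; simp at hA
  have hAn : (‖A‖ : ℂ) ≠ 0 := by simpa using hA0
  obtain ⟨w, hw⟩ := exists_normal_basis A
  have hCR : (1 : ℝ) < C := by exact_mod_cast hC
  set η : ℝ := 1 - (C : ℝ)⁻¹ with hη
  have hC0 : (0 : ℝ) < C := by linarith
  have hCi : (C : ℝ)⁻¹ < 1 := inv_lt_one_of_one_lt₀ hCR
  have hCi0 : 0 < (C : ℝ)⁻¹ := by positivity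
  have hη0 : 0 < η := by rw [hη]; linarith
  have hη1 : 1 + η ≤ C := by
    rw [hη]
    have : (C : ℝ) * (C : ℝ)⁻¹ = 1 := mul_inv_cancel₀ hC0.ne'
    nlinarith
  have hAu : 0 < ‖A (b 0)‖ := norm_pos_iff.2 hA
  obtain ⟨V, hV, hVA⟩ := hf.exists_nhds_norm_apply_sub_le (mul_pos hη0 hAu)
  refine ⟨V, hV, fun B hB => ?_⟩
  set S : CSpace (k + 1) → CSpace (k + 1) := fun x => x - (A x / A (b 0)) • b 0 with hS
  have hSsub : ∀ x y, S x - S y = S (x - y) := fun x y => by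
    simp only [hS, map_sub, sub_div, sub_smul]; abel
  have hSA : ∀ x, A (S x) = 0 := fun x => by
    simp only [hS, map_sub, map_smul, smul_eq_mul]
    rw [div_mul_cancel₀ _ hA, sub_self]
  have hSw : ∀ x, w.repr (S x) 0 = 0 := fun x => by
    have h := hw (S x)
    rw [hSA] at h
    exact (mul_eq_zero.1 h.symm).resolve_left hAn
  have hPS : ∀ x, coordProj b (S x) = coordProj b x := fun x => by
    simp [hS, coordProj_basis_zero]
  have hclose : ∀ x ∈ B, ∀ y ∈ B, ‖S (x - y) - (x - y)‖ ≤ η * ‖x - y‖ := by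
    intro x hx y hy
    have h := hVA x (hB hx).1 y (hB hy).1 (hB hx).2 (hB hy).2
    have e : S (x - y) - (x - y) = -((A (x - y) / A (b 0)) • b 0) := by simp only [hS]; abel
    rw [e, norm_neg, norm_smul, norm_div, b.norm_eq_one, mul_one, div_le_iff₀ hAu]
    linarith
  have hupper : ∀ x ∈ B, ∀ y ∈ B, dist (S x) (S y) ≤ C * dist x y := by
    intro x hx y hy
    rw [dist_eq_norm, dist_eq_norm, hSsub]
    have h1 := hclose x hx y hy
    have h2 := norm_le_norm_add_norm_sub' (S (x - y)) (x - y)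
    nlinarith [norm_nonneg (x - y)]
  have hlower : ∀ x ∈ B, ∀ y ∈ B, dist x y ≤ C * dist (S x) (S y) := by
    intro x hx y hy
    rw [dist_eq_norm, dist_eq_norm, hSsub]
    have h1 := hclose x hx y hy
    have h2 := norm_le_norm_add_norm_sub (S (x - y)) (x - y)
    have h3 : (C : ℝ)⁻¹ * ‖x - y‖ ≤ ‖S (x - y)‖ := by
      have : η * ‖x - y‖ = ‖x - y‖ - (C : ℝ)⁻¹ * ‖x - y‖ := by rw [hη]; ring
      linarith
    rwa [inv_mul_le_iff₀ hC0] at h3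
  have hkey : Measure.euclideanHausdorffMeasure (k * 2) (coordProj b '' B) =
      ENNReal.ofReal (‖A (b 0)‖ ^ 2 / ‖A‖ ^ 2) *
        Measure.euclideanHausdorffMeasure (k * 2) (S '' B) := by
    have h1 := euclideanHausdorffMeasure_coordProj_image b w (B := S '' B)
      (by rintro _ ⟨x, -, rfl⟩; exact hSw x)
    rw [Set.image_image] at h1
    simp only [hPS] at h1
    rw [h1]
    congr 2
    rw [← div_pow, hw, norm_mul, Complex.norm_real, norm_norm,
      mul_div_cancel_left₀ _ (by simpa using hA0), norm_inner_symm,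
      OrthonormalBasis.repr_apply_apply]
  refine ⟨fun x hx y hy hxy => ?_, ?_, ?_⟩
  · have h1 : coordProj b (S (x - y)) = 0 := by rw [hPS, map_sub, hxy, sub_self]
    have h2 := coordSect_coordProj_add b (S (x - y))
    rw [h1, map_zero, zero_add] at h2
    have h3 := hSA (x - y)
    rw [← h2, map_smul, smul_eq_mul] at h3
    have h4 : S (x - y) = 0 := by rw [← h2, (mul_eq_zero.1 h3).resolve_right hA, zero_smul]
    have h5 := hlower x hx y hy
    rw [dist_eq_norm (S x), hSsub, h4, norm_zero, mul_zero] at h5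
    exact dist_le_zero.1 h5
  · rw [hkey, mul_left_comm]
    gcongr
    exact (LipschitzOnWith.of_dist_le_mul hupper).euclideanHausdorffMeasure_image_le _
  · rw [hkey, mul_left_comm]
    gcongr
    exact euclideanHausdorffMeasure_le_of_antilipschitz hlower _

/-- Near a regular zero where `b 0` is tangent, the projection along `b 0` almost annihilates
areas. -/
theorem exists_nhds_coordProj_area_le {f : CSpace (k + 1) → ℂ} {A : CSpace (k + 1) →L[ℂ] ℂ}
    {z₀ : CSpace (k + 1)} (hf : HasStrictFDerivAt f A z₀) (hA0 : A ≠ 0) (hA : A (b 0) = 0)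
    {m : NNReal} (hm : 0 < m) :
    ∃ V ∈ 𝓝 z₀, ∀ B ⊆ V ∩ {z | f z = 0},
      Measure.euclideanHausdorffMeasure (k * 2) (coordProj b '' B) ≤
        m * Measure.euclideanHausdorffMeasure (k * 2) B := by
  have hHaar := isAddHaarMeasure_euclideanHausdorffMeasure_CSpace k
  have hAn : 0 < ‖A‖ := by simpa using hA0
  obtain ⟨w, hw⟩ := exists_normal_basis A
  set L : CSpace k →L[ℝ] CSpace k :=
    ((coordProj b).comp (coordSect w).toContinuousLinearMap).restrictScalars ℝ with hL
  have hdet : L.det = 0 := by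
    have h := det_real_coordProj_comp_coordSect b w
    have h0 : inner ℂ (b 0) (w 0) = 0 := by
      have h1 := hw (b 0)
      rw [hA] at h1
      have h2 := (mul_eq_zero.1 h1.symm).resolve_left (by exact_mod_cast hAn.ne')
      rw [OrthonormalBasis.repr_apply_apply] at h2
      rw [← inner_conj_symm, h2, map_zero]
    rw [h0, norm_zero, zero_pow two_ne_zero] at h
    exact h
  have hev := addHaar_image_le_mul_of_det_lt
    (Measure.euclideanHausdorffMeasure (k * 2) : Measure (CSpace k)) L (m := m)
    (by rw [hdet]; simpa using hm)
  obtain ⟨δ, hδ, hδ0⟩ := (hev.and self_mem_nhdsWithin).exists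
  have hδ0 : (0 : ℝ) < δ := hδ0
  -- the tangential part of a difference dominates its normal part
  set η : ℝ := min (1 / 2) (δ / 2) with hη
  have hη0 : 0 < η := lt_min (by norm_num) (by positivity)
  have hη1 : η ≤ 1 / 2 := min_le_left _ _
  have hη2 : η ≤ δ / 2 := min_le_right _ _
  obtain ⟨V, hV, hVA⟩ := hf.exists_nhds_norm_apply_sub_le (mul_pos hη0 hAn)
  refine ⟨V, hV, fun B hB => ?_⟩
  have hclose : ∀ x ∈ B, ∀ y ∈ B,
      ‖(x - y) - coordSect w (coordProj w (x - y))‖ ≤ η * ‖x - y‖ := by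
    intro x hx y hy
    have h := hVA x (hB hx).1 y (hB hy).1 (hB hx).2 (hB hy).2
    have e : (x - y) - coordSect w (coordProj w (x - y)) = w.repr (x - y) 0 • w 0 := by
      conv_lhs => enter [1]; rw [← coordSect_coordProj_add w (x - y)]
      abel
    rw [e, norm_smul, w.norm_eq_one, mul_one]
    rw [hw, norm_mul, Complex.norm_real, norm_norm] at h
    nlinarith
  have hlower : ∀ x ∈ B, ∀ y ∈ B, ‖x - y‖ ≤ 2 * ‖coordProj w (x - y)‖ := by
    intro x hx y hy
    have h1 := hclose x hx y hy
    have h2 := norm_le_norm_add_norm_sub' (x - y) (coordSect w (coordProj w (x - y)))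
    rw [LinearIsometry.norm_map] at h2
    nlinarith [norm_nonneg (x - y)]
  have hinj : Set.InjOn (coordProj w) B := fun x hx y hy hxy => by
    have := hlower x hx y hy
    rw [map_sub, hxy, sub_self, norm_zero, mul_zero] at this
    exact sub_eq_zero.1 (norm_le_zero_iff.1 this)
  set g := Function.invFunOn (coordProj w) B with hg
  have hgl : ∀ x ∈ B, g (coordProj w x) = x := fun x hx => hinj.leftInvOn_invFunOn hx
  have happ : ApproximatesLinearOn (fun y => coordProj b (g y)) L (coordProj w '' B) δ := by
    rintro _ ⟨x, hx, rfl⟩ _ ⟨y, hy, rfl⟩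
    have e : coordProj b (g (coordProj w x)) - coordProj b (g (coordProj w y)) -
        L (coordProj w x - coordProj w y) =
        coordProj b ((x - y) - coordSect w (coordProj w (x - y))) := by
      rw [hgl x hx, hgl y hy]
      simp [hL, map_sub]
    rw [e]
    have h1 := norm_coordProj_le b ((x - y) - coordSect w (coordProj w (x - y)))
    have h2 := hclose x hx y hy
    have h3 := hlower x hx y hy
    rw [← map_sub]
    nlinarith [norm_nonneg (coordProj w (x - y)), norm_nonneg (x - y)]
  have h := hδ (coordProj w '' B) (fun y => coordProj b (g y)) happ
  rw [Set.image_image] at h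
  have e : (fun x => coordProj b (g (coordProj w x))) '' B = coordProj b '' B :=
    Set.image_congr fun x hx => by rw [hgl x hx]
  rw [e] at h
  refine h.trans ?_
  gcongr
  have hlip : LipschitzOnWith 1 (coordProj w) B := LipschitzOnWith.of_dist_le_mul fun x _ y _ => by
    rw [dist_eq_norm, dist_eq_norm, ← map_sub, NNReal.coe_one, one_mul]
    exact norm_coordProj_le w _
  simpa using hlip.euclideanHausdorffMeasure_image_le (k * 2)

variable {f : CSpace (k + 1) → ℂ}

theorem measurable_normalCosSq (hf : ContDiff ℂ 1 f) : Measurable (normalCosSq b f) := by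
  have h := hf.continuous_fderiv one_ne_zero
  have h1 : Measurable fun z => ‖fderiv ℂ f z (b 0)‖ ^ 2 :=
    ((h.clm_apply continuous_const).norm.pow 2).measurable
  exact h1.div (h.norm.pow 2).measurable

theorem normalCosSq_nonneg (z : CSpace (k + 1)) : 0 ≤ normalCosSq b f z := by
  unfold normalCosSq; positivity

theorem normalCosSq_le_one (z : CSpace (k + 1)) : normalCosSq b f z ≤ 1 := by
  refine div_le_one_of_le₀ ?_ (by positivity)
  have := (fderiv ℂ f z).le_opNorm (b 0)
  rw [b.norm_eq_one, mul_one] at this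
  gcongr

theorem ENNReal.le_of_forall_one_lt_le_pow_mul {x y : ENNReal} (n : ℕ)
    (h : ∀ C : NNReal, 1 < C → x ≤ (C : ENNReal) ^ n * y) : x ≤ y := by
  have ht : Tendsto (fun C : NNReal => (C : ENNReal) ^ n * y) (𝓝[>] 1) (𝓝 (1 * y)) := by
    refine ENNReal.Tendsto.mul_const (tendsto_nhdsWithin_of_tendsto_nhds ?_) (Or.inl one_ne_zero)
    have : Continuous fun C : NNReal => (C : ENNReal) ^ n :=
      (ENNReal.continuous_pow n).comp ENNReal.continuous_coe
    simpa using this.tendsto 1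
  rw [one_mul] at ht
  refine ge_of_tendsto ht ?_
  filter_upwards [self_mem_nhdsWithin] with C hC using h C hC

/-- The area formula for the projection along `b 0` on the part of the zero set where it is
injective and `b 0` is transversal. -/
theorem euclideanHausdorffMeasure_coordProj_image_eq_lintegral (hf : ContDiff ℂ 1 f)
    {B : Set (CSpace (k + 1))} (hB : MeasurableSet B)
    (hBf : ∀ z ∈ B, f z = 0 ∧ fderiv ℂ f z (b 0) ≠ 0) (hinj : Set.InjOn (coordProj b) B) :
    Measure.euclideanHausdorffMeasure (k * 2) (coordProj b '' B) =
      ∫⁻ z in B, ENNReal.ofReal (normalCosSq b f z)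
        ∂(Measure.euclideanHausdorffMeasure (k * 2)) := by
  set H : Measure (CSpace (k + 1)) := Measure.euclideanHausdorffMeasure (k * 2) with hH
  set lam : Measure (CSpace k) := Measure.euclideanHausdorffMeasure (k * 2) with hlam
  have hfd := hf.continuous_fderiv one_ne_zero
  have hPm : Continuous (coordProj b) := (coordProj b).continuous
  have key : ∀ C : NNReal, 1 < C →
      lam (coordProj b '' B) ≤ (C : ENNReal) ^ (k * 2 + 1) *
        ∫⁻ z in B, ENNReal.ofReal (normalCosSq b f z) ∂H ∧
      ∫⁻ z in B, ENNReal.ofReal (normalCosSq b f z) ∂H ≤ (C : ENNReal) ^ (k * 2 + 1) *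
        lam (coordProj b '' B) := by
    intro C hC
    have hCR : (1 : ℝ) < C := by exact_mod_cast hC
    obtain ⟨D, hDm, hDd, hDU, hDp⟩ := exists_measurable_partition hB
      (p := fun B' => MeasurableSet B' → lam (coordProj b '' B') ≤ (C : ENNReal) ^ (k * 2 + 1) *
        ∫⁻ z in B', ENNReal.ofReal (normalCosSq b f z) ∂H ∧
        ∫⁻ z in B', ENNReal.ofReal (normalCosSq b f z) ∂H ≤ (C : ENNReal) ^ (k * 2 + 1) *
          lam (coordProj b '' B')) (by simp) (by
      intro z₀ hz₀
      obtain ⟨V, hV, hVB⟩ := exists_nhds_coordProj_area b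
        (hf.contDiffAt.hasStrictFDerivAt (x := z₀) one_ne_zero) (hBf z₀ hz₀).2 hC
      have hA0 : 0 < ‖fderiv ℂ f z₀‖ := norm_pos_iff.2 fun h => by
        have := (hBf z₀ hz₀).2
        simp [h] at this
      have hJ0 : 0 < normalCosSq b f z₀ := by
        have := norm_pos_iff.2 (hBf z₀ hz₀).2
        unfold normalCosSq; positivity
      have hJc : ContinuousAt (normalCosSq b f) z₀ :=
        ContinuousAt.div (by exact ((hfd.clm_apply continuous_const).norm.pow 2).continuousAt)
          (hfd.norm.pow 2).continuousAt (by positivity)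
      have e1 : ∀ᶠ z in 𝓝 z₀, normalCosSq b f z₀ < C * normalCosSq b f z :=
        (hJc.const_mul (C : ℝ)).eventually (lt_mem_nhds (by nlinarith))
      have e2 : ∀ᶠ z in 𝓝 z₀, normalCosSq b f z < C * normalCosSq b f z₀ :=
        hJc.eventually (gt_mem_nhds (by nlinarith))
      refine ⟨V ∩ {z | normalCosSq b f z₀ < C * normalCosSq b f z ∧
        normalCosSq b f z < C * normalCosSq b f z₀}, inter_mem hV (e1.and e2), ?_⟩
      intro B' hB' hB'm
      obtain ⟨-, h1, h2⟩ := hVB B' fun z hz => ⟨(hB' hz).1.1, (hBf z (hB' hz).2).1⟩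
      have hJ : ‖fderiv ℂ f z₀ (b 0)‖ ^ 2 / ‖fderiv ℂ f z₀‖ ^ 2 = normalCosSq b f z₀ := rfl
      rw [hJ] at h1 h2
      have h3 : ENNReal.ofReal (normalCosSq b f z₀) * H B' ≤
          C * ∫⁻ z in B', ENNReal.ofReal (normalCosSq b f z) ∂H := by
        rw [← setLIntegral_const, ← lintegral_const_mul' _ _ ENNReal.coe_ne_top]
        refine setLIntegral_mono' hB'm fun z hz => ?_
        rw [← ENNReal.ofReal_coe_nnreal, ← ENNReal.ofReal_mul (by positivity)]
        exact ENNReal.ofReal_le_ofReal (hB' hz).1.2.1.le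
      have h4 : ∫⁻ z in B', ENNReal.ofReal (normalCosSq b f z) ∂H ≤
          C * (ENNReal.ofReal (normalCosSq b f z₀) * H B') := by
        rw [← mul_assoc, ← setLIntegral_const]
        refine setLIntegral_mono' hB'm fun z hz => ?_
        rw [← ENNReal.ofReal_coe_nnreal, ← ENNReal.ofReal_mul (by positivity)]
        exact ENNReal.ofReal_le_ofReal (hB' hz).1.2.2.le
      constructor
      · calc _ ≤ _ := h1
          _ ≤ (C : ENNReal) ^ (k * 2) *
            (C * ∫⁻ z in B', ENNReal.ofReal (normalCosSq b f z) ∂H) := by gcongr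
          _ = _ := by ring
      · calc _ ≤ _ := h4
          _ ≤ C * ((C : ENNReal) ^ (k * 2) * lam (coordProj b '' B')) := by gcongr
          _ = _ := by ring)
    have hsum : ∫⁻ z in B, ENNReal.ofReal (normalCosSq b f z) ∂H =
        ∑' i, ∫⁻ z in D i, ENNReal.ofReal (normalCosSq b f z) ∂H := by
      rw [← hDU, lintegral_iUnion hDm hDd]
    have hDB : ∀ i, D i ⊆ B := fun i => hDU ▸ Set.subset_iUnion D i
    have hsum2 : lam (coordProj b '' B) = ∑' i, lam (coordProj b '' D i) := by
      rw [← hDU, Set.image_iUnion, measure_iUnion]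
      · intro i j hij
        have := hDd hij
        rw [Function.onFun, Set.disjoint_left] at this ⊢
        rintro _ ⟨x, hx, rfl⟩ ⟨y, hy, hxy⟩
        rw [hinj (hDB j hy) (hDB i hx) hxy] at hy
        exact this hx hy
      · exact fun i => (hDm i).image_of_continuousOn_injOn hPm.continuousOn (hinj.mono (hDB i))
    rw [hsum, hsum2, ← ENNReal.tsum_mul_left, ← ENNReal.tsum_mul_left]
    exact ⟨ENNReal.tsum_le_tsum fun i => (hDp i (hDm i)).1,
      ENNReal.tsum_le_tsum fun i => (hDp i (hDm i)).2⟩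
  exact le_antisymm (ENNReal.le_of_forall_one_lt_le_pow_mul _ fun C hC => (key C hC).1)
    (ENNReal.le_of_forall_one_lt_le_pow_mul _ fun C hC => (key C hC).2)

/-- A smooth hypersurface has locally finite area. -/
theorem euclideanHausdorffMeasure_zeros_inter_lt_top (hf : ContDiff ℂ 1 f)
    (hreg : ∀ z, f z = 0 → fderiv ℂ f z ≠ 0) {K : Set (CSpace (k + 1))} (hK : IsCompact K) :
    Measure.euclideanHausdorffMeasure (k * 2) (K ∩ {z | f z = 0}) < ⊤ := by
  have hHaar := isAddHaarMeasure_euclideanHausdorffMeasure_CSpace k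
  have hZ : IsClosed {z | f z = 0} := isClosed_eq hf.continuous continuous_const
  refine (hK.inter_right hZ).measure_lt_top_of_nhdsWithin fun z₀ hz₀ => ?_
  obtain ⟨w, hw⟩ := exists_normal_basis (fderiv ℂ f z₀)
  have hAn : ‖fderiv ℂ f z₀‖ ≠ 0 := by simpa using hreg z₀ hz₀.2
  have hw0 : fderiv ℂ f z₀ (w 0) = (‖fderiv ℂ f z₀‖ : ℂ) := by rw [hw]; simp [w.repr_self]
  obtain ⟨V, hV, hVB⟩ := exists_nhds_coordProj_area w
    (hf.contDiffAt.hasStrictFDerivAt (x := z₀) one_ne_zero)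
    (by rw [hw0]; exact_mod_cast hAn) (C := 2) one_lt_two
  refine ⟨V ∩ (K ∩ {z | f z = 0}), inter_mem (mem_nhdsWithin_of_mem_nhds hV) self_mem_nhdsWithin, ?_⟩
  obtain ⟨-, -, h⟩ := hVB (V ∩ (K ∩ {z | f z = 0})) fun z hz => ⟨hz.1, hz.2.2⟩
  rw [hw0, Complex.norm_real, norm_norm, div_self (pow_ne_zero 2 hAn), ENNReal.ofReal_one,
    one_mul] at h
  refine h.trans_lt (ENNReal.mul_lt_top (by simp) ?_)
  exact (measure_mono (Set.image_mono fun z hz => hz.2.1)).trans_lt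
    (hK.image (coordProj w).continuous).measure_lt_top

/-- The tangency points of the direction `b 0` project to a null set. -/
theorem euclideanHausdorffMeasure_coordProj_critical (hf : ContDiff ℂ 1 f)
    (hreg : ∀ z, f z = 0 → fderiv ℂ f z ≠ 0) :
    Measure.euclideanHausdorffMeasure (k * 2)
      (coordProj b '' {z | f z = 0 ∧ fderiv ℂ f z (b 0) = 0}) = 0 := by
  set H : Measure (CSpace (k + 1)) := Measure.euclideanHausdorffMeasure (k * 2) with hH
  have hfd := hf.continuous_fderiv one_ne_zero
  set S := {z | f z = 0 ∧ fderiv ℂ f z (b 0) = 0} with hS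
  have hSc : IsClosed S := (isClosed_eq hf.continuous continuous_const).inter
    (isClosed_eq (hfd.clm_apply continuous_const) continuous_const)
  have hcov : S = ⋃ n : ℕ, Metric.closedBall 0 n ∩ S := by
    rw [← Set.iUnion_inter, Metric.iUnion_closedBall_nat, Set.univ_inter]
  rw [hcov, Set.image_iUnion, measure_iUnion_null_iff]
  intro n
  have hTm : MeasurableSet (Metric.closedBall 0 (n : ℝ) ∩ S) :=
    Metric.isClosed_closedBall.measurableSet.inter hSc.measurableSet
  have hfin : H (Metric.closedBall 0 (n : ℝ) ∩ S) < ⊤ :=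
    (measure_mono (Set.inter_subset_inter_right _ fun z hz => hz.1)).trans_lt
      (euclideanHausdorffMeasure_zeros_inter_lt_top hf hreg (isCompact_closedBall 0 (n : ℝ)))
  have key : ∀ m : NNReal, 0 < m → Measure.euclideanHausdorffMeasure (k * 2)
      (coordProj b '' (Metric.closedBall 0 (n : ℝ) ∩ S)) ≤
        m * H (Metric.closedBall 0 (n : ℝ) ∩ S) := by
    intro m hm
    obtain ⟨D, hDm, hDd, hDU, hDp⟩ := exists_measurable_partition hTm
      (p := fun B => Measure.euclideanHausdorffMeasure (k * 2) (coordProj b '' B) ≤ m * H B)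
      (by simp) (by
        intro z₀ hz₀
        obtain ⟨V, hV, hVB⟩ := exists_nhds_coordProj_area_le b
          (hf.contDiffAt.hasStrictFDerivAt (x := z₀) one_ne_zero) (hreg z₀ hz₀.2.1) hz₀.2.2 hm
        exact ⟨V, hV, fun B hB => hVB B fun z hz => ⟨(hB hz).1, (hB hz).2.2.1⟩⟩)
    rw [← hDU, Set.image_iUnion, measure_iUnion hDd hDm, ← ENNReal.tsum_mul_left]
    exact (measure_iUnion_le _).trans (ENNReal.tsum_le_tsum hDp)
  by_contra hne
  have ht : Tendsto (fun m : NNReal => (m : ENNReal) * H (Metric.closedBall 0 (n : ℝ) ∩ S))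
      (𝓝[>] 0) (𝓝 (0 * H (Metric.closedBall 0 (n : ℝ) ∩ S))) :=
    ENNReal.Tendsto.mul_const (tendsto_nhdsWithin_of_tendsto_nhds
      (by simpa using ENNReal.continuous_coe.tendsto (0 : NNReal))) (Or.inr hfin.ne)
  rw [zero_mul] at ht
  have := ge_of_tendsto ht (by filter_upwards [self_mem_nhdsWithin] with m hm using key m hm)
  exact hne (le_antisymm this bot_le)

end Area

/-! ### Slicing a hypersurface by complex lines -/

section Slices

variable {k : ℕ} (b : OrthonormalBasis (Fin (k + 1)) ℂ (CSpace (k + 1))) {f : CSpace (k + 1) → ℂ}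

/-- The area formula as a change of variables, valid for arbitrary functions on the base. -/
theorem integral_comp_coordProj (hf : ContDiff ℂ 1 f) {B : Set (CSpace (k + 1))}
    (hB : MeasurableSet B) (hBf : ∀ z ∈ B, f z = 0 ∧ fderiv ℂ f z (b 0) ≠ 0)
    (hinj : Set.InjOn (coordProj b) B) (h : CSpace k → ℝ) :
    (IntegrableOn (fun z => normalCosSq b f z * h (coordProj b z)) B
      (Measure.euclideanHausdorffMeasure (k * 2)) ↔
      IntegrableOn h (coordProj b '' B) (Measure.euclideanHausdorffMeasure (k * 2))) ∧
    ∫ z in B, normalCosSq b f z * h (coordProj b z) ∂(Measure.euclideanHausdorffMeasure (k * 2)) =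
      ∫ y in coordProj b '' B, h y ∂(Measure.euclideanHausdorffMeasure (k * 2)) := by
  set H : Measure (CSpace (k + 1)) := Measure.euclideanHausdorffMeasure (k * 2) with hH
  set lam : Measure (CSpace k) := Measure.euclideanHausdorffMeasure (k * 2) with hlam
  have hJm : Measurable fun z => ENNReal.ofReal (normalCosSq b f z) :=
    (measurable_normalCosSq b hf).ennreal_ofReal
  set HJ : Measure (CSpace (k + 1)) :=
    H.withDensity fun z => ENNReal.ofReal (normalCosSq b f z) with hHJ
  have hPc : Continuous (coordProj b) := (coordProj b).continuous
  have he : MeasurableEmbedding (B.domRestrict (coordProj b)) :=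
    ContinuousOn.measurableEmbedding hB hPc.continuousOn hinj
  have hrange : ∀ s : Set (CSpace k),
      Subtype.val '' (B.domRestrict (coordProj b) ⁻¹' s) = B ∩ coordProj b ⁻¹' s := by
    intro s; ext z; simp [Set.domRestrict, and_comm]
  have hmap : (HJ.comap (Subtype.val : B → CSpace (k + 1))).map (B.domRestrict (coordProj b)) =
      lam.restrict (coordProj b '' B) := by
    ext s hs
    rw [he.map_apply, (MeasurableEmbedding.subtype_coe hB).comap_apply, hrange,
      Measure.restrict_apply hs, hHJ, withDensity_apply _ (hB.inter (hPc.measurable hs)),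
      ← euclideanHausdorffMeasure_coordProj_image_eq_lintegral b hf
        (hB.inter (hPc.measurable hs)) (fun z hz => hBf z hz.1) (hinj.mono Set.inter_subset_left),
      Set.image_inter_preimage, Set.inter_comm]
  have htr : ∀ z, (ENNReal.ofReal (normalCosSq b f z)).toReal = normalCosSq b f z := fun z =>
    ENNReal.toReal_ofReal (normalCosSq_nonneg b z)
  have hlt : ∀ᵐ z ∂(H.restrict B), ENNReal.ofReal (normalCosSq b f z) < ⊤ :=
    ae_of_all _ fun z => ENNReal.ofReal_lt_top
  have hrestr : HJ.restrict B =
      (H.restrict B).withDensity fun z => ENNReal.ofReal (normalCosSq b f z) :=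
    restrict_withDensity hB _
  constructor
  · have h1 := integrable_withDensity_iff_integrable_smul' (μ := H.restrict B) hJm hlt
      (g := fun z => h (coordProj b z))
    simp only [htr, smul_eq_mul] at h1
    rw [IntegrableOn, ← h1, ← hrestr, ← map_comap_subtype_coe hB,
      (MeasurableEmbedding.subtype_coe hB).integrable_map_iff, IntegrableOn, ← hmap,
      he.integrable_map_iff]
    rfl
  · have h1 := integral_withDensity_eq_integral_toReal_smul₀ (μ := H.restrict B)
      hJm.aemeasurable hlt (fun z => h (coordProj b z))
    simp only [htr, smul_eq_mul] at h1
    rw [← h1, ← hrestr, ← integral_subtype_comap hB, ← hmap, he.integral_map]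
    rfl

variable {G : CSpace k → Polynomial ℂ}

theorem eval_derivative_slice (hf : Differentiable ℂ f)
    (hG : ∀ y s, (G y).eval s = f (coordSect b y + s • b 0)) (y : CSpace k) (s : ℂ) :
    (G y).derivative.eval s = fderiv ℂ f (coordSect b y + s • b 0) (b 0) := by
  have h1 := (G y).hasDerivAt s
  have h2 : HasDerivAt (fun s : ℂ => coordSect b y + s • b 0) ((1 : ℂ) • b 0) s :=
    ((hasDerivAt_id s).smul_const (b 0)).const_add _
  have h3 := (hf (coordSect b y + s • b 0)).hasFDerivAt.comp_hasDerivAt s h2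
  rw [one_smul] at h3
  refine h1.unique (h3.congr_of_eventuallyEq (Eventually.of_forall fun t => ?_))
  exact hG y t

theorem isFiniteMeasureOnCompacts_zeros (hf : ContDiff ℂ 1 f)
    (hreg : ∀ z, f z = 0 → fderiv ℂ f z ≠ 0) :
    IsFiniteMeasureOnCompacts ((Measure.euclideanHausdorffMeasure (k * 2) :
      Measure (CSpace (k + 1))).restrict {z | f z = 0}) := by
  refine ⟨fun K hK => ?_⟩
  rw [Measure.restrict_apply hK.measurableSet]
  exact euclideanHausdorffMeasure_zeros_inter_lt_top hf hreg hK

theorem integrableOn_normalCosSq_mul (hf : ContDiff ℂ 1 f)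
    (hreg : ∀ z, f z = 0 → fderiv ℂ f z ≠ 0) {χ : CSpace (k + 1) → ℝ} (hχ : Continuous χ)
    (hs : HasCompactSupport χ) :
    IntegrableOn (fun z => normalCosSq b f z * χ z) {z | f z = 0}
      (Measure.euclideanHausdorffMeasure (k * 2)) := by
  have := isFiniteMeasureOnCompacts_zeros hf hreg
  refine (hχ.integrable_of_hasCompactSupport hs).bdd_mul (c := 1)
    (measurable_normalCosSq b hf).aestronglyMeasurable (ae_of_all _ fun z => ?_)
  rw [Real.norm_of_nonneg (normalCosSq_nonneg b z)]
  exact normalCosSq_le_one b z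

/-- The integral of `χ` over a smooth hypersurface against the area of its projection along `b 0` is
obtained by summing `χ` over the intersections with the complex lines parallel to `b 0` and
integrating over the lines. -/
theorem integral_normalCosSq_mul_eq_integral_roots (hf : ContDiff ℂ 1 f)
    (hreg : ∀ z, f z = 0 → fderiv ℂ f z ≠ 0)
    (hG : ∀ y s, (G y).eval s = f (coordSect b y + s • b 0))
    {χ : CSpace (k + 1) → ℝ} (hχ : Continuous χ) (hs : HasCompactSupport χ) :
    (∀ᵐ y ∂(Measure.euclideanHausdorffMeasure (k * 2) : Measure (CSpace k)), G y ≠ 0) ∧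
    ∫ z in {z | f z = 0}, normalCosSq b f z * χ z ∂(Measure.euclideanHausdorffMeasure (k * 2)) =
      ∫ y, ((G y).roots.map fun s => χ (coordSect b y + s • b 0)).sum
        ∂(Measure.euclideanHausdorffMeasure (k * 2)) := by
  set H : Measure (CSpace (k + 1)) := Measure.euclideanHausdorffMeasure (k * 2) with hH
  set lam : Measure (CSpace k) := Measure.euclideanHausdorffMeasure (k * 2) with hlam
  have hfd := hf.continuous_fderiv one_ne_zero
  have hder := eval_derivative_slice b (hf.differentiable one_ne_zero) hG
  set Z := {z | f z = 0} with hZ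
  set N := {z | f z = 0 ∧ fderiv ℂ f z (b 0) ≠ 0} with hN
  have hZm : MeasurableSet Z := (isClosed_eq hf.continuous continuous_const).measurableSet
  have hNm : MeasurableSet N := hZm.inter
    (isOpen_ne_fun (hfd.clm_apply continuous_const) continuous_const).measurableSet
  have hproj : ∀ y (s : ℂ), coordProj b (coordSect b y + s • b 0) = y := fun y s => by
    rw [map_add, map_smul, coordProj_basis_zero, smul_zero, add_zero, coordProj_coordSect]
  have hsinj : ∀ y (s t : ℂ), coordSect b y + s • b 0 = coordSect b y + t • b 0 → s = t := by
    intro y s t h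
    have hb : b 0 ≠ 0 := b.orthonormal.ne_zero 0
    exact smul_left_injective ℂ hb (add_left_cancel h)
  obtain ⟨D, hDm, hDd, hDU, hDinj⟩ := exists_measurable_partition hNm
    (p := fun B => Set.InjOn (coordProj b) B) (by simp) (by
      intro z₀ hz₀
      obtain ⟨V, hV, hVB⟩ := exists_nhds_coordProj_area b
        (hf.contDiffAt.hasStrictFDerivAt (x := z₀) one_ne_zero) hz₀.2 (C := 2) one_lt_two
      exact ⟨V, hV, fun B hB => (hVB B fun z hz => ⟨(hB hz).1, (hB hz).2.1⟩).1⟩)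
  have hDN : ∀ i, D i ⊆ N := fun i => hDU ▸ Set.subset_iUnion D i
  -- the points of the line over `y` in the piece `D i`; at most one of the summands is nonzero
  set h : ℕ → CSpace k → ℝ := fun i y => ∑ s ∈ (G y).roots.toFinset,
    (D i).indicator χ (coordSect b y + s • b 0) with hh
  have hhD : ∀ i, ∀ z ∈ D i, h i (coordProj b z) = χ z := by
    intro i z hz
    have hzN := hDN i hz
    have e := coordSect_coordProj_add b z
    have hev : (G (coordProj b z)).eval (b.repr z 0) = 0 := by rw [hG, e]; exact hzN.1
    have hG0 : G (coordProj b z) ≠ 0 := fun h0 => by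
      have := hder (coordProj b z) (b.repr z 0)
      rw [e, h0] at this
      exact hzN.2 (by simpa using this.symm)
    simp only [hh]
    rw [Finset.sum_eq_single (b.repr z 0)]
    · rw [e, Set.indicator_of_mem hz]
    · intro s _ hs
      refine Set.indicator_of_notMem (fun hsD => hs ?_) _
      refine hsinj (coordProj b z) _ _ ?_
      rw [e]
      exact hDinj i hsD hz (hproj _ _)
    · intro hn
      exact absurd (by simpa [hG0] using hev) hn
  have hh0 : ∀ i, ∀ y ∉ coordProj b '' D i, h i y = 0 := by
    intro i y hy
    refine Finset.sum_eq_zero fun s _ => Set.indicator_of_notMem (fun hsD => hy ?_) _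
    exact ⟨_, hsD, hproj y s⟩
  have hPDm : ∀ i, MeasurableSet (coordProj b '' D i) := fun i =>
    (hDm i).image_of_continuousOn_injOn (coordProj b).continuous.continuousOn (hDinj i)
  have hint := integrableOn_normalCosSq_mul b hf hreg hχ hs
  have hNZ : N ⊆ Z := fun z hz => hz.1
  have hcv := fun (i : ℕ) (g : CSpace k → ℝ) =>
    integral_comp_coordProj b hf (hDm i) (hDN i) (hDinj i) g
  have hcongr : ∀ i, Set.EqOn (fun z => normalCosSq b f z * χ z)
      (fun z => normalCosSq b f z * h i (coordProj b z)) (D i) := fun i z hz => by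
    simp only [hhD i z hz]
  have hhint : ∀ i, Integrable (h i) lam := fun i => by
    rw [← integrableOn_iff_integrable_of_support_subset (s := coordProj b '' D i)
      (fun y hy => by by_contra hc; exact hy (hh0 i y hc)), ← (hcv i (h i)).1]
    exact ((hint.mono_set hNZ).mono_set (hDN i)).congr_fun (hcongr i) (hDm i)
  have hhval : ∀ i, ∫ y, h i y ∂lam = ∫ z in D i, normalCosSq b f z * χ z ∂H := fun i => by
    rw [setIntegral_congr_fun (hDm i) (hcongr i), (hcv i (h i)).2,
      setIntegral_eq_integral_of_forall_compl_eq_zero (hh0 i)]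
  have hhnorm : ∀ i, ∫ y, ‖h i y‖ ∂lam = ∫ z in D i, ‖normalCosSq b f z * χ z‖ ∂H := fun i => by
    have : Set.EqOn (fun z => ‖normalCosSq b f z * χ z‖)
        (fun z => normalCosSq b f z * ‖h i (coordProj b z)‖) (D i) := fun z hz => by
      simp only [hhD i z hz, norm_mul, Real.norm_of_nonneg (normalCosSq_nonneg b z)]
    rw [setIntegral_congr_fun (hDm i) this, (hcv i fun y => ‖h i y‖).2,
      setIntegral_eq_integral_of_forall_compl_eq_zero fun y hy => by rw [hh0 i y hy, norm_zero]]
  have hsum1 : Summable fun i => ∫ y, ‖h i y‖ ∂lam := by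
    simp only [hhnorm]
    refine (hasSum_integral_iUnion hDm hDd ?_).summable
    rw [hDU]
    exact (hint.mono_set hNZ).norm
  have hS1 := hasSum_integral_of_summable_integral_norm hhint hsum1
  have hS2 : HasSum (fun i => ∫ y, h i y ∂lam) (∫ z in N, normalCosSq b f z * χ z ∂H) := by
    simp only [hhval]
    have := hasSum_integral_iUnion hDm hDd (f := fun z => normalCosSq b f z * χ z) (μ := H)
      (by rw [hDU]; exact hint.mono_set hNZ)
    rwa [hDU] at this
  have hZN : ∫ z in Z, normalCosSq b f z * χ z ∂H = ∫ z in N, normalCosSq b f z * χ z ∂H := by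
    refine setIntegral_eq_of_subset_of_forall_sdiff_eq_zero hZm hNZ fun z hz => ?_
    have : fderiv ℂ f z (b 0) = 0 := by
      by_contra hc
      exact hz.2 ⟨hz.1, hc⟩
    simp [normalCosSq, this]
  have hcrit : ∀ᵐ y ∂lam, y ∉ coordProj b '' {z | f z = 0 ∧ fderiv ℂ f z (b 0) = 0} :=
    compl_mem_ae_iff.2 (euclideanHausdorffMeasure_coordProj_critical b hf hreg)
  have hsimple : ∀ y ∉ coordProj b '' {z | f z = 0 ∧ fderiv ℂ f z (b 0) = 0},
      ∀ s, (G y).eval s = 0 → (G y).derivative.eval s ≠ 0 := by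
    intro y hy s hs0 hs1
    rw [hG] at hs0
    rw [hder] at hs1
    exact hy ⟨_, ⟨hs0, hs1⟩, hproj y s⟩
  have hGne : ∀ y ∉ coordProj b '' {z | f z = 0 ∧ fderiv ℂ f z (b 0) = 0}, G y ≠ 0 := by
    intro y hy h0
    exact hsimple y hy 0 (by simp [h0]) (by simp [h0])
  refine ⟨hcrit.mono hGne, ?_⟩
  rw [hZN, ← hS1.unique hS2]
  refine integral_congr_ae (hcrit.mono fun y hy => ?_)
  have hnd : (G y).roots.Nodup := by
    rw [Multiset.nodup_iff_count_le_one]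
    intro s
    by_contra hc
    rw [not_le, Polynomial.count_roots, Polynomial.one_lt_rootMultiplicity_iff_isRoot (hGne y hy)]
      at hc
    exact hsimple y hy s hc.1 hc.2
  have hpiece : ∀ s ∈ (G y).roots.toFinset,
      HasSum (fun i => (D i).indicator χ (coordSect b y + s • b 0))
        (χ (coordSect b y + s • b 0)) := by
    intro s hs'
    have hs0 : (G y).eval s = 0 := by
      rw [Multiset.mem_toFinset, Polynomial.mem_roots (hGne y hy)] at hs'
      exact hs'
    have hsN : coordSect b y + s • b 0 ∈ N := by
      have h1 := hsimple y hy s hs0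
      rw [hder] at h1
      rw [hG] at hs0
      exact ⟨hs0, h1⟩
    rw [← hDU, Set.mem_iUnion] at hsN
    obtain ⟨i, hi⟩ := hsN
    have := hasSum_single (f := fun i => (D i).indicator χ (coordSect b y + s • b 0)) i
      fun j hj => Set.indicator_of_notMem
        (fun hj' => Set.disjoint_left.1 (hDd hj) hj' hi) _
    simpa [Set.indicator_of_mem hi] using this
  simp only [hh]
  rw [(hasSum_sum hpiece).tsum_eq, Finset.sum, Multiset.toFinset_val, hnd.dedup]

end Slices

/-! ### The Poincaré–Lelong formula in one direction -/

theorem contDiff_polyEval {m : ℕ} (g : MvPolynomial (Fin m) ℂ) {n : WithTop ℕ∞} :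
    ContDiff ℂ n (polyEval g) := by
  have : polyEval g = fun z : CSpace m => ∑ d ∈ g.support, g.coeff d * ∏ i, z i ^ d i := by
    ext z
    rw [polyEval, MvPolynomial.eval_eq']
  rw [this]
  exact ContDiff.sum fun d _ => contDiff_const.mul (contDiff_prod fun i _ =>
    ContDiff.pow (contDiff_piLp_apply 2) _)

section Slicing

variable {k : ℕ} (b : OrthonormalBasis (Fin (k + 1)) ℂ (CSpace (k + 1)))

/-- The restriction of a polynomial to the complex line through `coordSect b y` in the direction
`b 0`. -/
noncomputable def slicePoly (g : MvPolynomial (Fin (k + 1)) ℂ) (y : CSpace k) : Polynomial ℂ :=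
  MvPolynomial.aeval
    (fun i => Polynomial.C (coordSect b y i) + Polynomial.C (b 0 i) * Polynomial.X) g

theorem eval_slicePoly (g : MvPolynomial (Fin (k + 1)) ℂ) (y : CSpace k) (s : ℂ) :
    (slicePoly b g y).eval s = polyEval g (coordSect b y + s • b 0) := by
  unfold slicePoly polyEval
  induction g using MvPolynomial.induction_on with
  | C a => simp
  | add p q hp hq => simp only [map_add, Polynomial.eval_add, hp, hq]
  | mul_X p i hp =>
    simp only [map_mul, Polynomial.eval_mul, hp]
    congr 1
    simp
    ring

/-- The splitting of `ℂ^(k+1)` into the direction `b 0` and its orthogonal complement. -/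
noncomputable def coordEquiv : (CSpace k × ℂ) ≃L[ℝ] CSpace (k + 1) :=
  LinearEquiv.toContinuousLinearEquiv
    { toFun := fun p => coordSect b p.1 + p.2 • b 0
      invFun := fun x => (coordProj b x, b.repr x 0)
      map_add' := fun p q => by simp [add_smul]; abel
      map_smul' := fun c p => by
        have := (coordSect b).map_smul (c : ℂ) p.1
        simp only [Complex.coe_smul] at this
        simp [this, mul_smul]
      left_inv := fun p => by
        ext <;> simp [coordProj_basis_zero, repr_coordSect_zero, b.repr_self]
      right_inv := fun x => coordSect_coordProj_add b x }

theorem coordEquiv_apply (p : CSpace k × ℂ) : coordEquiv b p = coordSect b p.1 + p.2 • b 0 := rfl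

/-- Integration over `ℂ^(k+1)` as an iterated integral along complex lines. -/
theorem exists_integral_eq_mul_integral_slices : ∃ c : ℝ, ∀ h : CSpace (k + 1) → ℝ, Integrable h →
    ∫ y, ∫ s : ℂ, h (coordSect b y + s • b 0) ∂(volume : Measure ℂ)
      ∂(Measure.euclideanHausdorffMeasure (k * 2)) = c * ∫ z, h z := by
  have := isAddHaarMeasure_euclideanHausdorffMeasure_CSpace k
  set lam : Measure (CSpace k) := Measure.euclideanHausdorffMeasure (k * 2) with hlam
  have hH : (Measure.map (coordEquiv b) (lam.prod volume)).IsAddHaarMeasure :=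
    (coordEquiv b).isAddHaarMeasure_map _
  obtain ⟨c, hc⟩ : ∃ c : NNReal, Measure.map (coordEquiv b) (lam.prod volume) = c • volume :=
    ⟨_, Measure.isAddLeftInvariant_eq_smul _ _⟩
  refine ⟨c, fun h hh => ?_⟩
  have hme : MeasurableEmbedding (coordEquiv b) :=
    (coordEquiv b).toHomeomorph.measurableEmbedding
  have h1 : Integrable h (Measure.map (coordEquiv b) (lam.prod volume)) := by
    rw [hc]; exact hh.smul_measure_nnreal
  rw [hme.integrable_map_iff] at h1
  have h2 := integral_prod _ h1
  simp only [Function.comp, coordEquiv_apply] at h2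
  rw [← h2]
  have h3 := hme.integral_map (μ := lam.prod volume) h
  simp only [coordEquiv_apply] at h3
  rw [← h3, hc, integral_smul_nnreal_measure]
  simp [NNReal.smul_def]

theorem secondDeriv_comp_line {χ : CSpace (k + 1) → ℝ} (hχ : ContDiff ℝ ∞ χ) (a u : CSpace (k + 1))
    (v s : ℂ) :
    secondDeriv (fun s : ℂ => χ (a + s • u)) v s = secondDeriv χ (v • u) (a + s • u) := by
  have hline : ∀ s : ℂ, HasFDerivAt (fun s : ℂ => a + s • u)
      ((ContinuousLinearMap.toSpanSingleton ℂ u).restrictScalars ℝ) s := fun s => by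
    have := (((ContinuousLinearMap.toSpanSingleton ℂ u).restrictScalars ℝ).hasFDerivAt
      (x := s)).const_add a
    exact this
  have h1 : ∀ s : ℂ, fderiv ℝ (fun s : ℂ => χ (a + s • u)) s v =
      fderiv ℝ χ (a + s • u) (v • u) := fun s => by
    have := ((hχ.differentiable (by simp) (a + s • u)).hasFDerivAt.comp s (hline s)).fderiv
    rw [Function.comp_def] at this
    rw [this]
    simp
  have hd : ContDiff ℝ ∞ (fun w => fderiv ℝ χ w (v • u)) :=
    (hχ.fderiv_right (m := ∞) (by simp)).clm_apply contDiff_const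
  unfold secondDeriv
  simp only [h1]
  have := ((hd.differentiable (by simp) (a + s • u)).hasFDerivAt.comp s (hline s)).fderiv
  rw [Function.comp_def] at this
  rw [this]
  simp

/-- The Poincaré–Lelong formula for the component of the current of integration in the direction
`b 0`: integrate the formula in one variable over the complex lines parallel to `b 0`. -/
theorem exists_integral_normalCosSq_mul_eq_integral_log : ∃ c : ℝ,
    ∀ g : MvPolynomial (Fin (k + 1)) ℂ, (∀ z, polyEval g z = 0 → fderiv ℂ (polyEval g) z ≠ 0) →
    ∀ χ : CSpace (k + 1) → ℝ, ContDiff ℝ ∞ χ → HasCompactSupport χ →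
    Integrable (fun z => Real.log ‖polyEval g z‖ *
      (secondDeriv χ (b 0) z + secondDeriv χ (Complex.I • b 0) z)) →
    ∫ z in {z | polyEval g z = 0}, normalCosSq b (polyEval g) z * χ z
        ∂(Measure.euclideanHausdorffMeasure (k * 2)) =
      c * ∫ z, Real.log ‖polyEval g z‖ *
        (secondDeriv χ (b 0) z + secondDeriv χ (Complex.I • b 0) z) := by
  obtain ⟨c, hc⟩ := exists_integral_eq_mul_integral_slices b
  refine ⟨(2 * Real.pi)⁻¹ * c, fun g hreg χ hχ hs hint => ?_⟩
  obtain ⟨hne, h⟩ := integral_normalCosSq_mul_eq_integral_roots b (contDiff_polyEval g) hreg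
    (fun y s => eval_slicePoly b g y s) hχ.continuous hs
  rw [h, mul_assoc, ← hc _ hint, ← integral_const_mul]
  refine integral_congr_ae (hne.mono fun y hy => ?_)
  have hχy : ContDiff ℝ ∞ (fun s : ℂ => χ (coordSect b y + s • b 0)) :=
    hχ.comp (contDiff_const.add (contDiff_id.smul contDiff_const))
  have hsy : HasCompactSupport (fun s : ℂ => χ (coordSect b y + s • b 0)) := by
    refine hs.comp_isClosedEmbedding (g := fun s : ℂ => coordSect b y + s • b 0) ?_
    have hb : b 0 ≠ 0 := b.orthonormal.ne_zero 0
    exact (Homeomorph.addLeft (coordSect b y)).isClosedEmbedding.comp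
      (isClosedEmbedding_smul_left hb)
  have h1 := integral_log_norm_polynomial_mul_laplacian hχy hsy hy
  simp only [secondDeriv_comp_line hχ, one_smul, eval_slicePoly] at h1
  simp only
  rw [h1, inv_mul_cancel_left₀ (by positivity)]

end Slicing

/-! ### Restricting a form to a complex hyperplane -/

section Restriction

variable {k : ℕ}

/-- Up to order, the real frame `w 0, i w 0, w 1, i w 1, …` of a complex frame, with the two
vectors coming from `w 0` separated from the others. -/
noncomputable def splitFrame (w : Fin (k + 1) → CSpace (k + 1)) :
    Fin 2 ⊕ Fin (k * 2) → CSpace (k + 1) :=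
  Sum.elim (fun i => Complex.I ^ (i : ℕ) • w 0) (realFrame fun j => w j.succ)

theorem exists_basis_eq_splitFrame (w : OrthonormalBasis (Fin (k + 1)) ℂ (CSpace (k + 1))) :
    ∃ B : Module.Basis (Fin 2 ⊕ Fin (k * 2)) ℝ (CSpace (k + 1)), ⇑B = splitFrame w := by
  set e : Fin 2 ⊕ Fin (k * 2) → Fin 2 × Fin (k + 1) :=
    Sum.elim (fun i => (i, 0)) (fun l => (l.modNat, l.divNat.succ)) with he
  have hinj : Function.Injective e := by
    rintro (i | i) (j | j) h
    · simpa [he] using h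
    · simp [he, Prod.ext_iff] at h
      exact absurd h.2 (Fin.succ_ne_zero _).symm
    · simp [he, Prod.ext_iff] at h
    · simp only [he, Sum.elim_inr, Prod.mk.injEq, Fin.succ_inj] at h
      congr 1
      apply (finProdFinEquiv (m := k) (n := 2)).symm.injective
      exact Prod.ext h.2 h.1
  have hbij : Function.Bijective e :=
    (Fintype.bijective_iff_injective_and_card e).2 ⟨hinj, by simp; ring⟩
  refine ⟨(Complex.basisOneI.smulTower w.toBasis).reindex (Equiv.ofBijective e hbij).symm, ?_⟩
  have h2 : ∀ i : Fin 2, Complex.basisOneI i = Complex.I ^ (i : ℕ) := fun i => by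
    fin_cases i <;> simp
  ext1 i
  rw [Module.Basis.reindex_apply, Equiv.symm_symm, Equiv.ofBijective_apply,
    Module.Basis.smulTower_apply, h2]
  rcases i with i | i
  · simp [he, splitFrame]
  · simp [he, splitFrame, realFrame]

theorem det_restrictScalars_eq_one_of_map_orthonormalBasis
    {U : CSpace (k + 1) →ₗ[ℂ] CSpace (k + 1)}
    {w w' : OrthonormalBasis (Fin (k + 1)) ℂ (CSpace (k + 1))} (hU : ∀ j, U (w' j) = w j) :
    LinearMap.det (U.restrictScalars ℝ) = 1 := by
  have h := Matrix.det_of_mem_unitary (w'.toMatrix_orthonormalBasis_mem_unitary w)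
  have e : LinearMap.toMatrix w'.toBasis w'.toBasis U = w'.toBasis.toMatrix w := by
    ext i j
    rw [LinearMap.toMatrix_apply, Module.Basis.toMatrix_apply, w'.coe_toBasis, hU]
  have h1 : ‖LinearMap.det U‖ = 1 := by
    rw [← LinearMap.det_toMatrix w'.toBasis, e]
    exact CStarRing.norm_of_mem_unitary h
  rw [LinearMap.det_restrictScalars, Algebra.norm_complex_apply, Complex.normSq_eq_norm_sq, h1,
    one_pow]

/-- A real alternating form of top degree takes the same value on the real frames of all unitary
bases, because unitary maps have real determinant one. -/
theorem AlternatingMap.map_splitFrame_eq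
    (A : CSpace (k + 1) [⋀^Fin 2 ⊕ Fin (k * 2)]→ₗ[ℝ] ℝ)
    (w w' : OrthonormalBasis (Fin (k + 1)) ℂ (CSpace (k + 1))) :
    A (splitFrame w) = A (splitFrame w') := by
  obtain ⟨B, hB⟩ := exists_basis_eq_splitFrame w'
  obtain ⟨U, hU⟩ : ∃ U : CSpace (k + 1) →ₗ[ℂ] CSpace (k + 1), ∀ j, U (w' j) = w j :=
    ⟨w'.toBasis.constr ℂ w, fun j => by
      have := w'.toBasis.constr_basis ℂ w j
      rwa [w'.coe_toBasis] at this⟩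
  have h : splitFrame w = U.restrictScalars ℝ ∘ B := by
    rw [hB]
    ext1 i
    rcases i with i | i
    · simp [splitFrame, hU]
    · simp [splitFrame, realFrame, hU]
  rw [A.eq_smul_basis_det B, h, ← hB, AlternatingMap.smul_apply, AlternatingMap.smul_apply,
    B.det_comp, det_restrictScalars_eq_one_of_map_orthonormalBasis hU, one_mul]

/-- The real bilinear form `Im (conj ⟨ν, x⟩ ⟨ν, y⟩)`, the area form of the complex line spanned by
`ν`. -/
noncomputable def normalAreaForm (ν : CSpace (k + 1)) : CSpace (k + 1) [⋀^Fin 2]→ₗ[ℝ] ℝ :=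
  (Matrix.detRowAlternating (R := ℝ) (n := Fin 2)).compLinearMap
    (LinearMap.pi ![Complex.reLm ∘ₗ ((innerSL ℂ ν : CSpace (k + 1) →ₗ[ℂ] ℂ).restrictScalars ℝ),
      Complex.imLm ∘ₗ ((innerSL ℂ ν : CSpace (k + 1) →ₗ[ℂ] ℂ).restrictScalars ℝ)])

theorem normalAreaForm_apply (ν : CSpace (k + 1)) (v : Fin 2 → CSpace (k + 1)) :
    normalAreaForm ν v = (inner ℂ ν (v 0)).re * (inner ℂ ν (v 1)).im -
      (inner ℂ ν (v 0)).im * (inner ℂ ν (v 1)).re := by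
  have : normalAreaForm ν v = Matrix.det (Matrix.of fun i => ![(inner ℂ ν (v i)).re, (inner ℂ ν (v i)).im]) := by
    refine congrArg (Matrix.det (n := Fin 2) (R := ℝ)) (Matrix.ext fun i j => ?_)
    fin_cases j <;> rfl
  rw [this, Matrix.det_fin_two]
  simp

/-- Polarization of the area form of the line spanned by `ν`. -/
theorem normalAreaForm_eq_norm_sq (ν : CSpace (k + 1)) (v : Fin 2 → CSpace (k + 1)) :
    normalAreaForm ν v = 1 / 2 * ‖inner ℂ (v 0 - Complex.I • v 1) ν‖ ^ 2 -
      1 / 2 * ‖inner ℂ (v 0) ν‖ ^ 2 - 1 / 2 * ‖inner ℂ (v 1) ν‖ ^ 2 := by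
  rw [normalAreaForm_apply, norm_inner_symm, norm_inner_symm _ ν, norm_inner_symm _ ν,
    inner_sub_right, inner_smul_right]
  simp only [← Complex.normSq_eq_norm_sq, Complex.normSq_apply]
  simp
  ring

/-- The product of the area form of the complex normal line with a form of complementary
degree. -/
noncomputable def normalProduct (ν : CSpace (k + 1))
    (η : CSpace (k + 1) [⋀^Fin (k * 2)]→L[ℝ] ℝ) :
    MultilinearMap ℝ (fun _ : Fin 2 ⊕ Fin (k * 2) => CSpace (k + 1)) ℝ :=
  (LinearMap.mul' ℝ ℝ).compMultilinearMap
    ((normalAreaForm ν).toMultilinearMap.domCoprod η.toMultilinearMap)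

theorem alternatization_normalProduct_apply (ν : CSpace (k + 1))
    (η : CSpace (k + 1) [⋀^Fin (k * 2)]→L[ℝ] ℝ) (v : Fin 2 ⊕ Fin (k * 2) → CSpace (k + 1)) :
    MultilinearMap.alternatization (normalProduct ν η) v =
      ∑ σ : Equiv.Perm (Fin 2 ⊕ Fin (k * 2)), ((Equiv.Perm.sign σ : ℤ) : ℝ) *
        (normalAreaForm ν (fun i => v (σ (Sum.inl i))) * η (fun l => v (σ (Sum.inr l)))) := by
  rw [MultilinearMap.alternatization_apply]
  refine Finset.sum_congr rfl fun σ _ => ?_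
  rw [Units.smul_def, zsmul_eq_mul]
  rfl

/-- On the real frame of a unitary basis whose first vector is the normal, only the permutations
preserving the two normal directions contribute to the alternatization, all by the same amount. -/
theorem exists_alternatization_normalProduct_splitFrame (k : ℕ) : ∃ N : ℝ, N ≠ 0 ∧
    ∀ (η : CSpace (k + 1) [⋀^Fin (k * 2)]→L[ℝ] ℝ)
      (w : OrthonormalBasis (Fin (k + 1)) ℂ (CSpace (k + 1))),
      MultilinearMap.alternatization (normalProduct (w 0) η) (splitFrame w) =
        N * η (realFrame fun j => w j.succ) := by
  classical
  set S : Finset (Equiv.Perm (Fin 2 ⊕ Fin (k * 2))) :=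
    Finset.univ.filter fun σ => Set.MapsTo σ (Set.range Sum.inl) (Set.range Sum.inl) with hS
  have h1 : (1 : Equiv.Perm (Fin 2 ⊕ Fin (k * 2))) ∈ S := by
    simp only [hS, Finset.mem_filter, Finset.mem_univ, true_and]
    exact fun x hx => hx
  refine ⟨S.card, by simpa using Finset.ne_empty_of_mem h1, fun η w => ?_⟩
  have hw : ∀ i j, inner ℂ (w i) (w j) = if i = j then 1 else 0 :=
    orthonormal_iff_ite.1 w.orthonormal
  rw [alternatization_normalProduct_apply, ← Finset.sum_subset (Finset.subset_univ S),
    ← nsmul_eq_mul, ← Finset.sum_const]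
  · refine Finset.sum_congr rfl fun σ hσ => ?_
    obtain ⟨⟨τ, ρ⟩, rfl⟩ := Equiv.Perm.mem_sumCongrHom_range_of_perm_mapsTo_inl
      (Finset.mem_filter.1 hσ).2
    have e1 : normalAreaForm (w 0) (fun i =>
        splitFrame w (Equiv.Perm.sumCongrHom _ _ (τ, ρ) (Sum.inl i))) =
        ((Equiv.Perm.sign τ : ℤ) : ℝ) := by
      have := (normalAreaForm (w 0)).map_perm (fun i => splitFrame w (Sum.inl i)) τ
      rw [Units.smul_def, zsmul_eq_mul] at this
      refine Eq.trans this ?_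
      rw [normalAreaForm_apply]
      simp [splitFrame]
    have e2 : η (fun l =>
        splitFrame w (Equiv.Perm.sumCongrHom _ _ (τ, ρ) (Sum.inr l))) =
        ((Equiv.Perm.sign ρ : ℤ) : ℝ) * η (realFrame fun j => w j.succ) := by
      have := η.toAlternatingMap.map_perm (realFrame fun j => w j.succ) ρ
      rw [Units.smul_def, zsmul_eq_mul] at this
      exact this
    have e3 : Equiv.Perm.sign (Equiv.Perm.sumCongrHom _ _ (τ, ρ)) =
        Equiv.Perm.sign τ * Equiv.Perm.sign ρ := Equiv.Perm.sign_sumCongr τ ρ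
    have hsq : ∀ u : ℤˣ, ((u : ℤ) : ℝ) * ((u : ℤ) : ℝ) = 1 := fun u => by
      rcases Int.units_eq_one_or u with rfl | rfl <;> simp
    rw [e1, e2, e3, Units.val_mul, Int.cast_mul]
    linear_combination (((Equiv.Perm.sign τ : ℤ) : ℝ) * ((Equiv.Perm.sign τ : ℤ) : ℝ) *
      η (realFrame fun j => w j.succ)) * hsq (Equiv.Perm.sign ρ) +
      η (realFrame fun j => w j.succ) * hsq (Equiv.Perm.sign τ)
  · intro σ _ hσ
    have : ∃ i : Fin 2, ∃ l, σ (Sum.inl i) = Sum.inr l := by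
      by_contra! hcon
      refine hσ (Finset.mem_filter.2 ⟨Finset.mem_univ _, ?_⟩)
      rintro _ ⟨i, rfl⟩
      rcases hx : σ (Sum.inl i) with j | l
      · exact ⟨j, rfl⟩
      · exact absurd hx (hcon i l)
    obtain ⟨i, l, hil⟩ := this
    have hz : inner ℂ (w 0) (splitFrame w (σ (Sum.inl i))) = 0 := by
      rw [hil]
      simp [splitFrame, realFrame, hw, (Fin.succ_ne_zero _).symm]
    have : normalAreaForm (w 0) (fun i => splitFrame w (σ (Sum.inl i))) = 0 := by
      rw [normalAreaForm_apply]
      fin_cases i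
      · simp only [Fin.zero_eta] at hz
        simp [hz]
      · simp only [Fin.mk_one] at hz
        simp [hz]
    rw [this, zero_mul, mul_zero]

/-- The value of a form on the real frame of a complex hyperplane is a combination of finitely many
squared cosines of the angles between the normal and fixed directions, with coefficients depending
linearly on the form. -/
theorem exists_realFrame_eq_sum_norm_inner_sq (k : ℕ) :
    ∃ (N : ℕ) (c : Fin N → (CSpace (k + 1) [⋀^Fin (k * 2)]→L[ℝ] ℝ) →L[ℝ] ℝ)
      (b : Fin N → OrthonormalBasis (Fin (k + 1)) ℂ (CSpace (k + 1))),
      ∀ (η : CSpace (k + 1) [⋀^Fin (k * 2)]→L[ℝ] ℝ)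
        (w : OrthonormalBasis (Fin (k + 1)) ℂ (CSpace (k + 1))),
        η (realFrame fun j => w j.succ) = ∑ i, c i η * ‖inner ℂ (b i 0) (w 0)‖ ^ 2 := by
  obtain ⟨N, hN, h⟩ := exists_alternatization_normalProduct_splitFrame k
  set w' := EuclideanSpace.basisFun (Fin (k + 1)) ℂ with hw'
  -- each permutation of the fixed frame contributes three squared cosines, by polarization of the
  -- area form
  suffices H : ∃ (c : Equiv.Perm (Fin 2 ⊕ Fin (k * 2)) × Fin 3 →
      (CSpace (k + 1) [⋀^Fin (k * 2)]→L[ℝ] ℝ) →L[ℝ] ℝ)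
      (b : Equiv.Perm (Fin 2 ⊕ Fin (k * 2)) × Fin 3 →
        OrthonormalBasis (Fin (k + 1)) ℂ (CSpace (k + 1))),
      ∀ (η : CSpace (k + 1) [⋀^Fin (k * 2)]→L[ℝ] ℝ)
        (w : OrthonormalBasis (Fin (k + 1)) ℂ (CSpace (k + 1))),
        η (realFrame fun j => w j.succ) = ∑ i, c i η * ‖inner ℂ (b i 0) (w 0)‖ ^ 2 by
    obtain ⟨c, b, H⟩ := H
    let e := Fintype.equivFin (Equiv.Perm (Fin 2 ⊕ Fin (k * 2)) × Fin 3)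
    refine ⟨_, c ∘ e.symm, b ∘ e.symm, fun η w => ?_⟩
    rw [H, ← e.symm.sum_comp]
    rfl
  set u : Equiv.Perm (Fin 2 ⊕ Fin (k * 2)) × Fin 3 → CSpace (k + 1) := fun i =>
    ![splitFrame w' (i.1 (Sum.inl 0)) - Complex.I • splitFrame w' (i.1 (Sum.inl 1)),
      splitFrame w' (i.1 (Sum.inl 0)), splitFrame w' (i.1 (Sum.inl 1))] i.2 with hu
  choose b hb using fun i => exists_orthonormalBasis_norm_smul (u i)
  refine ⟨fun i => (N⁻¹ * ((Equiv.Perm.sign i.1 : ℤ) : ℝ) * ![1 / 2, -1 / 2, -1 / 2] i.2 *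
    ‖u i‖ ^ 2) • ContinuousAlternatingMap.apply ℝ (CSpace (k + 1)) ℝ
      (fun l => splitFrame w' (i.1 (Sum.inr l))), b, fun η w => ?_⟩
  have hn : ∀ i, ‖u i‖ ^ 2 * ‖inner ℂ (b i 0) (w 0)‖ ^ 2 = ‖inner ℂ (u i) (w 0)‖ ^ 2 := fun i => by
    conv_rhs => rw [← hb i, inner_smul_left, norm_mul]
    simp [mul_pow]
  have key := h η w
  rw [AlternatingMap.map_splitFrame_eq _ w w', alternatization_normalProduct_apply] at key
  rw [← mul_right_inj' hN, ← key, Finset.mul_sum, Fintype.sum_prod_type]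
  refine Finset.sum_congr rfl fun σ _ => ?_
  have : ∀ x : Fin 3, N * (((N⁻¹ * ((Equiv.Perm.sign σ : ℤ) : ℝ) * ![1 / 2, -1 / 2, -1 / 2] x *
      ‖u (σ, x)‖ ^ 2) • ContinuousAlternatingMap.apply ℝ (CSpace (k + 1)) ℝ
      (fun l => splitFrame w' (σ (Sum.inr l)))) η * ‖inner ℂ (b (σ, x) 0) (w 0)‖ ^ 2) =
      ((Equiv.Perm.sign σ : ℤ) : ℝ) * (![1 / 2, -1 / 2, -1 / 2] x *
        ‖inner ℂ (u (σ, x)) (w 0)‖ ^ 2 * η (fun l => splitFrame w' (σ (Sum.inr l)))) := fun x => by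
    rw [← hn]
    simp only [_root_.smul_apply, smul_eq_mul, ContinuousAlternatingMap.apply_apply]
    field_simp
  simp only [this]
  rw [Fin.sum_univ_three, normalAreaForm_eq_norm_sq]
  simp only [hu, Matrix.cons_val_zero, Matrix.cons_val_one, Matrix.cons_val]
  ring

end Restriction

/-! ### The current of integration along a regular zero set -/

section Tangent

variable {k : ℕ}

/-- Every local defining function has the same tangent space: the level set is parametrised by the
implicit function, along which both functions vanish. -/
theorem fderiv_apply_eq_zero_of_isLocalDefiningFunction {m : ℕ} {f g : CSpace m → ℂ}
    {A : CSpace m →L[ℂ] ℂ} {z : CSpace m} (hf : HasStrictFDerivAt f A z) (hA : A ≠ 0)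
    (hfz : f z = 0) (hg : IsLocalDefiningFunction {w | f w = 0} z g) {v : CSpace m}
    (hv : A v = 0) : fderiv ℂ g z v = 0 := by
  obtain ⟨U, hU, hzU, hgU, -, hgZ⟩ := hg
  have hr : A.range = ⊤ := by
    refine LinearMap.range_eq_top.2 fun c => ?_
    obtain ⟨x, hx⟩ : ∃ x, A x ≠ 0 := by
      by_contra! h
      exact hA (ContinuousLinearMap.ext h)
    exact ⟨(c / A x) • x, by simp [hx]⟩
  set ψ := hf.implicitFunction f A hr (f z) with hψ
  have h0 : ψ 0 = z := hf.implicitFunction_apply_image hr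
  have hψd : HasStrictFDerivAt ψ A.ker.subtypeL 0 := hf.to_implicitFunction hr
  have hgd : HasFDerivAt g (fderiv ℂ g z) (ψ 0) := by
    rw [h0]
    exact ((hgU z hzU).differentiableAt (hU.mem_nhds hzU)).hasFDerivAt
  have hcomp := hgd.comp (0 : A.ker) hψd.hasFDerivAt
  have hzero : g ∘ ψ =ᶠ[𝓝 0] fun _ => 0 := by
    have h1 : ∀ᶠ x in 𝓝 (0 : A.ker), f (ψ x) = f z := by
      have := hf.map_implicitFunction_eq hr
      rw [nhds_prod_eq] at this
      exact this.curry.self_of_nhds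
    have h2 : ∀ᶠ x in 𝓝 (0 : A.ker), ψ x ∈ U :=
      hψd.hasFDerivAt.continuousAt.eventually_mem (by rw [h0]; exact hU.mem_nhds hzU)
    filter_upwards [h1, h2] with x hx1 hx2
    have : ψ x ∈ {w | f w = 0} ∩ U := ⟨by simpa [hfz] using hx1, hx2⟩
    rw [hgZ] at this
    exact this.2
  have h3 := hcomp.unique ((hasFDerivAt_const (0 : ℂ) (0 : A.ker)).congr_of_eventuallyEq hzero)
  exact DFunLike.congr_fun h3 (⟨v, hv⟩ : A.ker)

theorem apply_eq_zero_of_isLocalDefiningFunction {m : ℕ} {f g : CSpace m → ℂ}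
    {A : CSpace m →L[ℂ] ℂ} {z : CSpace m} (hf : HasStrictFDerivAt f A z) (hA : A ≠ 0)
    (hfz : f z = 0) (hg : IsLocalDefiningFunction {w | f w = 0} z g) {v : CSpace m}
    (hv : fderiv ℂ g z v = 0) : A v = 0 := by
  have H : ∀ v, A v = 0 → fderiv ℂ g z v = 0 := fun v hv =>
    fderiv_apply_eq_zero_of_isLocalDefiningFunction hf hA hfz hg hv
  obtain ⟨_, _, _, _, hg0, _⟩ := hg
  obtain ⟨x, hx⟩ : ∃ x, fderiv ℂ g z x ≠ 0 := by
    by_contra! h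
    exact hg0 (ContinuousLinearMap.ext h)
  have hAx : A x ≠ 0 := fun h => hx (H x h)
  have := H (v - (A v / A x) • x) (by simp [hAx])
  simpa [hv, hx, hAx] using this

/-- The tangential density of a form on a regular hypersurface, in terms of the squared cosines of
the angles between its normal and fixed directions. -/
theorem tangentialDensity_eq_sum {N : ℕ}
    {c : Fin N → (CSpace (k + 1) [⋀^Fin (k * 2)]→L[ℝ] ℝ) →L[ℝ] ℝ}
    {b : Fin N → OrthonormalBasis (Fin (k + 1)) ℂ (CSpace (k + 1))}
    (hcb : ∀ (η : CSpace (k + 1) [⋀^Fin (k * 2)]→L[ℝ] ℝ)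
        (w : OrthonormalBasis (Fin (k + 1)) ℂ (CSpace (k + 1))),
        η (realFrame fun j => w j.succ) = ∑ i, c i η * ‖inner ℂ (b i 0) (w 0)‖ ^ 2)
    {f : CSpace (k + 1) → ℂ} (hf : ContDiff ℂ 1 f) {z : CSpace (k + 1)} (hz : f z = 0)
    (hz' : fderiv ℂ f z ≠ 0)
    (η : CSpace (k + 1) → (CSpace (k + 1) [⋀^Fin ((k + 1 - 1) * 2)]→L[ℝ] ℝ)) :
    tangentialDensity {w | f w = 0} η z = ∑ i, normalCosSq (b i) f z * c i (η z) := by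
  have hs : HasStrictFDerivAt f (fderiv ℂ f z) z :=
    hf.contDiffAt.hasStrictFDerivAt one_ne_zero
  have hdef : IsLocalDefiningFunction {w | f w = 0} z f :=
    ⟨Set.univ, isOpen_univ, trivial, (hf.differentiable one_ne_zero).differentiableOn, hz', by
      simp⟩
  obtain ⟨w, hw⟩ := exists_normal_basis (fderiv ℂ f z)
  have hw' : ∀ x, fderiv ℂ f z x = (‖fderiv ℂ f z‖ : ℂ) * inner ℂ (w 0) x := fun x => by
    rw [hw, OrthonormalBasis.repr_apply_apply]
  have hn : (‖fderiv ℂ f z‖ : ℂ) ≠ 0 := by simpa using hz'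
  have hex : ∃ v, IsUnitaryTangentFrame {w | f w = 0} z v :=
    ⟨fun j : Fin k => w j.succ, w.orthonormal.comp _ (Fin.succ_injective k), f, hdef, fun j => by
      rw [hw', orthonormal_iff_ite.1 w.orthonormal, if_neg (Fin.succ_ne_zero j).symm, mul_zero]⟩
  rw [tangentialDensity, dif_pos hex]
  obtain ⟨hv, g, hg, hgv⟩ := hex.choose_spec
  set v : Fin k → CSpace (k + 1) := hex.choose
  have hv0 : ∀ j, inner ℂ (w 0) (v j) = 0 := fun j => by
    have := apply_eq_zero_of_isLocalDefiningFunction hs hz' hz hg (hgv j)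
    rw [hw'] at this
    exact (mul_eq_zero.1 this).resolve_left hn
  have hon : Orthonormal ℂ (Fin.cons (w 0) v : Fin (k + 1) → CSpace (k + 1)) := by
    rw [orthonormal_iff_ite] at hv ⊢
    intro i j
    refine Fin.cases ?_ (fun i => ?_) i <;> refine Fin.cases ?_ (fun j => ?_) j
    · simp [inner_self_eq_norm_sq_to_K]
    · simp [hv0, (Fin.succ_ne_zero j).symm]
    · simp [inner_eq_zero_symm.1 (hv0 i)]
    · simpa using hv i j
  have hcard : Module.finrank ℂ (CSpace (k + 1)) = Fintype.card (Fin (k + 1)) := by simp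
  obtain ⟨w₁, hw₁⟩ := Orthonormal.exists_orthonormalBasis_extension_of_card_eq (s := Set.univ)
    hcard (hon.comp _ Subtype.val_injective)
  have e0 : w₁ 0 = w 0 := hw₁ 0 trivial
  have e1 : v = fun j => w₁ j.succ := by
    ext1 j
    rw [hw₁ _ trivial, Fin.cons_succ]
  rw [e1]
  refine (hcb (η z) w₁).trans (Finset.sum_congr rfl fun i _ => ?_)
  rw [normalCosSq, hw', e0, norm_mul, mul_pow, Complex.norm_real, norm_norm, mul_div_cancel_left₀,
    norm_inner_symm, mul_comm]
  simpa using hz'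

theorem regularPoints_zeros {m : ℕ} {f : CSpace m → ℂ} (hf : ContDiff ℂ 1 f)
    (hreg : ∀ z, f z = 0 → fderiv ℂ f z ≠ 0) : regularPoints {z | f z = 0} = {z | f z = 0} :=
  Set.Subset.antisymm (fun _ hz => hz.1) fun z hz => ⟨hz, f, Set.univ, isOpen_univ, trivial,
    (hf.differentiable one_ne_zero).differentiableOn, hreg z hz, by simp⟩

/-- The Poincaré–Lelong formula: for a polynomial with 0 as a regular value, the current of
integration applied to a test form is the integral of the logarithm of the modulus of the polynomial
against a function that depends on the form only. This function is given as a sum of functions `h i`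
whose products with the logarithm have to be integrable one by one. -/
theorem exists_currentPairing_eq_integral_log (φ : TestForm (k + 1)) :
    ∃ (N : ℕ) (h : Fin N → CSpace (k + 1) → ℝ), (∀ i, Continuous (h i)) ∧
      (∀ i, HasCompactSupport (h i)) ∧
      ∀ g : MvPolynomial (Fin (k + 1)) ℂ,
        (∀ z, polyEval g z = 0 → fderiv ℂ (polyEval g) z ≠ 0) →
        (∀ i, Integrable fun z => Real.log ‖polyEval g z‖ * h i z) →
        Integrable (tangentialDensity (zeroSet g) φ.form) (surfaceMeasure (zeroSet g)) ∧
          currentPairing g φ = ∫ z, Real.log ‖polyEval g z‖ * ∑ i, h i z := by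
  obtain ⟨N, c, b, hcb⟩ := exists_realFrame_eq_sum_norm_inner_sq k
  choose C hC using fun i => exists_integral_normalCosSq_mul_eq_integral_log (b i)
  have hχ : ∀ i, ContDiff ℝ ∞ fun z => c i (φ.form z) := fun i =>
    (c i).contDiff.comp φ.smooth
  have hχs : ∀ i, HasCompactSupport fun z => c i (φ.form z) := fun i =>
    φ.compactSupport.comp_left (map_zero (c i))
  set χ : Fin N → CSpace (k + 1) → ℝ := fun i z => c i (φ.form z) with hχd
  set L : Fin N → CSpace (k + 1) → ℝ := fun i z =>
    secondDeriv (χ i) (b i 0) z + secondDeriv (χ i) (Complex.I • b i 0) z with hL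
  have hLc : ∀ i, Continuous (L i) := fun i =>
    (continuous_secondDeriv (hχ i) _).add (continuous_secondDeriv (hχ i) _)
  have hLs : ∀ i, HasCompactSupport (L i) := fun i =>
    (hasCompactSupport_secondDeriv (hχs i) _).add (hasCompactSupport_secondDeriv (hχs i) _)
  -- a constant `C i = 0` would lose the integrability of `log |g| * L i`, so `L i` is listed
  -- next to `C i * L i - L i`
  refine ⟨N + N, Fin.append (fun i z => C i * L i z - L i z) L, fun i => ?_, fun i => ?_,
    fun g hreg hint => ?_⟩
  · refine Fin.addCases (fun i => ?_) (fun i => ?_) i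
    · rw [Fin.append_left]
      exact (continuous_const.mul (hLc i)).sub (hLc i)
    · rw [Fin.append_right]
      exact hLc i
  · refine Fin.addCases (fun i => ?_) (fun i => ?_) i
    · rw [Fin.append_left]
      exact ((hLs i).mul_left (f := fun _ => C i)).sub (hLs i)
    · rw [Fin.append_right]
      exact hLs i
  have hintL : ∀ i, Integrable fun z => Real.log ‖polyEval g z‖ * L i z := fun i => by
    simpa only [Fin.append_right] using hint (Fin.natAdd N i)
  have hf : ContDiff ℂ 1 (polyEval g) := contDiff_polyEval g
  have hZm : MeasurableSet {z | polyEval g z = 0} :=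
    (isClosed_eq hf.continuous continuous_const).measurableSet
  have hμ : surfaceMeasure (zeroSet g) =
      (Measure.euclideanHausdorffMeasure (k * 2)).restrict {z | polyEval g z = 0} := by
    unfold surfaceMeasure zeroSet
    rw [regularPoints_zeros hf hreg]
    rfl
  have hae : tangentialDensity (zeroSet g) φ.form =ᵐ[(Measure.euclideanHausdorffMeasure
      (k * 2)).restrict {z | polyEval g z = 0}]
      fun z => ∑ i, normalCosSq (b i) (polyEval g) z * χ i z := by
    filter_upwards [ae_restrict_mem hZm] with z hz
    exact tangentialDensity_eq_sum hcb hf hz (hreg z hz) φ.form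
  have hi : ∀ i, Integrable (fun z => normalCosSq (b i) (polyEval g) z * χ i z)
      ((Measure.euclideanHausdorffMeasure (k * 2)).restrict {z | polyEval g z = 0}) := fun i =>
    integrableOn_normalCosSq_mul (b i) hf hreg (hχ i).continuous (hχs i)
  rw [currentPairing, hμ, integrable_congr hae, integral_congr_ae hae]
  refine ⟨integrable_finsetSum _ fun i _ => hi i, ?_⟩
  rw [integral_finsetSum _ fun i _ => hi i]
  simp only [Fin.sum_univ_add, Fin.append_left, Fin.append_right, ← Finset.sum_add_distrib,
    sub_add_cancel, Finset.mul_sum]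
  rw [integral_finsetSum]
  · refine Finset.sum_congr rfl fun i _ => ?_
    rw [hC i g hreg (χ i) (hχ i) (hχs i) (hintL i), ← integral_const_mul]
    exact integral_congr_ae (ae_of_all _ fun z => by simp only [hL]; ring)
  · intro i _
    simpa only [mul_left_comm] using (hintL i).const_mul (C i)

end Tangent

/-! ### Almost every polynomial has 0 as a regular value -/

section Generic

variable {m n : ℕ} (p : Module.Basis (Fin (polyDim m n)) ℂ (PolySpace m n))

theorem polyEval_randomPoly (a : Fin (polyDim m n) → ℂ) (z : CSpace m) :
    polyEval (randomPoly p a) z = ∑ j, a j * polyEval (p j : MvPolynomial (Fin m) ℂ) z := by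
  simp [polyEval, randomPoly, MvPolynomial.smul_eval]

theorem exists_randomPoly_eq (g : MvPolynomial (Fin m) ℂ) (hg : g.totalDegree ≤ n) :
    ∃ a, randomPoly p a = g := by
  refine ⟨p.equivFun ⟨g, (MvPolynomial.mem_restrictTotalDegree _ _ _).2 hg⟩, ?_⟩
  have := congrArg Subtype.val
    (p.sum_equivFun ⟨g, (MvPolynomial.mem_restrictTotalDegree _ _ _).2 hg⟩)
  rw [Submodule.coe_sum] at this
  exact this

/-- The coefficient vectors of the affine functions `x ↦ t.1 + ∑ i, t.2 i * x i`. -/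
theorem exists_affine_coefficients (hn : 1 ≤ n) :
    ∃ s : (ℂ × (Fin m → ℂ)) →ₗ[ℂ] (Fin (polyDim m n) → ℂ), Function.Injective s ∧
      ∀ t z, polyEval (randomPoly p (s t)) z = t.1 + ∑ i, t.2 i * z i := by
  obtain ⟨e₀, he₀⟩ := exists_randomPoly_eq p (MvPolynomial.C 1) (by simp)
  choose e he using fun i => exists_randomPoly_eq p (MvPolynomial.X i)
    (by rw [MvPolynomial.totalDegree_X]; exact hn)
  have hs : ∀ t : ℂ × (Fin m → ℂ), ∀ z, polyEval (randomPoly p ((LinearMap.coprod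
      (LinearMap.toSpanSingleton ℂ _ e₀) (Fintype.linearCombination ℂ e)) t)) z =
      t.1 + ∑ i, t.2 i * z i := fun t z => by
    have h1 : ∑ j, e₀ j * polyEval (p j : MvPolynomial (Fin m) ℂ) z = 1 := by
      rw [← polyEval_randomPoly, he₀]; simp [polyEval]
    have h2 : ∀ i, ∑ j, e i j * polyEval (p j : MvPolynomial (Fin m) ℂ) z = z i := fun i => by
      rw [← polyEval_randomPoly, he]; simp [polyEval]
    rw [polyEval_randomPoly]
    simp only [LinearMap.coprod_apply, LinearMap.toSpanSingleton_apply,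
      Fintype.linearCombination_apply, Pi.add_apply, Pi.smul_apply, Finset.sum_apply, smul_eq_mul,
      add_mul, Finset.sum_add_distrib, mul_assoc, ← Finset.mul_sum, h1, mul_one, Finset.sum_mul]
    rw [Finset.sum_comm]
    simp only [← Finset.mul_sum, h2]
  refine ⟨_, (injective_iff_map_eq_zero _).2 fun t ht => ?_, hs⟩
  have h0 : ∀ z : CSpace m, t.1 + ∑ i, t.2 i * z i = 0 := fun z => by
    rw [← hs, ht, polyEval_randomPoly]; simp
  have h1 : t.1 = 0 := by simpa using h0 0
  refine Prod.ext h1 (funext fun i => ?_)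
  have := h0 (EuclideanSpace.single i 1)
  simpa [h1, Pi.single_apply] using this

theorem volume_eq_zero_of_dimH_lt {d : ℕ} {s : Set (Fin d → ℂ)} (h : dimH s < (d * 2 : ℕ)) :
    volume s = 0 := by
  have hfin : Module.finrank ℝ (Fin d → ℂ) = d * 2 := by
    rw [finrank_real_of_complex, Module.finrank_fin_fun, mul_comm]
  have := isAddHaarMeasure_hausdorffMeasure (E := Fin d → ℂ)
  rw [hfin] at this
  have h0 : Measure.hausdorffMeasure ((d * 2 : ℕ) : ℝ) s = 0 := by
    have h' : dimH s < ((d * 2 : ℕ) : NNReal) := by exact_mod_cast h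
    have := hausdorffMeasure_of_dimH_lt h'
    exact_mod_cast this
  rw [Measure.isAddLeftInvariant_eq_smul volume (Measure.hausdorffMeasure ((d * 2 : ℕ) : ℝ)),
    Measure.smul_apply, h0, smul_zero]

/-- A polynomial with a singular zero `z` is the difference of a polynomial from a fixed complement
of the affine functions and its first Taylor polynomial at `z`. So these polynomials form the image
of the space of pairs of a point and an element of the complement, whose dimension is smaller by one
than that of the space of all polynomials. -/
theorem ae_forall_fderiv_polyEval_ne_zero (hn : 1 ≤ n) :
    ∀ᵐ a, ∀ z, polyEval (randomPoly p a) z = 0 → fderiv ℂ (polyEval (randomPoly p a)) z ≠ 0 := by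
  obtain ⟨s, hsi, hs⟩ := exists_affine_coefficients p hn
  obtain ⟨W, hW⟩ := Submodule.exists_isCompl (LinearMap.range s)
  set P : Fin (polyDim m n) → CSpace m → ℂ := fun j => polyEval (p j : MvPolynomial (Fin m) ℂ)
    with hP
  have hPc : ∀ j, ContDiff ℂ 2 (P j) := fun j => contDiff_polyEval _
  set D : (Fin (polyDim m n) → ℂ) → CSpace m → Fin m → ℂ := fun a z i =>
    ∑ j, a j * fderiv ℂ (P j) z (EuclideanSpace.single i 1) with hD
  have hfd : ∀ a z, HasFDerivAt (polyEval (randomPoly p a)) (∑ j, a j • fderiv ℂ (P j) z) z :=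
    fun a z => by
      have : polyEval (randomPoly p a) = fun z => ∑ j, a j • P j z :=
        funext fun z => polyEval_randomPoly p a z
      rw [this]
      exact HasFDerivAt.fun_sum fun j _ =>
        (((hPc j).differentiable two_ne_zero z).hasFDerivAt).const_smul (a j)
  have hDfd : ∀ a z i, D a z i =
      fderiv ℂ (polyEval (randomPoly p a)) z (EuclideanSpace.single i 1) := fun a z i => by
    rw [(hfd a z).fderiv]
    simp [hD]
  set Φ : CSpace m × W → (Fin (polyDim m n) → ℂ) := fun x => (x.2 : Fin (polyDim m n) → ℂ) -
    s (∑ j, (x.2 : Fin (polyDim m n) → ℂ) j * P j x.1 -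
      ∑ i, D x.2 x.1 i * x.1 i, D x.2 x.1) with hΦ
  have hΦc : ContDiff ℝ 1 Φ := by
    have hw : ContDiff ℂ 1 fun x : CSpace m × W => (x.2 : Fin (polyDim m n) → ℂ) :=
      W.subtypeL.contDiff.comp contDiff_snd
    have hwj : ∀ j, ContDiff ℂ 1 fun x : CSpace m × W => (x.2 : Fin (polyDim m n) → ℂ) j :=
      fun j => contDiff_pi.1 hw j
    have hDc : ∀ i, ContDiff ℂ 1 fun x : CSpace m × W => D x.2 x.1 i := fun i =>
      ContDiff.sum fun j _ => (hwj j).mul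
        ((((hPc j).fderiv_right (m := 1) le_rfl).comp contDiff_fst).clm_apply contDiff_const)
    have hx : ∀ i, ContDiff ℂ 1 fun x : CSpace m × W => x.1 i := fun i =>
      (contDiff_piLp_apply 2).comp contDiff_fst
    refine ContDiff.restrict_scalars ℝ (𝕜' := ℂ) (hw.sub
      ((LinearMap.toContinuousLinearMap s).contDiff.comp (ContDiff.prodMk (ContDiff.sub
        (ContDiff.sum fun j _ => (hwj j).mul
          (((hPc j).of_le one_le_two).comp contDiff_fst))
        (ContDiff.sum fun i _ => (hDc i).mul (hx i))) (contDiff_pi.2 hDc))))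
  have hdim : Module.finrank ℝ (CSpace m × W) < polyDim m n * 2 := by
    have h1 := Submodule.finrank_add_eq_of_isCompl hW
    rw [LinearMap.finrank_range_of_inj hsi] at h1
    simp only [Module.finrank_prod, Module.finrank_fin_fun, Module.finrank_self] at h1
    rw [Module.finrank_prod, finrank_real_CSpace, finrank_real_of_complex]
    omega
  refine measure_mono_null (fun a ha => ?_) (volume_eq_zero_of_dimH_lt
    (hΦc.dimH_range_le.trans_lt (Nat.cast_lt.2 hdim)))
  simp only [Set.mem_compl_iff, Set.mem_ofPred_eq, not_forall, not_not] at ha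
  obtain ⟨z, hz, hdz⟩ := ha
  obtain ⟨_, ⟨t, rfl⟩, w, hw, rfl⟩ := Submodule.mem_sup.1
    (hW.sup_eq_top ▸ Submodule.mem_top : a ∈ LinearMap.range s ⊔ W)
  refine ⟨(z, ⟨w, hw⟩), ?_⟩
  have hts : ∀ i, D (s t) z i = t.2 i := fun i => by
    have h1 : polyEval (randomPoly p (s t)) = fun z : CSpace m => t.1 + ∑ i, t.2 i * z i :=
      funext fun z => hs t z
    rw [hDfd, h1]
    have h2 : HasFDerivAt (fun z : CSpace m => t.1 + ∑ i, t.2 i * z i)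
        (∑ i, t.2 i • (EuclideanSpace.proj i : CSpace m →L[ℂ] ℂ)) z :=
      (HasFDerivAt.fun_sum fun i _ =>
        ((EuclideanSpace.proj i : CSpace m →L[ℂ] ℂ).hasFDerivAt).const_smul (t.2 i)).const_add _
    rw [h2.fderiv]
    simp
  have hDw : D w z = -t.2 := funext fun i => by
    have : D (s t + w) z i = 0 := by rw [hDfd, hdz]; rfl
    have hadd : D (s t + w) z i = D (s t) z i + D w z i := by
      simp only [hD, Pi.add_apply, add_mul, Finset.sum_add_distrib]
    rw [hadd, hts] at this
    exact (neg_eq_of_add_eq_zero_right this).symm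
  have hfw : ∑ j, w j * P j z = -(t.1 + ∑ i, t.2 i * z i) := by
    rw [polyEval_randomPoly] at hz
    simp only [Pi.add_apply, add_mul, Finset.sum_add_distrib] at hz
    rw [← polyEval_randomPoly, hs] at hz
    exact (neg_eq_of_add_eq_zero_right hz).symm
  simp only [hΦ, hDw, hfw]
  have : ((-(t.1 + ∑ i, t.2 i * z i) - ∑ i, (-t.2) i * z i, -t.2) : ℂ × (Fin m → ℂ)) = -t :=
    Prod.ext (by simp) rfl
  rw [this, map_neg, sub_neg_eq_add, add_comm]

end Generic

/-! ### The variance of the linear statistics -/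

section Variance

/-- A form of the Cauchy–Schwarz inequality for the measure with density `w`. -/
theorem sq_integral_abs_mul_le {X : Type*} [MeasurableSpace X] {ν : Measure X} {F w : X → ℝ}
    (hw0 : ∀ x, 0 ≤ w x) (hw : Integrable w ν) (hF : Integrable (fun x => |F x| * w x) ν)
    (hF2 : Integrable (fun x => F x ^ 2 * w x) ν) :
    (∫ x, |F x| * w x ∂ν) ^ 2 ≤ (∫ x, w x ∂ν + 1) * ∫ x, F x ^ 2 * w x ∂ν := by
  set B := ∫ x, w x ∂ν
  set Y := ∫ x, |F x| * w x ∂ν with hY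
  set Q := ∫ x, F x ^ 2 * w x ∂ν with hQ
  have hB : 0 ≤ B := integral_nonneg hw0
  have h : 0 ≤ ∫ x, ((B + 1) * |F x| - Y) ^ 2 * w x ∂ν :=
    integral_nonneg fun x => mul_nonneg (sq_nonneg _) (hw0 x)
  have e : ∫ x, ((B + 1) * |F x| - Y) ^ 2 * w x ∂ν =
      (B + 1) ^ 2 * Q - 2 * (B + 1) * Y * Y + Y ^ 2 * B := by
    have : ∀ x, ((B + 1) * |F x| - Y) ^ 2 * w x =
        ((B + 1) ^ 2 * (F x ^ 2 * w x) - 2 * (B + 1) * Y * (|F x| * w x)) + Y ^ 2 * w x := by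
      intro x
      rw [← sq_abs (F x)]
      ring
    simp only [this]
    have hs : Integrable (fun x => (B + 1) ^ 2 * (F x ^ 2 * w x) -
        2 * (B + 1) * Y * (|F x| * w x)) ν := (hF2.const_mul _).sub (hF.const_mul _)
    rw [integral_add hs (hw.const_mul _),
      integral_sub (hF2.const_mul _) (hF.const_mul _), integral_const_mul, integral_const_mul,
      integral_const_mul]
  rw [e] at h
  have h2 : 0 ≤ (B + 1) * ((B + 1) * Q - Y ^ 2) := by nlinarith [sq_nonneg Y]
  have := nonneg_of_mul_nonneg_right h2 (by linarith)
  linarith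

theorem integrable_mul_of_abs_le {X : Type*} [MeasurableSpace X] {τ : Measure X} {F h w : X → ℝ}
    (hF : Measurable F) (hh : Measurable h) (hFw : Integrable (fun x => |F x| * w x) τ)
    (hw : ∀ x, |h x| ≤ w x) : Integrable (fun x => F x * h x) τ := by
  refine hFw.mono' (hF.mul hh).aestronglyMeasurable (ae_of_all _ fun x => ?_)
  rw [norm_mul, Real.norm_eq_abs, Real.norm_eq_abs]
  exact mul_le_mul_of_nonneg_left (hw x) (abs_nonneg _)

theorem volume_linearForm_eq_zero {d : ℕ} {w : Fin d → ℂ} (hw : w ≠ 0) :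
    volume {a : Fin d → ℂ | ∑ j, a j * w j = 0} = 0 := by
  obtain ⟨i, hi⟩ := Function.ne_iff.1 hw
  set T : (Fin d → ℂ) →ₗ[ℝ] ℂ := (Fintype.linearCombination ℂ w).restrictScalars ℝ with hT
  have hTa : ∀ a, T a = ∑ j, a j * w j := fun a => by simp [hT, Fintype.linearCombination_apply]
  have := Measure.addHaar_submodule (volume : Measure (Fin d → ℂ)) (LinearMap.ker T) (by
    intro h
    have h1 : Pi.single i 1 ∈ LinearMap.ker T := h ▸ Submodule.mem_top
    rw [LinearMap.mem_ker, hTa] at h1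
    exact hi (by simpa [Pi.single_apply] using h1))
  refine measure_mono_null (fun a ha => ?_) this
  exact (hTa a).trans ha

/-- If the second moments of the random variables `F · z` are bounded by `M`, then the random
variable `∫ F · z * ψ z` has a second moment bounded in terms of `M` and `ψ`. -/
theorem memLp_integral_mul_of_lintegral_sq_le {Ω X : Type*} [MeasurableSpace Ω]
    [MeasurableSpace X] {ν : Measure Ω} [SFinite ν] {τ : Measure X} [SFinite τ] {M : NNReal}
    {F : Ω → X → ℝ} (hFm : Measurable (Function.uncurry F))
    (hM : ∀ z, ∫⁻ a, ENNReal.ofReal (F a z ^ 2) ∂ν ≤ M) {w : X → ℝ} (hwm : Measurable w)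
    (hw0 : ∀ z, 0 ≤ w z) (hw : Integrable w τ) :
    (∀ᵐ a ∂ν, Integrable (fun z => |F a z| * w z) τ) ∧
      ∀ ψ : X → ℝ, Measurable ψ → (∀ z, |ψ z| ≤ w z) →
        MemLp (fun a => ∫ z, F a z * ψ z ∂τ) 2 ν ∧
        ∫ a, (∫ z, F a z * ψ z ∂τ) ^ 2 ∂ν ≤ (∫ z, w z ∂τ + 1) * (M * ∫ z, w z ∂τ) := by
  have hGm : Measurable fun x : Ω × X => ENNReal.ofReal (F x.1 x.2 ^ 2 * w x.2) :=
    ((hFm.pow_const 2).mul (hwm.comp measurable_snd)).ennreal_ofReal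
  have hT : ∫⁻ a, ∫⁻ z, ENNReal.ofReal (F a z ^ 2 * w z) ∂τ ∂ν ≤
      M * ENNReal.ofReal (∫ z, w z ∂τ) := by
    rw [lintegral_lintegral_swap hGm.aemeasurable, ofReal_integral_eq_lintegral_ofReal hw
      (ae_of_all _ hw0), ← lintegral_const_mul _ hwm.ennreal_ofReal]
    refine lintegral_mono fun z => ?_
    simp only [ENNReal.ofReal_mul (sq_nonneg _)]
    rw [lintegral_mul_const]
    · exact mul_le_mul_left (hM z) _
    · exact ((hFm.comp (measurable_id.prodMk measurable_const)).pow_const 2).ennreal_ofReal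
  have hTtop : M * ENNReal.ofReal (∫ z, w z ∂τ) ≠ ⊤ :=
    ENNReal.mul_ne_top ENNReal.coe_ne_top ENNReal.ofReal_ne_top
  have hfin : ∀ᵐ a ∂ν, ∫⁻ z, ENNReal.ofReal (F a z ^ 2 * w z) ∂τ < ⊤ :=
    ae_lt_top hGm.lintegral_prod_right' (hT.trans_lt hTtop.lt_top).ne
  have hFa : ∀ a, Measurable (F a) := fun a =>
    hFm.comp (measurable_const.prodMk measurable_id)
  have hint2 : ∀ᵐ a ∂ν, Integrable (fun z => F a z ^ 2 * w z) τ := by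
    filter_upwards [hfin] with a ha
    refine ⟨(((hFa a).pow_const 2).mul hwm).aestronglyMeasurable, ?_⟩
    rw [hasFiniteIntegral_iff_ofReal (ae_of_all _ fun z => mul_nonneg (sq_nonneg _) (hw0 z))]
    exact ha
  have hint1 : ∀ᵐ a ∂ν, Integrable (fun z => |F a z| * w z) τ := by
    filter_upwards [hint2] with a ha
    refine (ha.add hw).mono' ((hFa a).abs.mul hwm).aestronglyMeasurable (ae_of_all _ fun z => ?_)
    rw [Real.norm_of_nonneg (mul_nonneg (abs_nonneg _) (hw0 z))]
    have : |F a z| ≤ F a z ^ 2 + 1 := by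
      rw [← sq_abs]
      nlinarith [sq_nonneg (|F a z| - 1), abs_nonneg (F a z)]
    exact (mul_le_mul_of_nonneg_right this (hw0 z)).trans (by simp [add_mul])
  refine ⟨hint1, fun ψ hψm hψ => ?_⟩
  have hB : 0 ≤ ∫ z, w z ∂τ := integral_nonneg hw0
  have hYm : AEStronglyMeasurable (fun a => ∫ z, F a z * ψ z ∂τ) ν :=
    (StronglyMeasurable.integral_prod_right (f := fun a z => F a z * ψ z)
      (hFm.mul (hψm.comp measurable_snd)).stronglyMeasurable).aestronglyMeasurable
  have hle : ∫⁻ a, ENNReal.ofReal ((∫ z, F a z * ψ z ∂τ) ^ 2) ∂ν ≤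
      ENNReal.ofReal ((∫ z, w z ∂τ + 1) * (M * ∫ z, w z ∂τ)) := by
    have h1 : ∀ᵐ a ∂ν, ENNReal.ofReal ((∫ z, F a z * ψ z ∂τ) ^ 2) ≤
        ENNReal.ofReal (∫ z, w z ∂τ + 1) * ∫⁻ z, ENNReal.ofReal (F a z ^ 2 * w z) ∂τ := by
      filter_upwards [hint1, hint2] with a ha1 ha2
      rw [← ofReal_integral_eq_lintegral_ofReal ha2
        (ae_of_all _ fun z => mul_nonneg (sq_nonneg _) (hw0 z)),
        ← ENNReal.ofReal_mul (by linarith)]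
      refine ENNReal.ofReal_le_ofReal (le_trans ?_ (sq_integral_abs_mul_le hw0 hw ha1 ha2))
      have hle : |∫ z, F a z * ψ z ∂τ| ≤ ∫ z, |F a z| * w z ∂τ := by
        refine (abs_integral_le_integral_abs).trans (integral_mono_of_nonneg
          (ae_of_all _ fun _ => abs_nonneg _) ha1 (ae_of_all _ fun z => ?_))
        simp only [abs_mul]
        exact mul_le_mul_of_nonneg_left (hψ z) (abs_nonneg _)
      rw [← sq_abs]
      exact pow_le_pow_left₀ (abs_nonneg _) hle 2
    refine (lintegral_mono_ae h1).trans ?_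
    rw [lintegral_const_mul _ hGm.lintegral_prod_right', ENNReal.ofReal_mul (by linarith),
      ENNReal.ofReal_mul M.coe_nonneg, ENNReal.ofReal_coe_nnreal]
    exact mul_le_mul_right hT _
  have hY2 : Integrable (fun a => (∫ z, F a z * ψ z ∂τ) ^ 2) ν := by
    refine ⟨hYm.pow 2, ?_⟩
    rw [hasFiniteIntegral_iff_ofReal (ae_of_all _ fun z => sq_nonneg _)]
    exact hle.trans_lt ENNReal.ofReal_lt_top
  refine ⟨(memLp_two_iff_integrable_sq hYm).2 hY2, ?_⟩
  rw [integral_eq_lintegral_of_nonneg_ae (ae_of_all _ fun z => sq_nonneg _) hY2.1]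
  exact ENNReal.toReal_le_of_le_ofReal
    (mul_nonneg (by linarith) (mul_nonneg M.coe_nonneg hB)) hle

end Variance

section Statistic

variable {k n : ℕ}

/-- The norm `(∑ j, |p j z|²)^(1/2)` of the vector of values of the basis polynomials. -/
noncomputable def basisNorm {m n : ℕ} (p : Module.Basis (Fin (polyDim m n)) ℂ (PolySpace m n))
    (z : CSpace m) : ℝ :=
  Real.sqrt (∑ j, ‖polyEval (p j : MvPolynomial (Fin m) ℂ) z‖ ^ 2)

theorem basisNorm_pos {m n : ℕ} (p : Module.Basis (Fin (polyDim m n)) ℂ (PolySpace m n))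
    (z : CSpace m) : 0 < basisNorm p z := by
  refine Real.sqrt_pos.2 ((Finset.sum_nonneg fun j _ => sq_nonneg _).lt_of_ne' fun h => ?_)
  -- the constant polynomial 1 is a combination of the `p j`, so they have no common zero
  obtain ⟨e, he⟩ := exists_randomPoly_eq p (MvPolynomial.C 1) (by simp)
  have h1 : polyEval (randomPoly p e) z = 1 := by rw [he]; simp [polyEval]
  rw [polyEval_randomPoly, Finset.sum_eq_zero] at h1
  · exact zero_ne_one h1
  · intro j hj
    have := (Finset.sum_eq_zero_iff_of_nonneg fun j _ => sq_nonneg _).1 h j hj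
    simp only [pow_eq_zero_iff two_ne_zero, norm_eq_zero] at this
    rw [this, mul_zero]

theorem continuous_basisNorm {m n : ℕ}
    (p : Module.Basis (Fin (polyDim m n)) ℂ (PolySpace m n)) : Continuous (basisNorm p) :=
  Real.continuous_sqrt.comp (continuous_finsetSum _ fun _ _ =>
    ((contDiff_polyEval (n := 0) _).continuous.norm).pow 2)

/-- A combination of the basis polynomials is, at each point, a multiple of a unit linear form in
the coefficients. -/
theorem exists_unit_linearForm {m n : ℕ}
    (p : Module.Basis (Fin (polyDim m n)) ℂ (PolySpace m n)) :
    ∃ u : CSpace m → Fin (polyDim m n) → ℂ, (∀ j, Continuous fun z => u z j) ∧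
      (∀ z, ∑ j, ‖u z j‖ ^ 2 = 1) ∧
      ∀ a z, polyEval (randomPoly p a) z = basisNorm p z * ∑ j, a j * u z j := by
  have hb0 : ∀ z, (basisNorm p z : ℂ) ≠ 0 := fun z =>
    Complex.ofReal_ne_zero.2 (basisNorm_pos p z).ne'
  refine ⟨fun z j => polyEval (p j : MvPolynomial (Fin m) ℂ) z / (basisNorm p z : ℂ),
    fun j => (contDiff_polyEval (n := 0) _).continuous.div
      (Complex.continuous_ofReal.comp (continuous_basisNorm p)) hb0, fun z => ?_, fun a z => ?_⟩
  · have hsq : basisNorm p z ^ 2 = ∑ j, ‖polyEval (p j : MvPolynomial (Fin m) ℂ) z‖ ^ 2 :=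
      Real.sq_sqrt (Finset.sum_nonneg fun j _ => sq_nonneg _)
    simp only [norm_div, Complex.norm_real, div_pow, Real.norm_eq_abs, sq_abs]
    rw [← Finset.sum_div, ← hsq, div_self (pow_pos (basisNorm_pos p z) 2).ne']
  · rw [polyEval_randomPoly, Finset.mul_sum]
    refine Finset.sum_congr rfl fun j _ => ?_
    field_simp [hb0 z]

/-- The bound for one degree and one basis: `log |f_a|` differs from the logarithm of a unit linear
form in `a` by a term that does not depend on `a`. -/
theorem variance_zeroStatistic_le {φ : TestForm (k + 1)} {N : ℕ}
    {h : Fin N → CSpace (k + 1) → ℝ} (hc : ∀ i, Continuous (h i))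
    (hs : ∀ i, HasCompactSupport (h i))
    (hφ : ∀ g : MvPolynomial (Fin (k + 1)) ℂ,
      (∀ z, polyEval g z = 0 → fderiv ℂ (polyEval g) z ≠ 0) →
      (∀ i, Integrable fun z => Real.log ‖polyEval g z‖ * h i z) →
      Integrable (tangentialDensity (zeroSet g) φ.form) (surfaceMeasure (zeroSet g)) ∧
        currentPairing g φ = ∫ z, Real.log ‖polyEval g z‖ * ∑ i, h i z)
    (hn : 1 ≤ n) (p : Module.Basis (Fin (polyDim (k + 1) n)) ℂ (PolySpace (k + 1) n))
    {ν : Measure (Fin (polyDim (k + 1) n) → ℂ)} [IsProbabilityMeasure ν] (hν : ν ≪ volume)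
    {M : NNReal} (hM : ∀ w : Fin (polyDim (k + 1) n) → ℂ, ∑ j, ‖w j‖ ^ 2 = 1 →
      ∫⁻ a, ENNReal.ofReal (Real.log ‖∑ j, a j * w j‖ ^ 2) ∂ν ≤ M) :
    (∀ᵐ a ∂ν, Integrable (tangentialDensity (zeroSet (randomPoly p a)) φ.form)
      (surfaceMeasure (zeroSet (randomPoly p a)))) ∧
    MemLp (zeroStatistic p φ) 2 ν ∧
    Var[zeroStatistic p φ; ν] ≤
      ((∫ z, ∑ i, |h i z|) + 1) * (M * ∫ z, ∑ i, |h i z|) / (n : ℝ) ^ 2 := by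
  obtain ⟨u, huc, hu1, hpu⟩ := exists_unit_linearForm p
  set F : (Fin (polyDim (k + 1) n) → ℂ) → CSpace (k + 1) → ℝ := fun a z =>
    Real.log ‖∑ j, a j * u z j‖ with hF
  have hSc : Continuous fun x : (Fin (polyDim (k + 1) n) → ℂ) × CSpace (k + 1) =>
      ∑ j, x.1 j * u x.2 j :=
    continuous_finsetSum _ fun j _ =>
      ((continuous_apply j).comp continuous_fst).mul ((huc j).comp continuous_snd)
  have hFm : Measurable (Function.uncurry F) :=
    Real.measurable_log.comp hSc.norm.measurable
  have hFa : ∀ a, Measurable (F a) := fun a => hFm.of_uncurry_left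
  set w : CSpace (k + 1) → ℝ := fun z => ∑ i, |h i z| with hw
  have hwc : Continuous w := continuous_finsetSum _ fun i _ => (hc i).abs
  have hw0 : ∀ z, 0 ≤ w z := fun z => Finset.sum_nonneg fun i _ => abs_nonneg _
  have hwi : Integrable w := integrable_finsetSum _ fun i _ =>
    ((hc i).integrable_of_hasCompactSupport (hs i)).abs
  set ψ : CSpace (k + 1) → ℝ := fun z => ∑ i, h i z with hψ
  have hψc : Continuous ψ := continuous_finsetSum _ fun i _ => hc i
  obtain ⟨hint, hmain⟩ := memLp_integral_mul_of_lintegral_sq_le hFm (fun z => hM (u z) (hu1 z))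
    hwc.measurable hw0 hwi
  obtain ⟨hY, hY2⟩ := hmain ψ hψc.measurable fun z => Finset.abs_sum_le_sum_abs _ _
  have hne : ∀ᵐ a ∂ν, ∀ᵐ z, ∑ j, a j * u z j ≠ 0 := by
    have h1 : ∀ z, ∀ᵐ a ∂ν, ∑ j, a j * u z j ≠ 0 := fun z => by
      refine hν ?_
      have : u z ≠ 0 := fun h0 => by simpa [h0] using hu1 z
      have h2 := volume_linearForm_eq_zero this
      rwa [← compl_compl {a : Fin (polyDim (k + 1) n) → ℂ | ∑ j, a j * u z j = 0}] at h2
    refine (Measure.ae_ae_comm ?_).2 (ae_of_all _ h1)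
    exact (isOpen_ne_fun hSc continuous_const).measurableSet
  have hreg := hν.ae_le (ae_forall_fderiv_polyEval_ne_zero p hn)
  have hlog : ∀ᵐ a ∂ν, ∀ᵐ z, Real.log ‖polyEval (randomPoly p a) z‖ =
      Real.log (basisNorm p z) + F a z := by
    filter_upwards [hne] with a ha
    filter_upwards [ha] with z hz
    rw [hpu, norm_mul, Complex.norm_real, Real.norm_of_nonneg (basisNorm_pos p z).le,
      Real.log_mul (basisNorm_pos p z).ne' (norm_ne_zero_iff.2 hz)]
  have hlc : Continuous fun z => Real.log (basisNorm p z) :=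
    (continuous_basisNorm p).log fun z => (basisNorm_pos p z).ne'
  have hli : ∀ i, Integrable fun z => Real.log (basisNorm p z) * h i z := fun i =>
    (hlc.mul (hc i)).integrable_of_hasCompactSupport
      ((hs i).mul_left (f := fun z => Real.log (basisNorm p z)))
  have hFi : ∀ᵐ a ∂ν, ∀ i, Integrable fun z => F a z * h i z := by
    filter_upwards [hint] with a ha i
    exact integrable_mul_of_abs_le (hFa a) (hc i).measurable ha fun z =>
      Finset.single_le_sum (f := fun i => |h i z|) (fun i _ => abs_nonneg _) (Finset.mem_univ i)
  have hpair : ∀ᵐ a ∂ν, Integrable (tangentialDensity (zeroSet (randomPoly p a)) φ.form)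
      (surfaceMeasure (zeroSet (randomPoly p a))) ∧ currentPairing (randomPoly p a) φ =
        (∫ z, Real.log (basisNorm p z) * ψ z) + ∫ z, F a z * ψ z := by
    filter_upwards [hreg, hlog, hFi] with a h1 h2 h3
    have h4 : ∀ i, Integrable fun z => Real.log ‖polyEval (randomPoly p a) z‖ * h i z :=
      fun i => ((hli i).add (h3 i)).congr (h2.mono fun z hz => by
        simp only [Pi.add_apply]; rw [hz, add_mul])
    refine (hφ _ h1 h4).imp_right fun h5 => ?_
    have e1 : Integrable fun z => Real.log (basisNorm p z) * ψ z := by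
      simp only [hψ, Finset.mul_sum]
      exact integrable_finsetSum _ fun i _ => hli i
    have e2 : Integrable fun z => F a z * ψ z := by
      simp only [hψ, Finset.mul_sum]
      exact integrable_finsetSum _ fun i _ => h3 i
    rw [h5, ← integral_add e1 e2]
    exact integral_congr_ae (h2.mono fun z hz => by
      simp only [hψ] at hz ⊢
      rw [hz, add_mul])
  have hX : zeroStatistic p φ =ᵐ[ν] fun a => (1 / (n : ℝ)) * (∫ z, F a z * ψ z) +
      (1 / (n : ℝ)) * ∫ z, Real.log (basisNorm p z) * ψ z := by
    filter_upwards [hpair] with a ha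
    rw [zeroStatistic, ha.2]
    ring
  refine ⟨hpair.mono fun a ha => ha.1, (memLp_congr_ae hX).2
    ((hY.const_mul _).add (memLp_const _)), ?_⟩
  rw [variance_congr hX, variance_add_const (hY.const_mul _).1, variance_const_mul, div_pow, one_pow,
    one_div_mul_eq_div]
  gcongr
  exact (variance_le_expectation_sq hY.1).trans hY2

end Statistic

theorem theorem6 (m : ℕ) (hm : 1 ≤ m)
    (μ : (d : ℕ) → MeasureTheory.Measure (Fin d → ℂ))
    (hμ : μ = complexGaussian ∨ μ = fubiniStudy)
    (φ : TestForm m) :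
    ∃ C : ℝ,
      ∀ (K : Set (CSpace m)) (_ : IsCompact K) (_ : IsLocallyRegular K)
        (q : CSpace m → ℝ) (_ : ContinuousOn q K)
        (p : (n : ℕ) → Module.Basis (Fin (polyDim m n)) ℂ (PolySpace m n))
        (_ : ∀ n : ℕ, 1 ≤ n → ∀ j, ∀ z ∈ K,
          ‖polyEval (p n j : MvPolynomial (Fin m) ℂ) z‖ * Real.exp (-(n : ℝ) * q z) ≤ 1)
        (n : ℕ) (_ : 1 ≤ n),
        (∀ᵐ a ∂(μ (polyDim m n)),
          MeasureTheory.Integrable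
            (tangentialDensity (zeroSet (randomPoly (p n) a)) φ.form)
            (surfaceMeasure (zeroSet (randomPoly (p n) a)))) ∧
        MeasureTheory.MemLp (zeroStatistic (p n) φ) 2 (μ (polyDim m n)) ∧
        ProbabilityTheory.variance (zeroStatistic (p n) φ) (μ (polyDim m n)) ≤ C / (n : ℝ) ^ 2 := by
  obtain ⟨k, rfl⟩ := Nat.exists_eq_add_of_le' hm
  obtain ⟨N, h, hc, hs, hφ⟩ := exists_currentPairing_eq_integral_log φ
  obtain ⟨M, hM⟩ := exists_bound_sq_log_linearForm hμ
  have hprob : ∀ d, IsProbabilityMeasure (μ d) := by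
    rcases hμ with rfl | rfl
    exacts [isProbabilityMeasure_complexGaussian, isProbabilityMeasure_fubiniStudy]
  have hac : ∀ d, μ d ≪ volume := by
    rcases hμ with rfl | rfl <;> exact fun d => withDensity_absolutelyContinuous _ _
  refine ⟨((∫ z, ∑ i, |h i z|) + 1) * (M * ∫ z, ∑ i, |h i z|),
    fun K _ _ q _ p _ n hn => ?_⟩
  have := hprob (polyDim (k + 1) n)
  exact variance_zeroStatistic_le hc hs hφ hn (p n) (hac _) (hM _)
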